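/- Let $d \ge 2$ and let $r, s \in (1,\infty)$ satisfy $\frac{2}{r} + \frac{d}{s} < \frac{d}{2}$. Then there exist a measurable, elliptic coefficient matrix $B : [0,1]\times\mathbb{R}^d \to \mathbb{C}^{d\times d}$ and a forcing term $f \in L^\infty(0,1;L^2(\mathbb{R}^d))$ such that the problem $$u' - \operatorname{div}(B\nabla u) = f \ \text{ on } (0,1), \qquad u(0) = 0,$$ has a unique solution $u \in L^2(0,1;H^1(\mathbb{R}^d)) \cap H^1(0,1;H^{-1}(\mathbb{R}^d))$, and this solution satisfies $u \notin L^r(0,1;L^s(\mathbb{R}^d))$. Here all function spaces consist of complex-valued functions, and $H^{-1}(\mathbb{R}^d)$ is the space of bounded antilinear functionals on $H^1(\mathbb{R}^d)$. Elliptic means that there are constants $\Lambda, \lambda > 0$ with $$|B(t,x)\xi| \le \Lambda|\xi|, \qquad \operatorname{Re}\,\big(B(t,x)\xi\cdot\overline{\xi}\big) \ge \lambda|\xi|^2 \qquad (t\in[0,1],\ x\in\mathbb{R}^d,\ \xi\in\mathbb{C}^d).$$ For $v \in H^1(\mathbb{R}^d)$, $\operatorname{div}(B(t)\nabla v) \in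 H^{-1}(\mathbb{R}^d)$ is the functional $\varphi \mapsto -\int_{\mathbb{R}^d} B(t,x)\nabla v(x)\cdot\overline{\nabla\varphi(x)}\,dx$, and $L^2(\mathbb{R}^d)$ is embedded in $H^{-1}(\mathbb{R}^d)$ by $h \mapsto \big(\varphi\mapsto\int h\,\overline{\varphi}\big)$. A function $u \in L^2(0,1;H^1(\mathbb{R}^d)) \cap H^1(0,1;H^{-1}(\mathbb{R}^d))$ is a solution if its representative that is continuous on $[0,1]$ with values in $H^{-1}(\mathbb{R}^d)$ satisfies $$u(t) - \int_0^t \operatorname{div}(B(\tau)\nabla u(\tau))\,d\tau = \int_0^t f(\tau)\,d\tau \qquad (t\in[0,1]),$$ with Bochner integrals in $H^{-1}(\mathbb{R}^d)$. -/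

import Mathlib

open MeasureTheory
open scoped ENNReal ContDiff

noncomputable section

namespace Parabolic

/-- Lebesgue measure on the time interval `(0,1)`. -/
abbrev timeMeasure : Measure ℝ := volume.restrict (Set.Ioo (0 : ℝ) 1)

/-- The Hilbert space `L²(ℝ^d; ℂ)`. -/
abbrev L2 (d : ℕ) : Type := Lp ℂ 2 (volume : Measure (EuclideanSpace ℝ (Fin d)))

/-- The Hilbert space `L²(ℝ^d; ℂ^d)`. -/
abbrev L2Vec (d : ℕ) : Type :=
  Lp (EuclideanSpace ℂ (Fin d)) 2 (volume : Measure (EuclideanSpace ℝ (Fin d)))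

/-- `g` is the weak gradient of `v`: `∫ v ∂ᵢφ = -∫ gᵢ φ` for every test function `φ` and every
coordinate `i`. -/
def IsWeakGradient {d : ℕ} (v : L2 d) (g : L2Vec d) : Prop :=
  ∀ φ : EuclideanSpace ℝ (Fin d) → ℝ, ContDiff ℝ ∞ φ → HasCompactSupport φ → ∀ i : Fin d,
    ∫ x, (fderiv ℝ φ x (EuclideanSpace.single i 1)) • v x = -∫ x, φ x • (g x) i

lemma integrable_test_smul {d : ℕ} {F : Type*} [NormedAddCommGroup F] [NormedSpace ℝ F]
    {ψ : EuclideanSpace ℝ (Fin d) → ℝ} (hψ : Continuous ψ) (hc : HasCompactSupport ψ)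
    (v : Lp F 2 (volume : Measure (EuclideanSpace ℝ (Fin d)))) :
    Integrable (fun x => ψ x • v x) :=
  ((Lp.memLp v).locallyIntegrable (by norm_num)).integrable_smul_left_of_hasCompactSupport hψ hc

lemma integrable_test_smul_coord {d : ℕ} {ψ : EuclideanSpace ℝ (Fin d) → ℝ}
    (hψ : Continuous ψ) (hc : HasCompactSupport ψ) (g : L2Vec d) (i : Fin d) :
    Integrable (fun x => ψ x • (g x) i) := by
  have h := integrable_test_smul hψ hc g
  exact ((EuclideanSpace.proj (𝕜 := ℂ) i).restrictScalars ℝ).integrable_comp h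

lemma continuous_test_deriv {d : ℕ} {φ : EuclideanSpace ℝ (Fin d) → ℝ} (hφ : ContDiff ℝ ∞ φ)
    (e : EuclideanSpace ℝ (Fin d)) : Continuous (fun x => fderiv ℝ φ x e) :=
  (hφ.continuous_fderiv (by simp)).clm_apply continuous_const

/-- The Sobolev space `H¹(ℝ^d)`, realised as the space of pairs `(v, ∇v)` in
`L²(ℝ^d; ℂ) × L²(ℝ^d; ℂ^d)` in which the second entry is the weak gradient of the first.
The norm inherited from the Hilbert sum is `(‖v‖² + ‖∇v‖²)^{1/2}`. -/
def sobolevH1 (d : ℕ) : Submodule ℂ (WithLp 2 (L2 d × L2Vec d)) where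
  carrier := {p | IsWeakGradient p.fst p.snd}
  zero_mem' := by
    intro φ _ _ i
    have h1 : ∫ x, (fderiv ℝ φ x (EuclideanSpace.single i 1)) • (0 : L2 d) x = 0 := by
      rw [← integral_zero (EuclideanSpace ℝ (Fin d)) ℂ (μ := volume)]
      refine integral_congr_ae ?_
      filter_upwards [Lp.coeFn_zero ℂ 2 (volume : Measure (EuclideanSpace ℝ (Fin d)))] with x hx
      rw [hx]; simp
    have h2 : ∫ x, φ x • ((0 : L2Vec d) x) i = 0 := by
      rw [← integral_zero (EuclideanSpace ℝ (Fin d)) ℂ (μ := volume)]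
      refine integral_congr_ae ?_
      filter_upwards [Lp.coeFn_zero (EuclideanSpace ℂ (Fin d)) 2
        (volume : Measure (EuclideanSpace ℝ (Fin d)))] with x hx
      rw [hx]; simp
    change ∫ x, (fderiv ℝ φ x (EuclideanSpace.single i 1)) • (0 : L2 d) x
      = -∫ x, φ x • ((0 : L2Vec d) x) i
    rw [h1, h2, neg_zero]
  add_mem' := by
    intro p q hp hq φ hφ hc i
    have hd := continuous_test_deriv hφ (EuclideanSpace.single i 1)
    have hdc : HasCompactSupport (fun x => fderiv ℝ φ x (EuclideanSpace.single i 1)) :=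
      hc.fderiv_apply (𝕜 := ℝ) _
    have h1 : ∫ x, (fderiv ℝ φ x (EuclideanSpace.single i 1)) • (p.fst + q.fst) x
        = (∫ x, (fderiv ℝ φ x (EuclideanSpace.single i 1)) • p.fst x)
          + ∫ x, (fderiv ℝ φ x (EuclideanSpace.single i 1)) • q.fst x := by
      rw [← integral_add (integrable_test_smul hd hdc _) (integrable_test_smul hd hdc _)]
      refine integral_congr_ae ?_
      filter_upwards [Lp.coeFn_add p.fst q.fst] with x hx
      rw [hx, Pi.add_apply, smul_add]
    have h2 : ∫ x, φ x • ((p.snd + q.snd) x) i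
        = (∫ x, φ x • (p.snd x) i) + ∫ x, φ x • (q.snd x) i := by
      rw [← integral_add (integrable_test_smul_coord hφ.continuous hc _ _)
        (integrable_test_smul_coord hφ.continuous hc _ _)]
      refine integral_congr_ae ?_
      filter_upwards [Lp.coeFn_add p.snd q.snd] with x hx
      rw [hx, Pi.add_apply, PiLp.add_apply, smul_add]
    change ∫ x, (fderiv ℝ φ x (EuclideanSpace.single i 1)) • (p.fst + q.fst) x
      = -∫ x, φ x • ((p.snd + q.snd) x) i
    rw [h1, h2, hp φ hφ hc i, hq φ hφ hc i, neg_add]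
  smul_mem' := by
    intro c p hp φ hφ hc i
    have h1 : ∫ x, (fderiv ℝ φ x (EuclideanSpace.single i 1)) • (c • p.fst) x
        = c * ∫ x, (fderiv ℝ φ x (EuclideanSpace.single i 1)) • p.fst x := by
      rw [← integral_const_mul]
      refine integral_congr_ae ?_
      filter_upwards [Lp.coeFn_smul c p.fst] with x hx
      rw [hx, Pi.smul_apply, smul_eq_mul, mul_smul_comm]
    have h2 : ∫ x, φ x • ((c • p.snd) x) i = c * ∫ x, φ x • (p.snd x) i := by
      rw [← integral_const_mul]
      refine integral_congr_ae ?_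
      filter_upwards [Lp.coeFn_smul c p.snd] with x hx
      rw [hx, Pi.smul_apply, PiLp.smul_apply, smul_eq_mul, mul_smul_comm]
    change ∫ x, (fderiv ℝ φ x (EuclideanSpace.single i 1)) • (c • p.fst) x
      = -∫ x, φ x • ((c • p.snd) x) i
    rw [h1, h2, hp φ hφ hc i, mul_neg]

/-- The space `V = H¹(ℝ^d)`. -/
abbrev H1 (d : ℕ) : Type := ↥(sobolevH1 d)

instance instNormedAddCommGroupH1 (d : ℕ) : NormedAddCommGroup (H1 d) := inferInstance

instance instInnerProductSpaceH1 (d : ℕ) : InnerProductSpace ℂ (H1 d) := inferInstance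

/-- The inclusion `H¹(ℝ^d) → L²(ℝ^d)`. -/
def H1.toL2 (d : ℕ) : H1 d →L[ℂ] L2 d :=
  (WithLp.fstL 2 ℂ (L2 d) (L2Vec d)).comp (sobolevH1 d).subtypeL

/-- The weak gradient `∇ : H¹(ℝ^d) → L²(ℝ^d; ℂ^d)`. -/
def H1.grad (d : ℕ) : H1 d →L[ℂ] L2Vec d :=
  (WithLp.sndL 2 ℂ (L2 d) (L2Vec d)).comp (sobolevH1 d).subtypeL

/-- `V* = H⁻¹(ℝ^d)`: the space of bounded antilinear functionals on `H¹(ℝ^d)`, with the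
operator norm. -/
abbrev HNeg1 (d : ℕ) : Type := H1 d →L⋆[ℂ] ℂ

instance instNormedAddCommGroupHNeg1 (d : ℕ) : NormedAddCommGroup (HNeg1 d) := inferInstance

instance instNormedSpaceHNeg1 (d : ℕ) : NormedSpace ℂ (HNeg1 d) := inferInstance

/-- The embedding `L²(ℝ^d) → H⁻¹(ℝ^d)`, which sends `h` to the functional `φ ↦ ∫ h φ̄`. -/
def HNeg1.ofL2 {d : ℕ} (h : L2 d) : HNeg1 d :=
  (innerSLFlip ℂ h).comp (H1.toL2 d)

/-- The divergence `L²(ℝ^d; ℂ^d) → H⁻¹(ℝ^d)`, which sends `G` to the functional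
`φ ↦ -∫ G · conj (∇φ)`. -/
def HNeg1.div {d : ℕ} (G : L2Vec d) : HNeg1 d :=
  -((innerSLFlip ℂ G).comp (H1.grad d))

/-- Time-dependent coefficients: `B t x` is a complex `d × d` matrix. Only the values for
`t ∈ [0,1]` matter. -/
abbrev Coeff (d : ℕ) : Type :=
  ℝ → EuclideanSpace ℝ (Fin d) → Matrix (Fin d) (Fin d) ℂ

/-- `B : [0,1] × ℝ^d → ℂ^{d×d}` is measurable and elliptic: for some `Λ, λ > 0`,
`|B(t,x) ξ| ≤ Λ |ξ|` and `Re (B(t,x) ξ · conj ξ) ≥ λ |ξ|²` for all `t ∈ [0,1]`, `x`, `ξ`. -/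
structure IsElliptic {d : ℕ} (B : Coeff d) : Prop where
  measurable : ∀ i j, Measurable fun p : ℝ × EuclideanSpace ℝ (Fin d) => B p.1 p.2 i j
  bounds : ∃ Lam lam : ℝ, 0 < Lam ∧ 0 < lam ∧
    ∀ t ∈ Set.Icc (0 : ℝ) 1, ∀ (x : EuclideanSpace ℝ (Fin d)) (ξ : EuclideanSpace ℂ (Fin d)),
      ‖Matrix.toEuclideanLin (B t x) ξ‖ ≤ Lam * ‖ξ‖ ∧
      lam * ‖ξ‖ ^ 2 ≤ (inner ℂ ξ (Matrix.toEuclideanLin (B t x) ξ)).re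

/-- For elliptic `B`, multiplication by `B(t,·)`, `t ∈ [0,1]`, maps `L²` to `L²`. -/
lemma IsElliptic.memLp_mul {d : ℕ} {B : Coeff d} (hB : IsElliptic B) {t : ℝ}
    (ht : t ∈ Set.Icc (0 : ℝ) 1) (g : L2Vec d) :
    MemLp (fun x => Matrix.toEuclideanLin (B t x) (g x)) 2
      (volume : Measure (EuclideanSpace ℝ (Fin d))) := by
  obtain ⟨Lam, lam, -, -, h⟩ := hB.bounds
  refine (Lp.memLp g).of_le_mul (c := Lam) ?_ (Filter.Eventually.of_forall fun x => (h t ht x _).1)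
  have hg : AEMeasurable (fun x => g x) (volume : Measure (EuclideanSpace ℝ (Fin d))) :=
    (Lp.aestronglyMeasurable g).aemeasurable
  have hgi : ∀ j, AEMeasurable (fun x => (g x) j)
      (volume : Measure (EuclideanSpace ℝ (Fin d))) := fun j =>
    (EuclideanSpace.proj (𝕜 := ℂ) j).continuous.measurable.comp_aemeasurable hg
  have hBm : ∀ i j, Measurable fun x => B t x i j := fun i j =>
    (hB.measurable i j).comp measurable_prodMk_left
  refine AEMeasurable.aestronglyMeasurable ?_
  have key : AEMeasurable (fun x => (fun i => ∑ j, B t x i j * (g x) j : Fin d → ℂ))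
      (volume : Measure (EuclideanSpace ℝ (Fin d))) :=
    aemeasurable_pi_lambda _ fun i => Finset.aemeasurable_fun_sum _ fun j _ =>
      (hBm i j).aemeasurable.mul (hgi j)
  exact (PiLp.continuous_toLp 2 (fun _ : Fin d => ℂ)).measurable.comp_aemeasurable key

open Classical in
/-- The product `B(t,·) g` as an element of `L²(ℝ^d; ℂ^d)`. The second branch never occurs for
elliptic `B` and `t ∈ [0,1]`, see `IsElliptic.memLp_mul`. -/
def coeffMul {d : ℕ} (B : Coeff d) (t : ℝ) (g : L2Vec d) : L2Vec d :=
  if h : MemLp (fun x => Matrix.toEuclideanLin (B t x) (g x)) 2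
      (volume : Measure (EuclideanSpace ℝ (Fin d)))
  then h.toLp _ else 0

/-- The operator `v ↦ div (B(t,·) ∇v)` from `H¹(ℝ^d)` to `H⁻¹(ℝ^d)`. -/
def divForm {d : ℕ} (B : Coeff d) (t : ℝ) (v : H1 d) : HNeg1 d :=
  HNeg1.div (coeffMul B t (H1.grad d v))

/-- `U ∈ H¹(0,1; X)`, for the absolutely continuous representative: `U` and its derivative `g`
are in `L²(0,1; X)` and `U` is the primitive of `g` on `[0,1]`. -/
def MemH1Time {X : Type*} [NormedAddCommGroup X] [NormedSpace ℝ X] (U : ℝ → X) : Prop :=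
  MemLp U 2 timeMeasure ∧ ∃ g : ℝ → X, MemLp g 2 timeMeasure ∧
    ∀ t ∈ Set.Icc (0 : ℝ) 1, U t = U 0 + ∫ s in (0 : ℝ)..t, g s

/-- `u ∈ L²(0,1; H¹) ∩ H¹(0,1; H⁻¹)` is a (Lions) solution of `u' - div (B ∇u) = f` on `(0,1)`,
`u(0) = 0`: the representative `U` of `u` that is continuous with values in `H⁻¹` satisfies
`U(t) - ∫₀ᵗ div (B ∇u) ds = ∫₀ᵗ f ds` for all `t ∈ [0,1]`, with Bochner integrals in `H⁻¹`. -/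
structure IsLionsSolution {d : ℕ} (B : Coeff d) (f : ℝ → L2 d) (u : ℝ → H1 d) : Prop where
  memLp : MemLp u 2 timeMeasure
  integrable_divForm : IntervalIntegrable (fun s => divForm B s (u s)) volume 0 1
  integrable_force : IntervalIntegrable (fun s => HNeg1.ofL2 (f s)) volume 0 1
  exists_representative : ∃ U : ℝ → HNeg1 d, MemH1Time U ∧
    (∀ᵐ t ∂timeMeasure, U t = HNeg1.ofL2 (H1.toL2 d (u t))) ∧
    ∀ t ∈ Set.Icc (0 : ℝ) 1,
      U t - ∫ s in (0 : ℝ)..t, divForm B s (u s) = ∫ s in (0 : ℝ)..t, HNeg1.ofL2 (f s)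

/-- `w ∈ L^r(0,1; L^s(ℝ^d))`, for a strongly measurable `w : (0,1) → L²(ℝ^d)`:
`∫₀¹ ‖w(t)‖_{L^s}^r dt < ∞`. -/
def MemLrLs {d : ℕ} (r s : ℝ) (w : ℝ → L2 d) : Prop :=
  ∫⁻ t in Set.Ioo (0 : ℝ) 1,
      (eLpNorm (w t) (ENNReal.ofReal s) (volume : Measure (EuclideanSpace ℝ (Fin d)))) ^ r < ⊤

end Parabolic

end

/-! ### The slow phase and the ellipticity inequality -/

namespace Parabolic

/-! The counterexample is a self-similar blow-up at `t = 1`, `x = 0`. With `τ = 1 - t`, the ansatz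
`τ^(-γ) φ(|x|²/τ)` and the scalar coefficient `a(|x|²/τ)` turn the homogeneous equation into the
profile equation `γ φ + s φ' = D g + 2 s g'`, where `g = 2 a φ'` and `D = d`. On a ball `|x|² ≤ s₀
τ` the function has size `τ^(-γ)`, so its `L^s` norm is at least `c τ^(-γ + d/(2s))`. For `γ = 1/r +
d/(2s)` the `r`-th power of this is a multiple of `1/τ`, which is not integrable. The hypothesis on
`r, s` says exactly `γ < d/4`. Then `|x|^(-2γ)` is locally square integrable, which gives `f ∈
L^∞(L²)` and, with a little room to spare, `u ∈ L²(H¹)`.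

The profile equation is solved backwards, with the coefficient as output. Writing `φ = (D - 2γ) y +
2 g` reduces it to `g = γ y + s y'`. Take `m = y'/g` as free datum and `P = 1 - s m`. Then `g = γ y
/ P`, `y'/y = γ m / P`, and `1/(2a) = φ'/g = (D - 2γ) m + 2 g'/g` is the function `A = recipCoeff D
γ m P`. All is explicit once `P` has no zero, and ellipticity amounts to `Re A > 0` together with
control at infinity.

Decay `y ~ s^(-γ)` wants `s m / P → -1`. If `m → η` is real, then `A → (D - 2γ) η` forces `η > 0`,
so `P ~ -η s`, although `P(0) = 1`. A real `P` would have to vanish in between; this is where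
complex coefficients enter. The choice `P = e^{iθ(s)} - η s` leads `P` around the origin while `θ`
grows from `0` to `π`, slowly in `log s`, with `η` small. To leading order `s Re A` is then `(D -
4γ)(1 - cos θ)`, a second use of `γ < D/4`; where `cos θ` is near `1` the terms in `η` take over
(`exists_symbol`, `exists_selfSimilarProfile`).

A cutoff in `|x|²` and a factor `t`, which gives `u(0) = 0`, produce a forcing term no more singular
than `|x|^(-2γ)` (`SelfSimilarProfile.timeDeriv_eq`, `exists_norm_bounds`, `isLionsSolution_sol`,
`not_memLrLs_sol`).

Uniqueness is the energy argument. The difference `w` of two solutions is the primitive of `G = div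
(B ∇w)`, so the integrated pairing of `G` with `w` is nonnegative (`integral_pairing_nonneg`), while
ellipticity bounds it above by `-λ ∫ ‖∇w‖²` (`IsLionsSolution.ae_eq`). -/

lemma deriv_smoothTransition_of_nonpos {x : ℝ} (hx : x < 0) :
    deriv Real.smoothTransition x = 0 := by
  have h : Real.smoothTransition =ᶠ[nhds x] fun _ => 0 := by
    filter_upwards [Iio_mem_nhds hx] with z hz
    exact Real.smoothTransition.zero_of_nonpos (le_of_lt hz)
  rw [h.deriv_eq]; simp

lemma deriv_smoothTransition_of_one_le {x : ℝ} (hx : 1 < x) :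
    deriv Real.smoothTransition x = 0 := by
  have h : Real.smoothTransition =ᶠ[nhds x] fun _ => 1 := by
    filter_upwards [Ioi_mem_nhds hx] with z hz
    exact Real.smoothTransition.one_of_one_le (le_of_lt hz)
  rw [h.deriv_eq]; simp

lemma exists_bound_deriv_smoothTransition :
    ∃ C : ℝ, 0 < C ∧ ∀ x, |deriv Real.smoothTransition x| ≤ C := by
  have hc : Continuous (deriv Real.smoothTransition) :=
    (Real.smoothTransition.contDiff (n := 1)).continuous_deriv le_rfl
  obtain ⟨C, hC⟩ := (isCompact_Icc (a := (0 : ℝ)) (b := 1)).exists_bound_of_continuousOn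
    hc.continuousOn
  refine ⟨max C 1, by positivity, fun x => ?_⟩
  rcases lt_or_ge x 0 with h | h
  · rw [deriv_smoothTransition_of_nonpos h]; simp
  rcases lt_or_ge 1 x with h' | h'
  · rw [deriv_smoothTransition_of_one_le h']; simp
  · exact (hC x ⟨h, h'⟩).trans (le_max_left _ _)

/-- A smooth phase which rotates from `0` to `π` arbitrarily slowly on a logarithmic scale. -/
lemma exists_slow_phase (κ : ℝ) (hκ : 0 < κ) :
    ∃ (ph : ℝ → ℝ) (S : ℝ), 1 ≤ S ∧ ContDiff ℝ ∞ ph ∧ (∀ s ≤ 1, ph s = 0) ∧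
      (∀ s, S ≤ s → ph s = Real.pi) ∧ ∀ s, |s * deriv ph s| ≤ κ := by
  obtain ⟨C, hC, hT⟩ := exists_bound_deriv_smoothTransition
  -- `arsinh` serves as a logarithm that is smooth on the whole line: `|s| * arsinh' s = |s| / √(1 +
  -- s²) ≤ 1`. Dividing it by `N` makes the logarithmic speed of the phase at most `π C / N = κ`.
  set N : ℝ := Real.pi * C / κ with hN
  have hNpos : 0 < N := by have := Real.pi_pos; positivity
  have hder : ∀ s, HasDerivAt (fun s => Real.pi * Real.smoothTransition
      ((Real.arsinh s - Real.arsinh 1) / N))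
      (Real.pi * (deriv Real.smoothTransition ((Real.arsinh s - Real.arsinh 1) / N)
        * ((√(1 + s ^ 2))⁻¹ / N))) s := fun s => by
    have h1 := ((Real.hasDerivAt_arsinh s).sub_const (Real.arsinh 1)).div_const N
    have h2 : HasDerivAt Real.smoothTransition (deriv Real.smoothTransition
        ((Real.arsinh s - Real.arsinh 1) / N)) ((Real.arsinh s - Real.arsinh 1) / N) :=
      ((Real.smoothTransition.contDiff (n := 1)).differentiable (by simp) _).hasDerivAt
    exact (h2.comp s h1).const_mul Real.pi
  refine ⟨fun s => Real.pi * Real.smoothTransition ((Real.arsinh s - Real.arsinh 1) / N),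
    Real.sinh (N + Real.arsinh 1), ?_, ?_, ?_, ?_, ?_⟩
  · calc (1 : ℝ) = Real.sinh (Real.arsinh 1) := (Real.sinh_arsinh 1).symm
      _ ≤ _ := Real.sinh_le_sinh.2 (by linarith)
  · exact contDiff_const.mul (Real.smoothTransition.contDiff.comp
      ((Real.contDiff_arsinh.sub contDiff_const).div_const N))
  · intro s hs
    have : Real.arsinh s ≤ Real.arsinh 1 := Real.arsinh_le_arsinh.2 hs
    simp only
    rw [Real.smoothTransition.zero_of_nonpos, mul_zero]
    exact div_nonpos_of_nonpos_of_nonneg (by linarith) hNpos.le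
  · intro s hs
    have : N + Real.arsinh 1 ≤ Real.arsinh s := by
      rw [← Real.arsinh_sinh (N + Real.arsinh 1)]; exact Real.arsinh_le_arsinh.2 hs
    simp only
    rw [Real.smoothTransition.one_of_one_le, mul_one]
    rw [le_div_iff₀ hNpos]; linarith
  · intro s
    rw [(hder s).deriv]
    have hq : 0 < √(1 + s ^ 2) := Real.sqrt_pos.2 (by positivity)
    have hs : |s| * (√(1 + s ^ 2))⁻¹ ≤ 1 := by
      rw [← div_eq_mul_inv, div_le_one hq]
      exact Real.abs_le_sqrt (by linarith)
    have hpi := Real.pi_pos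
    calc |s * (Real.pi * (deriv Real.smoothTransition ((Real.arsinh s - Real.arsinh 1) / N)
        * ((√(1 + s ^ 2))⁻¹ / N)))|
        = Real.pi / N * (|deriv Real.smoothTransition ((Real.arsinh s - Real.arsinh 1) / N)|
          * (|s| * (√(1 + s ^ 2))⁻¹)) := by
          rw [abs_mul, abs_mul, abs_mul, abs_div, abs_of_pos hpi, abs_of_pos (inv_pos.2 hq),
            abs_of_pos hNpos]; ring
      _ ≤ Real.pi / N * (C * 1) := by
          gcongr
          exact hT _
      _ = κ := by rw [hN]; field_simp

/-- The ellipticity inequality for a slowly rotating phase, in real form: `c`, `n` are the cosine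
and sine of the phase, `θ` is its logarithmic speed and `x` is a small perturbation. -/
lemma phase_inequality {γ δ x c n θ : ℝ} (hγ : 0 < γ) (hδ : 0 < δ) (hx : 0 < x) (hx' : x < 1 / 4)
    (hx'' : x * (5 + 6 * γ) < δ / 4) (hcn : c ^ 2 + n ^ 2 = 1) (hθ : |θ| ≤ 1 / 4) :
    0 < 2 * x * (c - x - θ * n) + 2 * γ * x * (2 * c - x) * (c - x)
      + δ * (1 - c + x) * (1 - 2 * x * c + x ^ 2) := by
  have hc1 : c ≤ 1 := by nlinarith [sq_nonneg n]
  have hc2 : -1 ≤ c := by nlinarith [sq_nonneg n]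
  have hn1 : n ≤ 1 := by nlinarith [sq_nonneg c]
  have hn2 : -1 ≤ n := by nlinarith [sq_nonneg c]
  have hθn : |θ * n| ≤ 1 / 4 := by
    rw [abs_mul]
    have : |n| ≤ 1 := abs_le.2 ⟨hn2, hn1⟩
    nlinarith [abs_nonneg n, abs_nonneg θ]
  obtain ⟨ht1, ht2⟩ := abs_le.1 hθn
  have hD : (1 - x) ^ 2 ≤ 1 - 2 * x * c + x ^ 2 := by nlinarith
  have hD' : 1 / 2 ≤ 1 - 2 * x * c + x ^ 2 := by nlinarith
  -- For `c ≥ 1/2` the first term is positive since `x` and `θ n` are too small to cancel `c`, and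
  -- the others are nonnegative. For `c < 1/2` the last term is at least `δ / 4`, which absorbs the
  -- remaining terms of size `x`.
  rcases le_or_gt (1 / 2) c with h | h
  · have h1 : 0 < 2 * x * (c - x - θ * n) := by
      apply mul_pos (by linarith); linarith
    have h2 : 0 ≤ 2 * γ * x * (2 * c - x) * (c - x) := by
      apply mul_nonneg (mul_nonneg (by positivity) (by linarith)) (by linarith)
    have h3 : 0 ≤ δ * (1 - c + x) * (1 - 2 * x * c + x ^ 2) :=
      mul_nonneg (mul_nonneg hδ.le (by linarith)) (by linarith)
    linarith
  · have h1 : -(5 * x) ≤ 2 * x * (c - x - θ * n) := by nlinarith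
    have h2 : -(3 * x) ≤ (2 * c - x) * (c - x) := by nlinarith [sq_nonneg c]
    have h2' : -(6 * γ * x) ≤ 2 * γ * x * (2 * c - x) * (c - x) := by
      have := mul_le_mul_of_nonneg_left h2 (show 0 ≤ 2 * γ * x by positivity)
      nlinarith [mul_pos hγ hx]
    have h3 : δ / 4 ≤ δ * (1 - c + x) * (1 - 2 * x * c + x ^ 2) := by
      have : 1 / 2 * (1 / 2) ≤ (1 - c + x) * (1 - 2 * x * c + x ^ 2) :=
        mul_le_mul (by linarith) hD' (by norm_num) (by linarith)
      nlinarith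
    nlinarith

/-- The reciprocal (up to a factor `2`) of the elliptic coefficient attached to a symbol `m`, where
`P s = 1 - s * m s`. -/
noncomputable def recipCoeff (D γ : ℝ) (m P : ℝ → ℂ) (s : ℝ) : ℂ :=
  (D - 2 * γ) * m s + ((2 + 2 * γ) * m s + 2 * s * deriv m s) / P s

/-- Multiplying the real part by `s |P|²` gives exactly the expression of `phase_inequality` with `x
= η s`, `θ = s ph'` and `δ = D - 4γ`. The derivative of `m` enters only through `m + s m' = -P'`,
which carries no denominator. -/
lemma recipCoeff_re_pos_of_phase {D γ η s ph ph' : ℝ} {m P m' : ℂ} (hγ : 0 < γ)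
    (hδ : 0 < D - 4 * γ) (hη : 0 < η) (hs : 0 < s) (hx : η * s < 1 / 4)
    (hx' : η * s * (5 + 6 * γ) < (D - 4 * γ) / 4) (hph : |s * ph'| ≤ 1 / 4)
    (hm : m = η + (1 - Complex.exp (ph * Complex.I)) / s)
    (hP : P = Complex.exp (ph * Complex.I) - η * s)
    (hm' : m + s * m' = η - ph' * Complex.I * Complex.exp (ph * Complex.I)) :
    0 < ((D - 2 * γ) * m + ((2 + 2 * γ) * m + 2 * s * m') / P).re := by
  have hcn : Real.cos ph ^ 2 + Real.sin ph ^ 2 = 1 := Real.cos_sq_add_sin_sq ph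
  have key := phase_inequality hγ hδ (mul_pos hη hs) hx hx' hcn hph
  set c := Real.cos ph
  set n := Real.sin ph
  have he : Complex.exp (ph * Complex.I) = ⟨c, n⟩ := by
    apply Complex.ext
    · simp [Complex.exp_ofReal_mul_I_re, c]
    · simp [Complex.exp_ofReal_mul_I_im, n]
  have hmc : m = ⟨η + (1 - c) / s, -n / s⟩ := by
    rw [hm, he]
    apply Complex.ext <;> simp [Complex.div_ofReal_re, Complex.div_ofReal_im]
  have hPc : P = ⟨c - η * s, n⟩ := by
    rw [hP, he]
    apply Complex.ext <;> simp
  have hZ : (2 + 2 * γ) * m + 2 * s * m'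
      = ⟨2 * γ * (η + (1 - c) / s) + 2 * η + 2 * ph' * n, 2 * γ * (-n / s) - 2 * ph' * c⟩ := by
    have : (2 + 2 * γ) * m + 2 * s * m' = 2 * γ * m + 2 * (m + s * m') := by ring
    rw [this, hm', he, hmc]
    apply Complex.ext
    · simp; ring
    · simp; ring
  have hN : Complex.normSq P = 1 - 2 * (η * s) * c + (η * s) ^ 2 := by
    rw [hPc, Complex.normSq_mk]; linear_combination hcn
  have hc1 : c ≤ 1 := Real.cos_le_one ph
  have hNpos : 0 < Complex.normSq P := by
    rw [hN]; nlinarith [mul_pos hη hs]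
  have hre : ((D - 2 * γ) * m + ((2 + 2 * γ) * m + 2 * s * m') / P).re
      * (s * Complex.normSq P) = 2 * (η * s) * (c - η * s - s * ph' * n)
        + 2 * γ * (η * s) * (2 * c - η * s) * (c - η * s)
        + (D - 4 * γ) * (1 - c + η * s) * (1 - 2 * (η * s) * c + (η * s) ^ 2) := by
    rw [Complex.add_re, Complex.div_re, hZ]
    have h1 : (((D : ℂ) - 2 * γ) * m).re = (D - 2 * γ) * (η + (1 - c) / s) := by
      rw [hmc]; simp
    rw [h1]
    have hPre : P.re = c - η * s := by rw [hPc]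
    have hPim : P.im = n := by rw [hPc]
    have e1 : ∀ a b c N : ℝ, N ≠ 0 → (a + (b / N + c / N)) * (s * N) = s * (a * N + b + c) := by
      intro a b c N hN; field_simp; ring
    rw [e1 _ _ _ _ hNpos.ne', hN, hPre, hPim]
    have hn : n ^ 2 = 1 - c ^ 2 := by linarith
    have e2 : s * ((D - 2 * γ) * (η + (1 - c) / s) * (1 - 2 * (η * s) * c + (η * s) ^ 2)
        + (2 * γ * (η + (1 - c) / s) + 2 * η + 2 * ph' * n) * (c - η * s)
        + (2 * γ * (-n / s) - 2 * ph' * c) * n)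
        = (D - 2 * γ) * (η * s + (1 - c)) * (1 - 2 * (η * s) * c + (η * s) ^ 2)
        + (2 * γ * (η * s + (1 - c)) + 2 * η * s + 2 * s * ph' * n) * (c - η * s)
        - 2 * γ * n ^ 2 - 2 * s * ph' * c * n := by
      field_simp; ring
    rw [e2, hn]; ring
  rw [← hre] at key
  exact pos_of_mul_pos_left key (by positivity)

/-! ### The symbol `m` and positivity of the reciprocal coefficient -/

lemma hasDerivAt_ofReal (s : ℝ) : HasDerivAt (fun z : ℝ => (z : ℂ)) 1 s := by
  simpa using (hasDerivAt_id s).ofReal_comp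

lemma hasDerivAt_symbol_tail {η S s : ℝ} {m : ℝ → ℂ} (hS : 0 < S) (hs : S < s)
    (hm : ∀ s, S ≤ s → m s = η + 2 / s) : HasDerivAt m (-(2 / s ^ 2)) s := by
  have h1 : m =ᶠ[nhds s] fun z => (η : ℂ) + 2 * ((z : ℂ))⁻¹ := by
    filter_upwards [Ioi_mem_nhds hs] with z hz
    rw [hm z (le_of_lt hz)]; ring
  have h3 := (((hasDerivAt_ofReal s).inv
    (by simpa using (hS.trans hs).ne')).const_mul (2 : ℂ)).const_add (η : ℂ)
  exact HasDerivAt.congr_of_eventuallyEq (h3.congr_deriv (by ring)) h1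

lemma symbol_tail {η S s : ℝ} {m P : ℝ → ℂ} (hS : 0 < S) (hs : S ≤ s)
    (hm : ∀ s, S ≤ s → m s = η + 2 / s) (hPm : ∀ s, P s = 1 - s * m s) :
    P s = -((1 + η * s : ℝ) : ℂ) := by
  have : (s : ℂ) ≠ 0 := by exact_mod_cast (hS.trans_le hs).ne'
  rw [hPm, hm s hs]; push_cast; field_simp; ring

/-- Once the phase has reached `π`, everything is real and rational in `s`. This closed form gives
positivity of the tail and all limits at infinity. -/
lemma recipCoeff_tail {D γ η S s : ℝ} {m P : ℝ → ℂ} (hη : 0 < η) (hS : 0 < S) (hs : S < s)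
    (hm : ∀ s, S ≤ s → m s = η + 2 / s) (hPm : ∀ s, P s = 1 - s * m s) :
    recipCoeff D γ m P s = (((D - 2 * γ) * η + 2 * (D - 4 * γ) / s
        - 2 * (1 - γ) * η / (1 + η * s) : ℝ) : ℂ) := by
  have hs1 : 0 < s := hS.trans hs
  have hs0 : (s : ℂ) ≠ 0 := by exact_mod_cast hs1.ne'
  have hq : 0 < 1 + η * s := by positivity
  have hqc : (1 + η * s : ℂ) ≠ 0 := by exact_mod_cast hq.ne'
  have hPs : P s = -(1 + η * s) := by rw [symbol_tail hS hs.le hm hPm]; push_cast; ring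
  simp only [recipCoeff, (hasDerivAt_symbol_tail hS hs hm).deriv, hm s hs.le, hPs]; push_cast
  rw [div_neg]
  field_simp
  ring

/-- `P = e^{i ph} - η s` runs from `1` to `-∞` around the origin. It is positive before the rotation
and negative after it; during the rotation `|e^{i ph}| = 1` exceeds `η s`. Positivity of the real
part is required for all real `s`, so that the inverse is smooth on the whole line. -/
lemma exists_symbol (D γ : ℝ) (hD : 2 ≤ D) (hγ : 0 < γ) (hγ' : γ < D / 4) :
    ∃ (m P : ℝ → ℂ) (η S : ℝ), 0 < η ∧ 1 ≤ S ∧ ContDiff ℝ ∞ m ∧ ContDiff ℝ ∞ P ∧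
      (∀ s, P s = 1 - s * m s) ∧ (∀ s, P s ≠ 0) ∧ (∀ s, S ≤ s → m s = η + 2 / s) ∧
      ∀ s, 0 < (recipCoeff D γ m P s).re := by
  obtain ⟨ph, S, hS, hph, hph0, hphpi, hphκ⟩ := exists_slow_phase (1 / 4) (by norm_num)
  -- The smallness of `x = η s` demanded by `phase_inequality`, with strict room.
  set x₀ : ℝ := min (1 / 5) ((D - 4 * γ) / 8 / (5 + 6 * γ)) with hx₀
  have hδ : 0 < D - 4 * γ := by linarith
  have hx₀pos : 0 < x₀ := lt_min (by norm_num) (by positivity)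
  have hx₀1 : x₀ ≤ 1 / 5 := min_le_left _ _
  have hx₀2 : x₀ * (5 + 6 * γ) ≤ (D - 4 * γ) / 8 := by
    rw [← le_div_iff₀ (by positivity)]; exact min_le_right _ _
  -- This keeps `η s < x₀` up to `s = 2 S`, beyond the end of the rotation.
  set η : ℝ := x₀ / (2 * S) with hη
  have hηpos : 0 < η := by positivity
  have hηS : η * (2 * S) = x₀ := by rw [hη]; field_simp
  set e : ℝ → ℂ := fun s => Complex.exp (ph s * Complex.I) with he
  have hesm : ContDiff ℝ ∞ e :=
    ((Complex.ofRealCLM.contDiff.comp hph).mul contDiff_const).cexp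
  have he1 : ∀ s ≤ 1, e s = 1 := fun s hs => by simp [he, hph0 s hs]
  have hepi : ∀ s, S ≤ s → e s = -1 := fun s hs => by simp [he, hphpi s hs]
  set m : ℝ → ℂ := fun s => η + (1 - e s) / s with hm
  set P : ℝ → ℂ := fun s => e s - η * s with hP
  have hm1 : ∀ s ≤ 1, m s = η := fun s hs => by simp [hm, he1 s hs]
  have hmS : ∀ s, S ≤ s → m s = η + 2 / s := fun s hs => by simp only [hm, hepi s hs]; ring
  have hofR : ContDiff ℝ ∞ (fun s : ℝ => (s : ℂ)) := Complex.ofRealCLM.contDiff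
  have hmsm : ContDiff ℝ ∞ m := by
    rw [contDiff_iff_contDiffAt]
    intro s
    rcases lt_or_ge s 1 with h | h
    · have : m =ᶠ[nhds s] fun _ => (η : ℂ) := by
        filter_upwards [Iio_mem_nhds h] with z hz using hm1 z (le_of_lt hz)
      exact contDiffAt_const.congr_of_eventuallyEq this
    · have hs0 : (s : ℂ) ≠ 0 := by exact_mod_cast (by linarith : (s : ℝ) ≠ 0)
      have h1 : ContDiffAt ℝ ∞ (fun s : ℝ => ((s : ℂ))⁻¹) s := hofR.contDiffAt.inv hs0
      simp only [hm, div_eq_mul_inv]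
      exact contDiffAt_const.add ((contDiffAt_const.sub hesm.contDiffAt).mul h1)
  have hPsm : ContDiff ℝ ∞ P := hesm.sub (contDiff_const.mul hofR)
  have hPm : ∀ s, P s = 1 - s * m s := fun s => by
    rcases eq_or_ne s 0 with rfl | h
    · simp [hP, he1 0 (by norm_num)]
    · have : (s : ℂ) ≠ 0 := by exact_mod_cast h
      simp only [hP, hm]; field_simp; ring
  have henorm : ∀ s, ‖e s‖ = 1 := fun s => Complex.norm_exp_ofReal_mul_I _
  have hP0 : ∀ s, P s ≠ 0 := by
    intro s
    rcases le_or_gt s 1 with h | h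
    · have : P s = ((1 - η * s : ℝ) : ℂ) := by simp [hP, he1 s h]
      rw [this]
      have : 0 < 1 - η * s := by nlinarith
      exact_mod_cast this.ne'
    rcases le_or_gt S s with h' | h'
    · have : P s = ((-1 - η * s : ℝ) : ℂ) := by simp [hP, hepi s h']
      rw [this]
      have : -1 - η * s < 0 := by nlinarith
      exact_mod_cast this.ne
    · intro h0
      have h1 : e s = η * s := by simpa [hP, sub_eq_zero] using h0
      have h2 := henorm s
      rw [h1, ← Complex.ofReal_mul, Complex.norm_real, Real.norm_of_nonneg (by positivity)] at h2
      nlinarith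
  refine ⟨m, P, η, S, hηpos, hS, hmsm, hPsm, hPm, hP0, hmS, fun s => ?_⟩
  rcases lt_or_ge s 1 with h | h
  · have hd : deriv m s = 0 := by
      have : m =ᶠ[nhds s] fun _ => (η : ℂ) := by
        filter_upwards [Iio_mem_nhds h] with z hz using hm1 z (le_of_lt hz)
      rw [this.deriv_eq]; simp
    have h1 : 0 < 1 - η * s := by nlinarith
    have : recipCoeff D γ m P s
        = (((D - 2 * γ) * η + (2 + 2 * γ) * η / (1 - η * s) : ℝ) : ℂ) := by
      simp only [recipCoeff, hd, hm1 s h.le, hP, he1 s h.le]; push_cast; ring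
    rw [this, Complex.ofReal_re]
    have : 0 < D - 2 * γ := by linarith
    positivity
  -- The tail formula needs `s > S` strictly, because it differentiates `m`; splitting at `2 S`
  -- leaves the point `S` to the phase estimate.
  rcases lt_or_ge s (2 * S) with h' | h'
  · have hs : 0 < s := by linarith
    have hs0 : (s : ℂ) ≠ 0 := by exact_mod_cast hs.ne'
    have hxs : η * s < x₀ := by rw [← hηS]; exact mul_lt_mul_of_pos_left h' hηpos
    have hde : HasDerivAt e (deriv ph s * Complex.I * e s) s := by
      have h1 : HasDerivAt ph (deriv ph s) s := (hph.differentiable (by simp) s).hasDerivAt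
      have h2 := (h1.ofReal_comp.mul_const Complex.I).cexp
      convert h2 using 1; simp only [he]; ring
    have hdm : HasDerivAt m (deriv m s) s := (hmsm.differentiable (by simp) s).hasDerivAt
    have h2 : HasDerivAt P (-(m s + s * deriv m s)) s := by
      have h3 := ((hasDerivAt_ofReal s).mul hdm).const_sub 1
      have : P = fun s => 1 - s * m s := funext hPm
      rw [this]; exact h3.congr_deriv (by simp)
    have h3 : HasDerivAt P (deriv ph s * Complex.I * e s - η) s := by
      have h4 := hde.sub ((hasDerivAt_ofReal s).const_mul (η : ℂ))
      exact h4.congr_deriv (by simp)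
    have h4 := h2.unique h3
    refine recipCoeff_re_pos_of_phase hγ hδ hηpos hs (by linarith) ?_ (hphκ s) rfl rfl ?_
    · have : η * s * (5 + 6 * γ) < x₀ * (5 + 6 * γ) := by gcongr
      linarith
    · linear_combination -h4
  · have hs : 0 < s := by linarith
    have hq : 0 < 1 + η * s := by positivity
    rw [recipCoeff_tail hηpos (by linarith : 0 < S) (by linarith) hmS hPm, Complex.ofReal_re]
    -- Here `D ≥ 2` is used: `2 (1 - γ) ≤ D - 2γ`.
    have h5 : 2 * (1 - γ) * η / (1 + η * s) ≤ (D - 2 * γ) * η := by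
      rw [div_le_iff₀ hq]
      have : 0 < (D - 2 * γ) * η * (η * s) := by
        have : 0 < D - 2 * γ := by linarith
        positivity
      nlinarith
    have : 0 < 2 * (D - 4 * γ) / s := by positivity
    linarith

/-! ### The self-similar profile and its decay -/

/-- A profile `φ` and a complex elliptic coefficient `a` for which
`(1 - t)^{-γ} φ(|x|² / (1 - t))` solves `u' = div (a(|x|² / (1 - t)) ∇u)` in dimension `D`. -/
structure SelfSimilarProfile (D γ : ℝ) where
  φ : ℝ → ℂ
  a : ℝ → ℂ
  contDiff_φ : ContDiff ℝ ∞ φ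
  contDiff_a : ContDiff ℝ ∞ a
  eqn : ∀ s : ℝ, γ * φ s + s * deriv φ s
    = D * (2 * a s * deriv φ s) + 2 * s * deriv (fun s => 2 * a s * deriv φ s) s
  φ_zero : φ 0 ≠ 0
  lam : ℝ
  lam_pos : 0 < lam
  C : ℝ
  C_pos : 0 < C
  le_re : ∀ s, 0 ≤ s → lam ≤ (a s).re
  norm_a_le : ∀ s, 0 ≤ s → ‖a s‖ ≤ C
  norm_deriv_a_le : ∀ s, 0 ≤ s → ‖deriv a s‖ * (1 + s) ≤ C
  norm_φ_le : ∀ s, 0 ≤ s → ‖φ s‖ * (1 + s) ^ γ ≤ C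
  norm_deriv_φ_le : ∀ s, 0 ≤ s → ‖deriv φ s‖ * (1 + s) ^ (γ + 1) ≤ C

lemma exists_bound_of_continuous_of_eventually {h : ℝ → ℝ} (hc : ContinuousOn h (Set.Ici 0)) {C : ℝ}
    (hC : ∀ᶠ s in Filter.atTop, h s ≤ C) : ∃ C' : ℝ, ∀ s, 0 ≤ s → h s ≤ C' := by
  obtain ⟨R, hR⟩ := Filter.eventually_atTop.1 hC
  obtain ⟨K, hK⟩ := (isCompact_Icc (a := (0 : ℝ)) (b := R)).exists_bound_of_continuousOn
    (hc.mono Set.Icc_subset_Ici_self)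
  refine ⟨max C K, fun s hs => ?_⟩
  rcases le_or_gt R s with h' | h'
  · exact (hR s h').trans (le_max_left _ _)
  · exact (le_abs_self _).trans ((hK s ⟨hs, h'.le⟩).trans (le_max_right _ _))

lemma exists_bound_of_continuous_of_tendsto {h : ℝ → ℝ} (hc : ContinuousOn h (Set.Ici 0)) {l : ℝ}
    (hl : Filter.Tendsto h Filter.atTop (nhds l)) : ∃ C' : ℝ, ∀ s, 0 ≤ s → h s ≤ C' :=
  exists_bound_of_continuous_of_eventually hc (C := l + 1)
    ((hl.eventually (gt_mem_nhds (show l < l + 1 by linarith))).mono fun _ h => h.le)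

theorem exists_selfSimilarProfile (D γ : ℝ) (hD : 2 ≤ D) (hγ : 0 < γ) (hγ' : γ < D / 4) :
    Nonempty (SelfSimilarProfile D γ) := by
  obtain ⟨m, P, η, S, hη, hS, hm, hP, hPm, hP0, hmS, hA⟩ := exists_symbol D γ hD hγ hγ'
  have hS0 : 0 < S := by linarith
  set A := recipCoeff D γ m P with hAdef
  have hA0 : ∀ s, A s ≠ 0 := fun s h => by have := hA s; rw [h] at this; simp at this
  have hofR : ContDiff ℝ ∞ (fun s : ℝ => (s : ℂ)) := Complex.ofRealCLM.contDiff
  have hPinv : ContDiff ℝ ∞ (fun s => (P s)⁻¹) := hP.inv hP0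
  have hmd : ContDiff ℝ ∞ (deriv m) := hm.deriv'
  have hAsm : ContDiff ℝ ∞ A := by
    have : A = fun s => (D - 2 * γ) * m s + ((2 + 2 * γ) * m s + 2 * s * deriv m s) * (P s)⁻¹ := by
      ext s; simp only [hAdef, recipCoeff, div_eq_mul_inv]
    rw [this]; fun_prop
  have hAinv : ContDiff ℝ ∞ (fun s => (A s)⁻¹) := hAsm.inv hA0
  -- The logarithmic derivative of `y` is `γ k`; hence `γ y + s y' = γ y (P + s m) / P = γ y / P`,
  -- the flux `g`.
  set k : ℝ → ℂ := fun s => m s * (P s)⁻¹ with hk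
  have hksm : ContDiff ℝ ∞ k := hm.mul hPinv
  set I : ℝ → ℂ := fun s => ∫ x in (0 : ℝ)..s, k x with hI
  have hId : ∀ s, HasDerivAt I (k s) s := fun s =>
    intervalIntegral.integral_hasDerivAt_right (hksm.continuous.intervalIntegrable _ _)
      (hksm.continuous.stronglyMeasurableAtFilter _ _) hksm.continuous.continuousAt
  have hIsm : ContDiff ℝ ∞ I := by
    rw [contDiff_infty_iff_deriv]
    refine ⟨fun s => (hId s).differentiableAt, ?_⟩
    have : deriv I = k := funext fun s => (hId s).deriv
    rwa [this]
  set y : ℝ → ℂ := fun s => Complex.exp (γ * I s) with hy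
  have hysm : ContDiff ℝ ∞ y := (contDiff_const.mul hIsm).cexp
  have hyd : ∀ s, HasDerivAt y (γ * k s * y s) s := fun s => by
    have := ((hId s).const_mul (γ : ℂ)).cexp
    exact this.congr_deriv (by simp only [hy]; ring)
  have hPd : ∀ s, HasDerivAt P (-(m s + s * deriv m s)) s := fun s => by
    have hdm : HasDerivAt m (deriv m s) s := (hm.differentiable (by simp) s).hasDerivAt
    have h3 := ((hasDerivAt_ofReal s).mul hdm).const_sub 1
    have : P = fun s => 1 - s * m s := funext hPm
    rw [this]; exact h3.congr_deriv (by simp)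
  have hPid : ∀ s, HasDerivAt (fun s => (P s)⁻¹) ((m s + s * deriv m s) / P s ^ 2) s := fun s =>
    ((hPd s).inv (hP0 s)).congr_deriv (by ring)
  -- This is `(D - 2γ) y + 2 g`, the substitution which reduces the profile equation to `g = γ y + s
  -- y'`.
  set φ : ℝ → ℂ := fun s => ((D - 2 * γ) + 2 * γ * (P s)⁻¹) * y s with hφ
  have hφsm : ContDiff ℝ ∞ φ := by fun_prop
  have hφd : ∀ s, HasDerivAt φ (γ * A s * y s * (P s)⁻¹) s := fun s => by
    have := (((hPid s).const_mul (2 * γ : ℂ)).const_add (D - 2 * γ : ℂ)).mul (hyd s)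
    refine this.congr_deriv ?_
    simp only [hAdef, recipCoeff, hk]
    have := hP0 s
    field_simp
    ring
  have hφd' : deriv φ = fun s => γ * A s * y s * (P s)⁻¹ := funext fun s => (hφd s).deriv
  set a : ℝ → ℂ := fun s => (A s)⁻¹ / 2 with ha
  have hasm : ContDiff ℝ ∞ a := hAinv.div_const 2
  have hg : (fun s => 2 * a s * deriv φ s) = fun s => γ * y s * (P s)⁻¹ := by
    ext s
    simp only [ha, hφd']
    have := hA0 s
    field_simp
  have hgd : ∀ s, deriv (fun s => 2 * a s * deriv φ s) s
      = γ * y s * (m s + s * deriv m s + γ * m s) / P s ^ 2 := fun s => by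
    rw [hg]
    have := ((hyd s).const_mul (γ : ℂ)).mul (hPid s)
    refine (HasDerivAt.deriv this).trans ?_
    simp only [hk]
    have := hP0 s
    field_simp
    ring
  -- the behaviour at infinity
  have hη0 : 0 < (D - 2 * γ) * η := mul_pos (by linarith) hη
  have hden : Filter.Tendsto (fun s : ℝ => 1 + η * s) Filter.atTop Filter.atTop :=
    Filter.tendsto_atTop_add_const_left _ _ (Filter.tendsto_id.const_mul_atTop hη)
  have hAtail : ∀ s, S < s → A s = (((D - 2 * γ) * η + 2 * (D - 4 * γ) / s
        - 2 * (1 - γ) * η / (1 + η * s) : ℝ) : ℂ) := fun s hs =>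
    recipCoeff_tail hη hS0 hs hmS hPm
  have hAlim : Filter.Tendsto A Filter.atTop (nhds (((D - 2 * γ) * η : ℝ) : ℂ)) := by
    have h1 : Filter.Tendsto (fun s : ℝ => (D - 2 * γ) * η + 2 * (D - 4 * γ) / s
        - 2 * (1 - γ) * η / (1 + η * s)) Filter.atTop (nhds ((D - 2 * γ) * η + 0 - 0)) :=
      (tendsto_const_nhds.add (tendsto_const_nhds.div_atTop Filter.tendsto_id)).sub
        (tendsto_const_nhds.div_atTop hden)
    rw [add_zero, sub_zero] at h1
    refine ((Complex.continuous_ofReal.tendsto _).comp h1).congr' ?_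
    filter_upwards [Filter.eventually_gt_atTop S] with s hs
    rw [hAtail s hs]; rfl
  have hl0 : (((D - 2 * γ) * η : ℝ) : ℂ) ≠ 0 := by exact_mod_cast hη0.ne'
  have halim : Filter.Tendsto a Filter.atTop (nhds ((((D - 2 * γ) * η : ℝ) : ℂ)⁻¹ / 2)) :=
    (hAlim.inv₀ hl0).div_const 2
  have hAd : ∀ s, S < s → HasDerivAt A ((-(2 * (D - 4 * γ) / s ^ 2)
      + 2 * (1 - γ) * η ^ 2 / (1 + η * s) ^ 2 : ℝ) : ℂ) s := fun s hs => by
    have hs0 : 0 < s := hS0.trans hs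
    have hq : 0 < 1 + η * s := by positivity
    have h1 : HasDerivAt (fun s : ℝ => (D - 2 * γ) * η + 2 * (D - 4 * γ) / s
        - 2 * (1 - γ) * η / (1 + η * s)) (-(2 * (D - 4 * γ) / s ^ 2)
      + 2 * (1 - γ) * η ^ 2 / (1 + η * s) ^ 2) s := by
      have h2 := ((((hasDerivAt_id s).inv hs0.ne').const_mul (2 * (D - 4 * γ))).const_add
        ((D - 2 * γ) * η)).sub (((((hasDerivAt_id s).const_mul η).const_add 1).inv
          hq.ne').const_mul (2 * (1 - γ) * η))
      exact h2.congr_deriv (by simp only [id]; ring)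
    refine h1.ofReal_comp.congr_of_eventuallyEq ?_
    filter_upwards [Ioi_mem_nhds hs] with z hz using hAtail z hz
  have had : ∀ s, deriv a s = -(deriv A s) * (A s)⁻¹ ^ 2 / 2 := fun s => by
    have h1 : HasDerivAt A (deriv A s) s := (hAsm.differentiable (by simp) s).hasDerivAt
    refine (((h1.inv (hA0 s)).div_const 2).deriv).trans ?_
    field_simp
  have hadlim : Filter.Tendsto (fun s => ‖deriv a s‖ * (1 + s)) Filter.atTop (nhds 0) := by
    have h1 : Filter.Tendsto (fun s : ℝ => ‖(A s)⁻¹ ^ 2 / 2‖ * |(-(2 * (D - 4 * γ))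
      + 2 * (1 - γ) * η ^ 2 * (s / (1 + η * s)) ^ 2)| * ((s⁻¹ + 1) * s⁻¹)) Filter.atTop
      (nhds (‖(((D - 2 * γ) * η : ℝ) : ℂ)⁻¹ ^ 2 / 2‖ * |(-(2 * (D - 4 * γ))
      + 2 * (1 - γ) * η ^ 2 * (η⁻¹) ^ 2)| * ((0 + 1) * 0))) := by
      have h2 : Filter.Tendsto (fun s : ℝ => s / (1 + η * s)) Filter.atTop (nhds η⁻¹) := by
        have h3 : Filter.Tendsto (fun s : ℝ => (s⁻¹ + η)⁻¹) Filter.atTop (nhds (0 + η)⁻¹) :=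
          (tendsto_inv_atTop_zero.add_const η).inv₀ (by simpa using hη.ne')
        rw [zero_add] at h3
        refine h3.congr' ?_
        filter_upwards [Filter.eventually_gt_atTop 0] with s hs
        field_simp
      exact (((((hAlim.inv₀ hl0).pow 2).div_const 2).norm).mul
        ((((h2.pow 2).const_mul _).const_add _).abs)).mul
        ((tendsto_inv_atTop_zero.add_const 1).mul tendsto_inv_atTop_zero)
    simp only [mul_zero] at h1
    refine h1.congr' ?_
    filter_upwards [Filter.eventually_gt_atTop S] with s hs
    have hs0 : 0 < s := hS0.trans hs
    have hq : 0 < 1 + η * s := by positivity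
    rw [had, (hAd s hs).deriv, mul_div_assoc, norm_mul, norm_neg, Complex.norm_real, Real.norm_eq_abs]
    have : -(2 * (D - 4 * γ) / s ^ 2) + 2 * (1 - γ) * η ^ 2 / (1 + η * s) ^ 2
        = (-(2 * (D - 4 * γ)) + 2 * (1 - γ) * η ^ 2 * (s / (1 + η * s)) ^ 2) * (s⁻¹ ^ 2) := by
      field_simp
    rw [this, abs_mul, abs_of_pos (by positivity : 0 < s⁻¹ ^ 2)]
    field_simp
  -- the decay of `y`
  obtain ⟨K, hK⟩ : ∃ K : ℝ, ∀ s, S < s → ‖y s‖ * (1 + s) ^ γ ≤ K := by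
    -- On the tail `k = -(η + 2/s) / (1 + η s) ≤ -1/s`. Hence `Re I + log s` decreases, and `|y| =
    -- exp (γ Re I)` is at most a multiple of `s^(-γ)`.
    have hanti : AntitoneOn (fun s => (I s).re + Real.log s) (Set.Ici S) := by
      have hd : ∀ s, 0 < s → HasDerivAt (fun s => (I s).re + Real.log s) ((k s).re + s⁻¹) s :=
        fun s hs => (Complex.reCLM.hasFDerivAt.comp_hasDerivAt s (hId s)).add
          (Real.hasDerivAt_log hs.ne')
      refine antitoneOn_of_deriv_nonpos (convex_Ici S) ?_ ?_ ?_
      · exact fun s hs => (hd s (hS0.trans_le hs)).continuousAt.continuousWithinAt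
      · rw [interior_Ici]
        exact fun s hs => (hd s (hS0.trans hs)).differentiableAt.differentiableWithinAt
      · rw [interior_Ici]
        intro s hs
        have hs0 : 0 < s := hS0.trans hs
        have hq : 0 < 1 + η * s := by positivity
        rw [(hd s hs0).deriv]
        have hks : k s = ((-((η + 2 / s) / (1 + η * s)) : ℝ) : ℂ) := by
          simp only [hk, hmS s (le_of_lt hs), symbol_tail hS0 (le_of_lt hs) hmS hPm]
          push_cast
          rw [inv_neg]
          ring
        rw [hks, Complex.ofReal_re, neg_add_nonpos_iff, le_div_iff₀ hq]
        have : s⁻¹ * (1 + η * s) = s⁻¹ + η := by field_simp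
        rw [this]
        have : 2 / s = 2 * s⁻¹ := by ring
        have : 0 < s⁻¹ := by positivity
        linarith
    -- The factor `2 ^ γ` comes from `1 + s ≤ 2 s`, valid because `s > S ≥ 1`.
    refine ⟨Real.exp (γ * ((I S).re + Real.log S)) * 2 ^ γ, fun s hs => ?_⟩
    have hs0 : 0 < s := hS0.trans hs
    have h1 : (I s).re + Real.log s ≤ (I S).re + Real.log S :=
      hanti (Set.mem_Ici.2 le_rfl) (Set.mem_Ici.2 hs.le) hs.le
    have h2 : ‖y s‖ = Real.exp (γ * (I s).re) := by
      simp only [hy]; rw [Complex.norm_exp]; simp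
    have h3 : (1 + s) ^ γ ≤ Real.exp (γ * Real.log s) * 2 ^ γ := by
      have : Real.exp (γ * Real.log s) = s ^ γ := by rw [Real.rpow_def_of_pos hs0, mul_comm]
      rw [this, ← Real.mul_rpow hs0.le (by norm_num)]
      exact Real.rpow_le_rpow (by linarith) (by linarith) hγ.le
    calc ‖y s‖ * (1 + s) ^ γ
        ≤ Real.exp (γ * (I s).re) * (Real.exp (γ * Real.log s) * 2 ^ γ) := by rw [h2]; gcongr
      _ = Real.exp (γ * ((I s).re + Real.log s)) * 2 ^ γ := by
          rw [← mul_assoc, ← Real.exp_add]; ring_nf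
      _ ≤ _ := by gcongr
  have hPtail : ∀ s, S < s → ‖(P s)⁻¹‖ * (1 + s) ≤ 2 / η := fun s hs => by
    have hs0 : 0 < s := hS0.trans hs
    have hq : 0 < 1 + η * s := by positivity
    rw [symbol_tail hS0 hs.le hmS hPm, norm_inv, norm_neg, Complex.norm_real,
      Real.norm_of_nonneg hq.le, inv_mul_le_iff₀ hq, ← sub_nonneg]
    have : (1 + η * s) * (2 / η) = 2 / η + 2 * s := by field_simp
    rw [this]
    have : 0 < 2 / η := by positivity
    linarith
  have hrpow : ∀ p : ℝ, ContinuousOn (fun s : ℝ => (1 + s) ^ p) (Set.Ici 0) := fun p =>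
    (by fun_prop : Continuous fun s : ℝ => 1 + s).continuousOn.rpow_const
      fun s hs => Or.inl (by have : (0 : ℝ) ≤ s := hs; linarith)
  have hare : ∀ s, 0 < (a s).re := fun s => by
    simp only [ha]
    rw [show (A s)⁻¹ / 2 = (A s)⁻¹ / ((2 : ℝ) : ℂ) by push_cast; rfl, Complex.div_ofReal_re,
      Complex.inv_re]
    have := hA s
    have : 0 < Complex.normSq (A s) := Complex.normSq_pos.2 (hA0 s)
    positivity
  obtain ⟨C₁, hC₁⟩ := exists_bound_of_continuous_of_tendsto
    (h := fun s => ((a s).re)⁻¹)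
    ((Complex.continuous_re.comp hasm.continuous).inv₀ fun s => (hare s).ne').continuousOn
    (((Complex.continuous_re.tendsto _).comp halim).inv₀ (by
      rw [← Complex.ofReal_inv, show (2 : ℂ) = ((2 : ℝ) : ℂ) by push_cast; rfl,
        ← Complex.ofReal_div, Complex.ofReal_re]
      positivity))
  obtain ⟨C₂, hC₂⟩ := exists_bound_of_continuous_of_tendsto
    (h := fun s => ‖a s‖) hasm.continuous.norm.continuousOn halim.norm
  obtain ⟨C₃, hC₃⟩ := exists_bound_of_continuous_of_tendsto
    (h := fun s => ‖deriv a s‖ * (1 + s))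
    ((hasm.continuous_deriv (by simp)).norm.mul (by fun_prop)).continuousOn hadlim
  obtain ⟨C₄, hC₄⟩ := exists_bound_of_continuous_of_eventually (C := (|D - 2 * γ| + 2 * γ * (2 / η)) * K)
    (h := fun s => ‖φ s‖ * (1 + s) ^ γ)
    (hφsm.continuous.norm.continuousOn.mul (hrpow γ)) (by
      filter_upwards [Filter.eventually_gt_atTop S] with s hs
      have hs0 : 0 < s := hS0.trans hs
      have h1 : ‖(P s)⁻¹‖ ≤ 2 / η := by
        have := hPtail s hs
        nlinarith [norm_nonneg (P s)⁻¹]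
      have h2 : ‖((D : ℂ) - 2 * γ) + 2 * γ * (P s)⁻¹‖ ≤ |D - 2 * γ| + 2 * γ * (2 / η) := by
        refine (norm_add_le _ _).trans (add_le_add ?_ ?_)
        · rw [← Real.norm_eq_abs, ← Complex.norm_real]; push_cast; rfl
        · rw [norm_mul]
          have : ‖(2 * γ : ℂ)‖ = 2 * γ := by
            rw [norm_mul, Complex.norm_real, Real.norm_of_nonneg hγ.le]; norm_num
          rw [this]; gcongr
      simp only [hφ]
      rw [norm_mul, mul_assoc]
      exact mul_le_mul h2 (hK s hs) (by positivity) (by positivity))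
  obtain ⟨C₀, hAnorm⟩ : ∃ C₀, ∀ᶠ s in Filter.atTop, ‖A s‖ ≤ C₀ :=
    ⟨_, (hAlim.norm.eventually (gt_mem_nhds (lt_add_one _))).mono fun _ h => h.le⟩
  obtain ⟨C₅, hC₅⟩ := exists_bound_of_continuous_of_eventually
    (C := γ * C₀ * K * (2 / η))
    (h := fun s => ‖deriv φ s‖ * (1 + s) ^ (γ + 1))
    ((hφsm.continuous_deriv (by simp)).norm.continuousOn.mul (hrpow (γ + 1))) (by
      filter_upwards [Filter.eventually_gt_atTop S, hAnorm] with s hs hAs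
      have hs0 : 0 < s := hS0.trans hs
      rw [hφd', Real.rpow_add (by linarith), Real.rpow_one]
      simp only [norm_mul, Complex.norm_real, Real.norm_of_nonneg hγ.le]
      calc γ * ‖A s‖ * ‖y s‖ * ‖(P s)⁻¹‖ * ((1 + s) ^ γ * (1 + s))
          = γ * ‖A s‖ * (‖y s‖ * (1 + s) ^ γ) * (‖(P s)⁻¹‖ * (1 + s)) := by ring
        _ ≤ _ := by
          have hK0 : 0 ≤ K := (by positivity : 0 ≤ ‖y s‖ * (1 + s) ^ γ).trans (hK s hs)
          have hC0 : 0 ≤ C₀ := (norm_nonneg _).trans hAs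
          gcongr
          · exact hK s hs
          · exact hPtail s hs)
  have hC₁pos : 0 < C₁ := (inv_pos.2 (hare 0)).trans_le (hC₁ 0 le_rfl)
  exact ⟨{
    φ := φ
    a := a
    contDiff_φ := hφsm
    contDiff_a := hasm
    eqn := fun s => by
      rw [hgd s, congrFun hg s, hφd']
      simp only [hφ, hAdef, recipCoeff]
      have h0 := hP0 s
      field_simp
      rw [hPm s]
      ring
    -- Since `P 0 = 1` and `y 0 = 1`, the value is `(D - 2γ) + 2γ = D`.
    φ_zero := by
      simp only [hφ, hy, hPm]
      refine mul_ne_zero ?_ (Complex.exp_ne_zero _)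
      have : (0 : ℝ) < D := by linarith
      have : (D : ℂ) ≠ 0 := by exact_mod_cast this.ne'
      simpa using this
    lam := C₁⁻¹
    lam_pos := inv_pos.2 hC₁pos
    C := max 1 (max (max C₂ C₃) (max C₄ C₅))
    C_pos := by positivity
    le_re := fun s hs => (inv_le_comm₀ hC₁pos (hare s)).2 (hC₁ s hs)
    norm_a_le := fun s hs => (hC₂ s hs).trans (by simp)
    norm_deriv_a_le := fun s hs => (hC₃ s hs).trans (by simp)
    norm_φ_le := fun s hs => (hC₄ s hs).trans (by simp)
    norm_deriv_φ_le := fun s hs => (hC₅ s hs).trans (by simp) }⟩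

/-! ### Weak gradients and the divergence -/

lemma isWeakGradient_toLp {d : ℕ} {v : EuclideanSpace ℝ (Fin d) → ℂ}
    {g : EuclideanSpace ℝ (Fin d) → EuclideanSpace ℂ (Fin d)} (hv : ContDiff ℝ 1 v)
    (hmv : MemLp v 2 volume) (hmg : MemLp g 2 volume)
    (h : ∀ x i, fderiv ℝ v x (EuclideanSpace.single i 1) = g x i) :
    IsWeakGradient (hmv.toLp v) (hmg.toLp g) := by
  intro φ hφ hc i
  have hd := continuous_test_deriv hφ (EuclideanSpace.single i 1)
  have hdc : HasCompactSupport (fun x => fderiv ℝ φ x (EuclideanSpace.single i 1)) :=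
    hc.fderiv_apply (𝕜 := ℝ) _
  have e1 : ∫ x, (fderiv ℝ φ x (EuclideanSpace.single i 1)) • (hmv.toLp v) x
      = ∫ x, (fderiv ℝ φ x (EuclideanSpace.single i 1)) • v x := by
    refine integral_congr_ae ?_
    filter_upwards [hmv.coeFn_toLp] with x hx
    rw [hx]
  have e2 : ∫ x, φ x • ((hmg.toLp g) x) i
      = ∫ x, φ x • fderiv ℝ v x (EuclideanSpace.single i 1) := by
    refine integral_congr_ae ?_
    filter_upwards [hmg.coeFn_toLp] with x hx
    rw [hx, h]
  have hcont := hv.continuous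
  have hdv : Continuous fun x => fderiv ℝ v x (EuclideanSpace.single i 1) :=
    (hv.continuous_fderiv (by simp)).clm_apply continuous_const
  rw [e1, e2, integral_smul_fderiv_eq_neg_fderiv_smul_of_integrable, neg_neg]
  · exact (hd.smul hcont).integrable_of_hasCompactSupport hdc.smul_right
  · exact (hφ.continuous.smul hdv).integrable_of_hasCompactSupport hc.smul_right
  · exact (hφ.continuous.smul hcont).integrable_of_hasCompactSupport hc.smul_right
  · exact fun x _ => hφ.differentiable (by simp) x
  · exact fun x _ => hv.differentiable (by simp) x

/-- Weak gradients are tested with real functions, whereas the flux is complex and `H⁻¹` is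
antilinear. Splitting `F` into real and imaginary parts and conjugating the defining identity
bridges the two. -/
lemma IsWeakGradient.integral_fderiv_mul_conj {d : ℕ} {v : L2 d} {g : L2Vec d}
    (h : IsWeakGradient v g) {F : EuclideanSpace ℝ (Fin d) → ℂ} (hF : ContDiff ℝ ∞ F)
    (hc : HasCompactSupport F) (i : Fin d) :
    Integrable (fun x => fderiv ℝ F x (EuclideanSpace.single i 1) * (starRingEnd ℂ) (v x)) ∧
    Integrable (fun x => F x * (starRingEnd ℂ) (g x i)) ∧
    ∫ x, fderiv ℝ F x (EuclideanSpace.single i 1) * (starRingEnd ℂ) (v x)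
      = -∫ x, F x * (starRingEnd ℂ) (g x i) := by
  have real_case : ∀ φ : EuclideanSpace ℝ (Fin d) → ℝ, ContDiff ℝ ∞ φ → HasCompactSupport φ →
      Integrable (fun x => (fderiv ℝ φ x (EuclideanSpace.single i 1) : ℂ)
        * (starRingEnd ℂ) (v x)) ∧
      Integrable (fun x => (φ x : ℂ) * (starRingEnd ℂ) (g x i)) ∧
      ∫ x, (fderiv ℝ φ x (EuclideanSpace.single i 1) : ℂ) * (starRingEnd ℂ) (v x)
        = -∫ x, (φ x : ℂ) * (starRingEnd ℂ) (g x i) := by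
    intro φ hφ hcφ
    have hd := continuous_test_deriv hφ (EuclideanSpace.single i 1)
    have hdc : HasCompactSupport (fun x => fderiv ℝ φ x (EuclideanSpace.single i 1)) :=
      hcφ.fderiv_apply (𝕜 := ℝ) _
    have i1 := integrable_test_smul hd hdc v
    have i2 := integrable_test_smul_coord hφ.continuous hcφ g i
    have e1 : ∀ x, (fderiv ℝ φ x (EuclideanSpace.single i 1) : ℂ) * (starRingEnd ℂ) (v x)
        = (starRingEnd ℂ) ((fderiv ℝ φ x (EuclideanSpace.single i 1)) • v x) := fun x => by
      simp [Complex.real_smul]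
    have e2 : ∀ x, (φ x : ℂ) * (starRingEnd ℂ) (g x i) = (starRingEnd ℂ) (φ x • (g x) i) :=
      fun x => by simp [Complex.real_smul]
    simp only [e1, e2]
    refine ⟨Complex.conjCLE.toContinuousLinearMap.integrable_comp i1,
      Complex.conjCLE.toContinuousLinearMap.integrable_comp i2, ?_⟩
    rw [integral_conj, integral_conj, h φ hφ hcφ i, map_neg]
  have hre : ContDiff ℝ ∞ fun x => (F x).re := Complex.reCLM.contDiff.comp hF
  have him : ContDiff ℝ ∞ fun x => (F x).im := Complex.imCLM.contDiff.comp hF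
  have hcre : HasCompactSupport fun x => (F x).re := hc.comp_left (g := Complex.re) rfl
  have hcim : HasCompactSupport fun x => (F x).im := hc.comp_left (g := Complex.im) rfl
  obtain ⟨a1, a2, a3⟩ := real_case _ hre hcre
  obtain ⟨b1, b2, b3⟩ := real_case _ him hcim
  have hFd : ∀ x, HasFDerivAt F (fderiv ℝ F x) x := fun x =>
    (hF.differentiable (by simp) x).hasFDerivAt
  have e1 : ∀ x, fderiv ℝ F x (EuclideanSpace.single i 1) * (starRingEnd ℂ) (v x)
      = (fderiv ℝ (fun x => (F x).re) x (EuclideanSpace.single i 1) : ℂ) * (starRingEnd ℂ) (v x)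
      + Complex.I * ((fderiv ℝ (fun x => (F x).im) x (EuclideanSpace.single i 1) : ℂ)
        * (starRingEnd ℂ) (v x)) := fun x => by
    have h1 := (Complex.reCLM.hasFDerivAt.comp x (hFd x)).fderiv
    have h2 := (Complex.imCLM.hasFDerivAt.comp x (hFd x)).fderiv
    have h1' : fderiv ℝ (fun x => (F x).re) x = Complex.reCLM.comp (fderiv ℝ F x) := h1
    have h2' : fderiv ℝ (fun x => (F x).im) x = Complex.imCLM.comp (fderiv ℝ F x) := h2
    rw [h1', h2']
    simp only [ContinuousLinearMap.comp_apply, Complex.reCLM_apply, Complex.imCLM_apply]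
    nth_rewrite 1 [← Complex.re_add_im (fderiv ℝ F x (EuclideanSpace.single i 1))]
    ring
  have e2 : ∀ x, F x * (starRingEnd ℂ) (g x i) = ((F x).re : ℂ) * (starRingEnd ℂ) (g x i)
      + Complex.I * (((F x).im : ℂ) * (starRingEnd ℂ) (g x i)) := fun x => by
    nth_rewrite 1 [← Complex.re_add_im (F x)]
    ring
  simp only [e1, e2]
  refine ⟨a1.add (b1.const_mul _), a2.add (b2.const_mul _), ?_⟩
  rw [integral_add a1 (b1.const_mul _), integral_add a2 (b2.const_mul _), integral_const_mul,
    integral_const_mul, a3, b3]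
  ring

lemma H1.isWeakGradient {d : ℕ} (p : H1 d) : IsWeakGradient (H1.toL2 d p) (H1.grad d p) := p.2

/-- The components of a smooth compactly supported field are themselves test functions for the weak
gradient of the element of `H¹` it is paired with, so no density argument is needed. -/
lemma ofL2_div_eq {d : ℕ} {F : EuclideanSpace ℝ (Fin d) → EuclideanSpace ℂ (Fin d)}
    {v : EuclideanSpace ℝ (Fin d) → ℂ} (hF : ∀ i, ContDiff ℝ ∞ fun x => F x i)
    (hc : HasCompactSupport F) (hmF : MemLp F 2 volume) (hmv : MemLp v 2 volume)
    (h : ∀ x, v x = ∑ i, fderiv ℝ (fun x => F x i) x (EuclideanSpace.single i 1)) :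
    HNeg1.ofL2 (hmv.toLp v) = HNeg1.div (hmF.toLp F) := by
  ext p
  have hci : ∀ i, HasCompactSupport fun x => F x i := fun i =>
    hc.comp_left (g := fun z : EuclideanSpace ℂ (Fin d) => z i) rfl
  have key := fun i => (H1.isWeakGradient p).integral_fderiv_mul_conj (hF i) (hci i) i
  have e1 : HNeg1.ofL2 (hmv.toLp v) p
      = ∫ x, ∑ i, fderiv ℝ (fun x => F x i) x (EuclideanSpace.single i 1)
        * (starRingEnd ℂ) (H1.toL2 d p x) := by
    change inner ℂ (H1.toL2 d p) (hmv.toLp v) = _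
    rw [L2.inner_def]
    refine integral_congr_ae ?_
    filter_upwards [hmv.coeFn_toLp] with x hx
    rw [hx, h, RCLike.inner_apply, Finset.sum_mul]
  have e2 : HNeg1.div (hmF.toLp F) p
      = -∫ x, ∑ i, F x i * (starRingEnd ℂ) (H1.grad d p x i) := by
    change -inner ℂ (H1.grad d p) (hmF.toLp F) = _
    rw [L2.inner_def]
    congr 1
    refine integral_congr_ae ?_
    filter_upwards [hmF.coeFn_toLp] with x hx
    rw [hx, PiLp.inner_apply]
    exact Finset.sum_congr rfl fun i _ => by rw [RCLike.inner_apply]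
  rw [e1, e2, integral_finsetSum _ fun i _ => (key i).1,
    integral_finsetSum _ fun i _ => (key i).2.1, ← Finset.sum_neg_distrib]
  exact Finset.sum_congr rfl fun i _ => (key i).2.2

lemma HNeg1.ofL2_apply {d : ℕ} (h : L2 d) (p : H1 d) :
    HNeg1.ofL2 h p = inner ℂ (H1.toL2 d p) h := rfl

lemma HNeg1.div_apply {d : ℕ} (G : L2Vec d) (p : H1 d) :
    HNeg1.div G p = -inner ℂ (H1.grad d p) G := rfl

lemma norm_innerSLFlip_comp_le {E F : Type*} [NormedAddCommGroup E] [InnerProductSpace ℂ E]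
    [NormedAddCommGroup F] [NormedSpace ℂ F] (h : E) (T : F →L[ℂ] E) :
    ‖(innerSLFlip ℂ h).comp T‖ ≤ ‖T‖ * ‖h‖ := by
  refine ContinuousLinearMap.opNorm_le_bound _ (by positivity) fun x => ?_
  rw [ContinuousLinearMap.comp_apply, innerSLFlip_apply_apply]
  calc ‖inner ℂ (T x) h‖ ≤ ‖T x‖ * ‖h‖ := norm_inner_le_norm _ _
    _ ≤ ‖T‖ * ‖x‖ * ‖h‖ := by gcongr; exact T.le_opNorm x
    _ = _ := by ring

/-- `HNeg1.ofL2` as a continuous linear map. -/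
noncomputable def HNeg1.ofL2L (d : ℕ) : L2 d →L[ℂ] HNeg1 d :=
  LinearMap.mkContinuous
    { toFun := HNeg1.ofL2
      map_add' := fun x y => ContinuousLinearMap.ext fun p => by
        rw [add_apply]
        simp only [HNeg1.ofL2_apply, inner_add_right]
      map_smul' := fun c x => ContinuousLinearMap.ext fun p => by
        rw [RingHom.id_apply, smul_apply]
        simp only [HNeg1.ofL2_apply, inner_smul_right, smul_eq_mul] }
    ‖H1.toL2 d‖ fun h => norm_innerSLFlip_comp_le h _

@[simp] lemma HNeg1.ofL2L_apply {d : ℕ} (h : L2 d) : HNeg1.ofL2L d h = HNeg1.ofL2 h := rfl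

/-- `HNeg1.div` as a continuous linear map. -/
noncomputable def HNeg1.divL (d : ℕ) : L2Vec d →L[ℂ] HNeg1 d :=
  LinearMap.mkContinuous
    { toFun := HNeg1.div
      map_add' := fun x y => ContinuousLinearMap.ext fun p => by
        rw [add_apply]
        simp only [HNeg1.div_apply, inner_add_right, neg_add]
      map_smul' := fun c x => ContinuousLinearMap.ext fun p => by
        rw [RingHom.id_apply, smul_apply]
        simp only [HNeg1.div_apply, inner_smul_right, smul_eq_mul, mul_neg] }
    ‖H1.grad d‖ fun h => (norm_neg _).trans_le (norm_innerSLFlip_comp_le h _)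

@[simp] lemma HNeg1.divL_apply {d : ℕ} (h : L2Vec d) : HNeg1.divL d h = HNeg1.div h := rfl

/-! ### Curves in `L²` given by jointly continuous functions -/

lemma norm_toLp_sq {α G : Type*} [MeasurableSpace α] {μ : Measure α} [NormedAddCommGroup G]
    [InnerProductSpace ℂ G] {f : α → G} (hf : MemLp f 2 μ) :
    ‖hf.toLp f‖ ^ 2 = ∫ x, ‖f x‖ ^ 2 ∂μ := by
  have h1 : ((‖hf.toLp f‖ ^ 2 : ℝ) : ℂ) = ∫ x, ((‖f x‖ ^ 2 : ℝ) : ℂ) ∂μ := by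
    have h2 := inner_self_eq_norm_sq_to_K (𝕜 := ℂ) (hf.toLp f)
    rw [L2.inner_def] at h2
    push_cast
    refine Eq.trans h2.symm ?_
    refine integral_congr_ae ?_
    filter_upwards [hf.coeFn_toLp] with x hx
    rw [hx, inner_self_eq_norm_sq_to_K]
    rfl
  rw [integral_complex_ofReal] at h1
  exact_mod_cast h1

/-- The squared `L²` distance to `F t₀` is an integral over a fixed compact set of a jointly
continuous function, hence continuous in `t`. -/
lemma continuousOn_toLp {d : ℕ} {G : Type*} [NormedAddCommGroup G] [InnerProductSpace ℂ G]
    {F : ℝ → EuclideanSpace ℝ (Fin d) → G} {s : Set ℝ} {K : Set (EuclideanSpace ℝ (Fin d))}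
    (hK : IsCompact K) (hF : ContinuousOn (Function.uncurry F) (s ×ˢ Set.univ))
    (hFK : ∀ t, ∀ x ∉ K, F t x = 0) (hm : ∀ t, MemLp (F t) 2 volume) :
    ContinuousOn (fun t => (hm t).toLp (F t)) s := by
  intro t₀ ht₀
  have h1 : ContinuousOn (fun t => ∫ x, ‖F t x - F t₀ x‖ ^ 2) s := by
    refine continuousOn_integral_of_compact_support hK ?_ ?_
    · have h2 : ContinuousOn (fun p : ℝ × EuclideanSpace ℝ (Fin d) => F t₀ p.2)
          (s ×ˢ Set.univ) :=
        hF.comp (f := fun p : ℝ × EuclideanSpace ℝ (Fin d) => (t₀, p.2))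
          (by fun_prop) fun p _ => ⟨ht₀, trivial⟩
      exact (hF.sub h2).norm.pow 2
    · intro t x _ hx
      simp [hFK t x hx, hFK t₀ x hx]
  have h2 := h1 t₀ ht₀
  have h3 : ∀ t, ‖(hm t).toLp (F t) - (hm t₀).toLp (F t₀)‖ ^ 2 = ∫ x, ‖F t x - F t₀ x‖ ^ 2 :=
    fun t => by
      rw [← MemLp.toLp_sub, norm_toLp_sq]; rfl
  rw [ContinuousWithinAt, tendsto_iff_norm_sub_tendsto_zero]
  have h4 : Filter.Tendsto (fun t => √(∫ x, ‖F t x - F t₀ x‖ ^ 2)) (nhdsWithin t₀ s) (nhds 0) := by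
    have := h2.tendsto.sqrt
    simpa using this
  refine h4.congr fun t => ?_
  rw [← h3, Real.sqrt_sq (norm_nonneg _)]

/-- Differentiation under the integral sign: near `t₀` the derivative is dominated by `M |h|` on
`K`, and `h` is integrable there. -/
lemma hasDerivAt_inner_toLp {d : ℕ} {F F' : ℝ → EuclideanSpace ℝ (Fin d) → ℂ} {s : Set ℝ}
    {K : Set (EuclideanSpace ℝ (Fin d))} (hs : IsOpen s) (hK : IsCompact K)
    (hF' : ContinuousOn (Function.uncurry F') (s ×ˢ Set.univ))
    (hFK' : ∀ t, ∀ x ∉ K, F' t x = 0)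
    (hm : ∀ t, MemLp (F t) 2 volume) (hm' : ∀ t, MemLp (F' t) 2 volume)
    (hd : ∀ t ∈ s, ∀ x, HasDerivAt (fun t => F t x) (F' t x) t) (h : L2 d) {t₀ : ℝ} (ht₀ : t₀ ∈ s) :
    HasDerivAt (fun t => inner ℂ h ((hm t).toLp (F t))) (inner ℂ h ((hm' t₀).toLp (F' t₀))) t₀ := by
  have e : ∀ {f : EuclideanSpace ℝ (Fin d) → ℂ} (hf : MemLp f 2 volume),
      inner ℂ h (hf.toLp f) = ∫ x, inner ℂ (h x) (f x) := fun hf => by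
    rw [L2.inner_def]
    refine integral_congr_ae ?_
    filter_upwards [hf.coeFn_toLp] with x hx
    rw [hx]
  have ie : ∀ {f : EuclideanSpace ℝ (Fin d) → ℂ}, MemLp f 2 volume →
      Integrable fun x => inner ℂ (h x) (f x) := fun hf =>
    (L2.integrable_inner h (hf.toLp _)).congr (by
      filter_upwards [hf.coeFn_toLp] with x hx
      rw [hx])
  simp only [e]
  obtain ⟨ε, hε, hball⟩ := Metric.nhds_basis_closedBall.mem_iff.1 (hs.mem_nhds ht₀)
  obtain ⟨M, hM⟩ := ((isCompact_closedBall t₀ ε).prod hK).exists_bound_of_continuousOn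
    (hF'.mono (Set.prod_mono hball (Set.subset_univ _)))
  have hbound : Integrable fun x => K.indicator (fun x => ‖h x‖) x * M := by
    refine Integrable.mul_const ?_ M
    rw [integrable_indicator_iff hK.measurableSet]
    exact (((Lp.memLp h).locallyIntegrable (by norm_num)).integrableOn_isCompact hK).norm
  refine (hasDerivAt_integral_of_dominated_loc_of_deriv_le
    (F' := fun t x => inner ℂ (h x) (F' t x)) (Metric.closedBall_mem_nhds t₀ hε)
    (Filter.Eventually.of_forall fun t => (ie (hm t)).aestronglyMeasurable) (ie (hm t₀))
    (ie (hm' t₀)).aestronglyMeasurable (Filter.Eventually.of_forall fun x t ht => ?_) hbound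
    (Filter.Eventually.of_forall fun x t ht => ?_)).2
  · by_cases hx : x ∈ K
    · rw [Set.indicator_of_mem hx]
      exact (norm_inner_le_norm _ _).trans
        (mul_le_mul_of_nonneg_left (hM (t, x) ⟨ht, hx⟩) (norm_nonneg _))
    · rw [hFK' t x hx, Set.indicator_of_notMem hx]; simp
  · have := (hd t (hball ht) x).mul_const ((starRingEnd ℂ) (h x))
    simpa only [RCLike.inner_apply] using this

/-- Testing against a fixed `h` reduces this to the scalar fundamental theorem of calculus, so only
weak differentiability of the curve is needed. -/
lemma toLp_sub_eq_integral {d : ℕ} {F F' : ℝ → EuclideanSpace ℝ (Fin d) → ℂ} {s : Set ℝ}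
    {K : Set (EuclideanSpace ℝ (Fin d))} (hs : IsOpen s) (hK : IsCompact K)
    (hF' : ContinuousOn (Function.uncurry F') (s ×ˢ Set.univ))
    (hFK' : ∀ t, ∀ x ∉ K, F' t x = 0)
    (hm : ∀ t, MemLp (F t) 2 volume) (hm' : ∀ t, MemLp (F' t) 2 volume)
    (hd : ∀ t ∈ s, ∀ x, HasDerivAt (fun t => F t x) (F' t x) t) {a b : ℝ}
    (hab : Set.uIcc a b ⊆ s) :
    (hm b).toLp (F b) - (hm a).toLp (F a) = ∫ t in a..b, (hm' t).toLp (F' t) := by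
  have hcont : ContinuousOn (fun t => (hm' t).toLp (F' t)) (Set.uIcc a b) :=
    (continuousOn_toLp hK hF' hFK' hm').mono hab
  have hint : IntervalIntegrable _ volume a b := hcont.intervalIntegrable
  refine ext_inner_left ℂ fun h => ?_
  have h1 : ∫ t in a..b, inner ℂ h ((hm' t).toLp (F' t))
      = inner ℂ h (∫ t in a..b, (hm' t).toLp (F' t)) :=
    (innerSL ℂ h).intervalIntegral_comp_comm hint
  rw [← h1, intervalIntegral.integral_eq_sub_of_hasDerivAt
    (f := fun t => inner ℂ h ((hm t).toLp (F t))), inner_sub_right]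
  · exact fun t ht => hasDerivAt_inner_toLp hs hK hF' hFK' hm hm' hd h (hab ht)
  · exact (ContinuousOn.inner (𝕜 := ℂ) continuousOn_const hcont).intervalIntegrable

/-! ### Integration by parts in time -/

section TimePairing

variable {X V : Type*} [NormedAddCommGroup X] [NormedSpace ℝ X] [NormedAddCommGroup V]
  [NormedSpace ℝ V] (B : X →L[ℝ] V →L[ℝ] ℝ)

/-- Translations act continuously on `L²`, and by Hölder's inequality pairing with the fixed `W ∈
L²` is a bounded functional of the other factor. -/
lemma continuous_integral_pairing_sub {g : ℝ → X} {W : ℝ → V} (hg : MemLp g 2 volume)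
    (hW : MemLp W 2 volume) : Continuous fun σ : ℝ => ∫ t, B (g (t - σ)) (W t) := by
  have hmp : ∀ σ : ℝ, MeasurePreserving (fun t : ℝ => t - σ) volume volume := fun σ =>
    measurePreserving_sub_right volume σ
  have hgσ : ∀ σ : ℝ, MemLp (fun t => g (t - σ)) 2 volume := fun σ =>
    hg.comp_measurePreserving (hmp σ)
  set τ : ℝ → C(ℝ, ℝ) := fun σ => ⟨fun t => t - σ, by fun_prop⟩ with hτ
  have hτc : Continuous τ := ContinuousMap.continuous_of_continuous_uncurry _ (by
    simp only [hτ, Function.uncurry_def, ContinuousMap.coe_mk]; fun_prop)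
  have hcont : Continuous fun σ => Lp.compMeasurePreserving (τ σ) (hmp σ) (hg.toLp g) :=
    continuous_const.compMeasurePreservingLp hτc hmp (by norm_num)
  -- the pairing as a continuous linear functional of the first factor
  have hint : ∀ f : Lp X 2 (volume : Measure ℝ), Integrable fun t => B (f t) (W t) := fun f =>
    memLp_one_iff_integrable.1
      (MemLp.of_bilin (p := 2) (q := 2) (r := 1) (fun x v => B x v) ‖B‖₊ (Lp.memLp f) hW
        (B.aestronglyMeasurable_comp₂ (Lp.aestronglyMeasurable f) hW.1)
        (Filter.Eventually.of_forall fun t => B.le_opNorm₂ _ _))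
  have hnorm : ∀ f : Lp X 2 (volume : Measure ℝ),
      ‖∫ t, B (f t) (W t)‖ ≤ (‖B‖ * (eLpNorm W 2 volume).toReal) * ‖f‖ := fun f => by
    have h1 := eLpNorm_le_eLpNorm_mul_eLpNorm_of_nnnorm (p := 2) (q := 2) (r := 1) (Lp.aestronglyMeasurable f) hW.1
      (fun x v => B x v) ‖B‖₊ (Filter.Eventually.of_forall fun t => B.le_opNorm₂ (f t) (W t))
    have h2 : ‖∫ t, B (f t) (W t)‖ ≤ (eLpNorm (fun t => B (f t) (W t)) 1 volume).toReal := by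
      refine (norm_integral_le_integral_norm _).trans_eq ?_
      rw [eLpNorm_one_eq_lintegral_enorm, ← integral_norm_eq_lintegral_enorm (hint f).1]
    refine h2.trans ((ENNReal.toReal_mono ?_ h1).trans_eq ?_)
    · exact ENNReal.mul_ne_top (ENNReal.mul_ne_top ENNReal.coe_ne_top (Lp.eLpNorm_ne_top f))
        hW.eLpNorm_ne_top
    · rw [ENNReal.toReal_mul, ENNReal.toReal_mul, ENNReal.coe_toReal, coe_nnnorm, Lp.norm_def]
      ring
  let Λ : Lp X 2 (volume : Measure ℝ) →L[ℝ] ℝ := LinearMap.mkContinuous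
    { toFun := fun f => ∫ t, B (f t) (W t)
      map_add' := fun f₁ f₂ => by
        rw [← integral_add (hint f₁) (hint f₂)]
        refine integral_congr_ae ?_
        filter_upwards [Lp.coeFn_add f₁ f₂] with t ht
        rw [ht, Pi.add_apply, map_add, add_apply]
      map_smul' := fun c f => by
        rw [RingHom.id_apply, smul_eq_mul, ← integral_const_mul]
        refine integral_congr_ae ?_
        filter_upwards [Lp.coeFn_smul c f] with t ht
        rw [ht, Pi.smul_apply, map_smul, smul_apply, smul_eq_mul] } _ hnorm
  refine (Λ.continuous.comp hcont).congr fun σ => ?_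
  change ∫ t, B ((Lp.compMeasurePreserving (τ σ) (hmp σ) (hg.toLp g)) t) (W t) = _
  refine integral_congr_ae ?_
  filter_upwards [Lp.coeFn_compMeasurePreserving (hg.toLp g) (hmp σ),
    (hmp σ).quasiMeasurePreserving.ae hg.coeFn_toLp] with t h1 h2
  exact congrArg (fun x => B x (W t)) (h1.trans h2)

/-- This licenses Fubini. The integrand is dominated by `‖g (t - σ)‖² + ‖W t‖²`, up to a constant,
which is integrable because `σ` ranges over a bounded interval. -/
lemma integrable_pairing_prod {g : ℝ → X} {W : ℝ → V} (hgm : StronglyMeasurable g)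
    (hWm : StronglyMeasurable W) (hg : MemLp g 2 volume) (hW : MemLp W 2 volume) (h : ℝ) :
    Integrable (Function.uncurry fun σ t : ℝ => B (g (t - σ)) (W t))
      ((volume.restrict (Set.Ioc 0 h)).prod volume) := by
  have hm : StronglyMeasurable (Function.uncurry fun σ t : ℝ => B (g (t - σ)) (W t)) := by
    have h1 : StronglyMeasurable fun p : ℝ × ℝ => g (p.2 - p.1) :=
      hgm.comp_measurable (measurable_snd.sub measurable_fst)
    have h2 : StronglyMeasurable fun p : ℝ × ℝ => W p.2 := hWm.comp_measurable measurable_snd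
    exact B.continuous₂.comp_stronglyMeasurable (h1.prodMk h2)
  have hg2 : Integrable fun t => ‖g t‖ ^ 2 := hg.integrable_norm_pow (by norm_num)
  have hW2 : Integrable fun t => ‖W t‖ ^ 2 := hW.integrable_norm_pow (by norm_num)
  have hbound : Integrable (fun p : ℝ × ℝ => ‖B‖ * (‖g (p.2 - p.1)‖ ^ 2 + ‖W p.2‖ ^ 2))
      ((volume.restrict (Set.Ioc 0 h)).prod volume) := by
    refine Integrable.const_mul (Integrable.add ?_ ?_) _
    · rw [integrable_prod_iff]
      · refine ⟨Filter.Eventually.of_forall fun σ => hg2.comp_sub_right σ, ?_⟩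
        have : ∀ σ : ℝ, ∫ t, ‖‖g (t - σ)‖ ^ 2‖ = ∫ t, ‖‖g t‖ ^ 2‖ := fun σ =>
          integral_sub_right_eq_self (fun t => ‖‖g t‖ ^ 2‖) σ
        simp only [this]
        exact integrable_const _
      · exact ((hgm.comp_measurable (measurable_snd.sub measurable_fst)).norm.pow
          2).aestronglyMeasurable
    · exact hW2.comp_snd _
  refine hbound.mono' hm.aestronglyMeasurable (Filter.Eventually.of_forall fun p => ?_)
  refine (B.le_opNorm₂ _ _).trans ?_
  rw [mul_assoc]
  gcongr
  nlinarith [sq_nonneg (‖g (p.2 - p.1)‖ - ‖W p.2‖), sq_nonneg (‖g (p.2 - p.1)‖ + ‖W p.2‖),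
    norm_nonneg (g (p.2 - p.1)), norm_nonneg (W p.2)]

/-- `F 0` is the limit of the averages of `F` over `(0, a)` as `a` decreases to `0`. -/
lemma zero_le_of_forall_integral_nonneg {F : ℝ → ℝ} (hF : Continuous F)
    (h : ∀ a, 0 < a → 0 ≤ ∫ σ in (0 : ℝ)..a, F σ) : 0 ≤ F 0 := by
  have h1 : HasDerivAt (fun a => ∫ σ in (0 : ℝ)..a, F σ) (F 0) 0 :=
    intervalIntegral.integral_hasDerivAt_right (hF.intervalIntegrable _ _)
      (hF.stronglyMeasurableAtFilter _ _) hF.continuousAt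
  have h2 := (hasDerivAt_iff_tendsto_slope.1 h1).mono_left
    (nhdsWithin_mono (0 : ℝ) (fun x (hx : x ∈ Set.Ioi 0) => (ne_of_gt hx : x ≠ 0)))
  refine ge_of_tendsto h2 ?_
  filter_upwards [self_mem_nhdsWithin] with a ha
  rw [slope_def_field, intervalIntegral.integral_same, sub_zero, sub_zero]
  exact div_nonneg (h a ha) (le_of_lt ha)

/-- If `w` is the primitive of `G` on `(0,1)` with respect to a symmetric form `S` with quadratic
form `N ≥ 0`, then the integrated pairing of `G` with `w` is nonnegative. -/
lemma integral_pairing_nonneg [CompleteSpace X] {S : V → V → ℝ} {N : V → ℝ} {C : ℝ}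
    (hN : Continuous N) (hN0 : N 0 = 0) (hNpos : ∀ v, 0 ≤ N v) (hNC : ∀ v, N v ≤ C * ‖v‖ ^ 2)
    (hS0 : ∀ p, S 0 p = 0) (hS : ∀ v v', (N v - N v') / 2 ≤ S v v - S v' v)
    {G : ℝ → X} {w : ℝ → V} (hG : MemLp G 2 timeMeasure) (hw : MemLp w 2 timeMeasure)
    (h : ∀ᵐ t ∂timeMeasure, ∀ p, B (∫ s in (0 : ℝ)..t, G s) p = S (w t) p) :
    0 ≤ ∫ t in Set.Ioo (0 : ℝ) 1, B (G t) (w t) := by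
  set I : Set ℝ := Set.Ioo 0 1 with hI
  have hIm : MeasurableSet I := measurableSet_Ioo
  have hgi : MemLp (I.indicator G) 2 volume := (memLp_indicator_iff_restrict hIm).2 hG
  have hWi : MemLp (I.indicator w) 2 volume := (memLp_indicator_iff_restrict hIm).2 hw
  set g : ℝ → X := hgi.1.mk _ with hgdef
  set W : ℝ → V := hWi.1.mk _ with hWdef
  have hge : I.indicator G =ᵐ[volume] g := hgi.1.ae_eq_mk
  have hWe : I.indicator w =ᵐ[volume] W := hWi.1.ae_eq_mk
  have hgm : StronglyMeasurable g := hgi.1.stronglyMeasurable_mk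
  have hWm : StronglyMeasurable W := hWi.1.stronglyMeasurable_mk
  have hg : MemLp g 2 volume := hgi.ae_eq hge
  have hW : MemLp W 2 volume := hWi.ae_eq hWe
  have hgint : ∀ a b : ℝ, IntervalIntegrable g volume a b := fun a b =>
    ((hg.locallyIntegrable (by norm_num)).integrableOn_isCompact isCompact_uIcc).intervalIntegrable
  have hF0 : ∫ t in I, B (G t) (w t) = ∫ t, B (g (t - 0)) (W t) := by
    rw [← integral_indicator hIm]
    refine integral_congr_ae ?_
    filter_upwards [hge, hWe] with t h1 h2
    rw [sub_zero, ← h1, ← h2]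
    by_cases ht : t ∈ I <;> simp [ht]
  rw [hF0]
  -- the primitive identity, extended by zero to negative times
  have hprim : ∀ᵐ t ∂(volume : Measure ℝ), t < 1 → ∀ p,
      B (∫ s in (0 : ℝ)..t, g s) p = S (W t) p := by
    have h' := (ae_restrict_iff' hIm).1 h
    filter_upwards [h', hWe] with t h1 h2 ht1 p
    have e1 : ∫ s in (0 : ℝ)..t, g s = ∫ s in (0 : ℝ)..t, I.indicator G s :=
      (intervalIntegral.integral_congr_ae (by
        filter_upwards [hge] with s hs _ using hs)).symm
    rcases le_or_gt t 0 with ht0 | ht0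
    · have e2 : ∫ s in (0 : ℝ)..t, I.indicator G s = 0 := by
        rw [intervalIntegral.integral_symm, intervalIntegral.integral_of_le ht0]
        rw [setIntegral_eq_zero_of_forall_eq_zero, neg_zero]
        intro s hs
        exact Set.indicator_of_notMem (fun h : s ∈ I => absurd h.1 (not_lt.2 hs.2)) _
      have e3 : W t = 0 := by
        rw [← h2]; exact Set.indicator_of_notMem (fun h : t ∈ I => absurd h.1 (not_lt.2 ht0)) _
      rw [e1, e2, e3, hS0]; simp
    · have htI : t ∈ I := ⟨ht0, ht1⟩
      have e2 : ∫ s in (0 : ℝ)..t, I.indicator G s = ∫ s in (0 : ℝ)..t, G s := by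
        rw [intervalIntegral.integral_of_le ht0.le, intervalIntegral.integral_of_le ht0.le]
        refine setIntegral_congr_fun measurableSet_Ioc fun s hs => ?_
        exact Set.indicator_of_mem (show s ∈ I from ⟨hs.1, hs.2.trans_lt ht1⟩) _
      have e3 : W t = w t := by rw [← h2]; exact Set.indicator_of_mem htI _
      rw [e1, e2, e3, h1 htI]
  -- Instead of differentiating `N (w t)`, the pairing is averaged over shifts `σ ∈ (0, a)` of `g`.
  -- After Fubini, `∫ g` over `(t - a, t)` is paired with `W t`, which for `t` in the interval is `S
  -- (W t - W (t - a)) (W t)` by the primitive identity.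
  refine zero_le_of_forall_integral_nonneg (continuous_integral_pairing_sub B hg hW) fun a ha => ?_
  have hprod := integrable_pairing_prod B hgm hWm hg hW a
  rw [intervalIntegral.integral_of_le ha.le, integral_integral_swap hprod]
  have hmp : MeasurePreserving (fun t : ℝ => t - a) volume volume :=
    measurePreserving_sub_right volume a
  have hNW : Integrable fun t => N (W t) := by
    refine ((hW.integrable_norm_pow (by norm_num)).const_mul C).mono'
      (hN.comp_stronglyMeasurable hWm).aestronglyMeasurable
      (Filter.Eventually.of_forall fun t => ?_)
    rw [Real.norm_of_nonneg (hNpos _)]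
    exact hNC _
  -- Translation invariance over the whole line; this is why `w` was extended by zero.
  have hzero : ∫ t, (N (W t) - N (W (t - a))) / 2 = 0 := by
    rw [integral_div, integral_sub hNW (hNW.comp_sub_right a),
      integral_sub_right_eq_self (fun t => N (W t)), sub_self, zero_div]
  refine hzero.symm.le.trans ?_
  refine integral_mono_ae ((hNW.sub (hNW.comp_sub_right a)).div_const 2)
    hprod.integral_prod_right ?_
  filter_upwards [hprim, hmp.quasiMeasurePreserving.ae hprim, hWe] with t h1 h2 h3
  have e1 : ∫ σ in Set.Ioc 0 a, B (g (t - σ)) (W t) = B (∫ s in (t - a)..t, g s) (W t) := by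
    rw [← intervalIntegral.integral_of_le ha.le]
    have h4 := intervalIntegral.integral_comp_sub_left (a := 0) (b := a)
      (fun s => B (g s) (W t)) t
    rw [h4, sub_zero]
    exact (B.flip (W t)).intervalIntegral_comp_comm (hgint _ _)
  change (N (W t) - N (W (t - a))) / 2 ≤ ∫ σ in Set.Ioc 0 a, B (g (t - σ)) (W t)
  rw [e1]
  -- Outside the interval `W t = 0`: the pairing vanishes and the lower bound is `-N (W (t - a)) / 2
  -- ≤ 0`. The jump of `W` at time `1` thus has the favourable sign.
  by_cases ht : t ∈ I
  · rw [← intervalIntegral.integral_interval_sub_left (hgint 0 t) (hgint 0 (t - a)), map_sub,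
      sub_apply, h1 ht.2, h2 (by have := ht.2; linarith)]
    exact hS _ _
  · have e3 : W t = 0 := by rw [← h3]; exact Set.indicator_of_notMem ht _
    rw [e3, hN0, map_zero]
    linarith [hNpos (W (t - a))]

end TimePairing

/-! ### Uniqueness of Lions solutions -/

lemma coeffMul_eq_toLp {d : ℕ} {B : Coeff d} {t : ℝ} {g : L2Vec d}
    (h : MemLp (fun x => Matrix.toEuclideanLin (B t x) (g x)) 2
      (volume : Measure (EuclideanSpace ℝ (Fin d)))) : coeffMul B t g = h.toLp _ := dif_pos h

lemma IsElliptic.coeFn_coeffMul {d : ℕ} {B : Coeff d} (hB : IsElliptic B) {t : ℝ}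
    (ht : t ∈ Set.Icc (0 : ℝ) 1) (g : L2Vec d) :
    coeffMul B t g =ᵐ[volume] fun x => Matrix.toEuclideanLin (B t x) (g x) := by
  rw [coeffMul_eq_toLp (hB.memLp_mul ht g)]
  exact MemLp.coeFn_toLp _

lemma IsElliptic.coeffMul_sub {d : ℕ} {B : Coeff d} (hB : IsElliptic B) {t : ℝ}
    (ht : t ∈ Set.Icc (0 : ℝ) 1) (g h : L2Vec d) :
    coeffMul B t (g - h) = coeffMul B t g - coeffMul B t h := by
  refine Lp.ext ?_
  filter_upwards [hB.coeFn_coeffMul ht (g - h), hB.coeFn_coeffMul ht g, hB.coeFn_coeffMul ht h,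
    Lp.coeFn_sub g h, Lp.coeFn_sub (coeffMul B t g) (coeffMul B t h)] with x h1 h2 h3 h4 h5
  rw [h1, h5, Pi.sub_apply, h2, h3, h4, Pi.sub_apply, map_sub]

lemma IsElliptic.divForm_sub {d : ℕ} {B : Coeff d} (hB : IsElliptic B) {t : ℝ}
    (ht : t ∈ Set.Icc (0 : ℝ) 1) (v w : H1 d) :
    divForm B t (v - w) = divForm B t v - divForm B t w := by
  simp only [divForm, map_sub, hB.coeffMul_sub ht, ← HNeg1.divL_apply]

lemma IsElliptic.exists_coeffMul_bounds {d : ℕ} {B : Coeff d} (hB : IsElliptic B) :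
    ∃ Lam lam : ℝ, 0 < Lam ∧ 0 < lam ∧ ∀ t ∈ Set.Icc (0 : ℝ) 1, ∀ g : L2Vec d,
      ‖coeffMul B t g‖ ≤ Lam * ‖g‖ ∧ lam * ‖g‖ ^ 2 ≤ (inner ℂ g (coeffMul B t g)).re := by
  obtain ⟨Lam, lam, hLam, hlam, h⟩ := hB.bounds
  refine ⟨Lam, lam, hLam, hlam, fun t ht g => ⟨?_, ?_⟩⟩
  · refine Lp.norm_le_mul_norm_of_ae_le_mul ?_
    filter_upwards [hB.coeFn_coeffMul ht g] with x hx
    rw [hx]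
    exact (h t ht x _).1
  · have h1 : ‖g‖ ^ 2 = ∫ x, ‖g x‖ ^ 2 := by
      have := norm_toLp_sq (Lp.memLp g)
      rwa [Lp.toLp_coeFn] at this
    have h2 : (inner ℂ g (coeffMul B t g)).re = ∫ x, (inner ℂ (g x) (coeffMul B t g x)).re := by
      rw [L2.inner_def]
      exact (integral_re (𝕜 := ℂ) (L2.integrable_inner g (coeffMul B t g))).symm
    rw [h1, h2, ← integral_const_mul]
    refine integral_mono_ae (((Lp.memLp g).integrable_norm_pow (by norm_num)).const_mul _)
      (L2.integrable_inner (𝕜 := ℂ) g (coeffMul B t g)).re ?_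
    filter_upwards [hB.coeFn_coeffMul ht g] with x hx
    change _ ≤ (inner ℂ (g x) (coeffMul B t g x)).re
    rw [hx]
    exact (h t ht x _).2

/-- The real part of the pairing between `H⁻¹` and `H¹`. -/
noncomputable def rePairing (d : ℕ) : HNeg1 d →L[ℝ] H1 d →L[ℝ] ℝ :=
  LinearMap.mkContinuous₂
    (LinearMap.mk₂ ℝ (fun (f : HNeg1 d) (p : H1 d) => (f p).re)
      (fun f g p => by rw [add_apply, Complex.add_re])
      (fun c f p => by rw [smul_apply, Complex.real_smul, Complex.re_ofReal_mul, smul_eq_mul])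
      (fun f p q => by rw [map_add, Complex.add_re])
      (fun c f p => by
        have : c • p = (c : ℂ) • p := rfl
        rw [this, map_smulₛₗ]
        simp))
    1 fun f p => by
      rw [one_mul]
      exact (Complex.abs_re_le_norm _).trans (f.le_opNorm p)

lemma rePairing_apply {d : ℕ} (f : HNeg1 d) (p : H1 d) : rePairing d f p = (f p).re := rfl

lemma H1.ext_of_toL2_grad {d : ℕ} {p : H1 d} (h1 : H1.toL2 d p = 0) (h2 : H1.grad d p = 0) :
    p = 0 :=
  Subtype.ext ((WithLp.ofLp_injective 2) (Prod.ext h1 h2))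

/-- The pairing of `G = div (B ∇w)` with `w` has nonnegative integral, yet is at most `-λ ‖∇w‖²` at
almost every time. Hence `∇w = 0`, then `G = 0`, and finally its primitive `w` vanishes. -/
theorem IsLionsSolution.ae_eq {d : ℕ} {B : Coeff d} {f : ℝ → L2 d} (hB : IsElliptic B)
    {u v : ℝ → H1 d} (hu : IsLionsSolution B f u) (hv : IsLionsSolution B f v) :
    v =ᵐ[timeMeasure] u := by
  obtain ⟨U, hU, hUu, hUeq⟩ := hu.exists_representative
  obtain ⟨Y, hY, hYv, hYeq⟩ := hv.exists_representative
  obtain ⟨Lam, lam, hLam, hlam, hbd⟩ := hB.exists_coeffMul_bounds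
  set w : ℝ → H1 d := fun t => v t - u t with hw
  set G : ℝ → HNeg1 d := fun t => divForm B t (v t) - divForm B t (u t) with hG
  have hI : ∀ᵐ t ∂timeMeasure, t ∈ Set.Ioo (0 : ℝ) 1 := ae_restrict_mem measurableSet_Ioo
  have hGw : ∀ t ∈ Set.Ioo (0 : ℝ) 1, G t = divForm B t (w t) := fun t ht =>
    (hB.divForm_sub (Set.Ioo_subset_Icc_self ht) _ _).symm
  have hwm : MemLp w 2 timeMeasure := hv.memLp.sub hu.memLp
  have hGi : IntervalIntegrable G volume 0 1 := hv.integrable_divForm.sub hu.integrable_divForm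
  have hGm : MemLp G 2 timeMeasure := by
    -- Measurability of `G` comes from the integrability clauses of the two solutions; the bound by
    -- `w` only controls its size.
    have hm : AEStronglyMeasurable G timeMeasure :=
      hGi.1.aestronglyMeasurable.mono_measure (Measure.restrict_mono Set.Ioo_subset_Ioc_self le_rfl)
    refine hwm.of_le_mul (c := ‖H1.grad d‖ * (Lam * ‖H1.grad d‖)) hm ?_
    filter_upwards [hI] with t ht
    rw [hGw t ht, divForm, ← HNeg1.divL_apply]
    have h1 : ‖HNeg1.divL d (coeffMul B t (H1.grad d (w t)))‖
        ≤ ‖H1.grad d‖ * ‖coeffMul B t (H1.grad d (w t))‖ :=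
      (norm_neg _).trans_le (norm_innerSLFlip_comp_le _ _)
    have h2 := (hbd t (Set.Ioo_subset_Icc_self ht) (H1.grad d (w t))).1
    have h3 := (H1.grad d).le_opNorm (w t)
    calc _ ≤ _ := h1
      _ ≤ ‖H1.grad d‖ * (Lam * (‖H1.grad d‖ * ‖w t‖)) := by gcongr; exact h2.trans (by gcongr)
      _ = _ := by ring
  have hprim : ∀ᵐ t ∂timeMeasure, ∫ s in (0 : ℝ)..t, G s = HNeg1.ofL2 (H1.toL2 d (w t)) := by
    filter_upwards [hUu, hYv, hI] with t h1 h2 ht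
    have ht' := Set.Ioo_subset_Icc_self ht
    have hsub : Set.uIcc (0 : ℝ) t ⊆ Set.uIcc 0 1 := by
      rw [Set.uIcc_of_le ht'.1, Set.uIcc_of_le zero_le_one]
      exact Set.Icc_subset_Icc_right ht'.2
    have e1 := hUeq t ht'
    have e2 := hYeq t ht'
    rw [hG, intervalIntegral.integral_sub (hv.integrable_divForm.mono_set hsub)
      (hu.integrable_divForm.mono_set hsub)]
    have e3 : HNeg1.ofL2 (H1.toL2 d (w t)) = Y t - U t := by
      rw [h1, h2, hw]; simp only [map_sub, ← HNeg1.ofL2L_apply]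
    rw [e3]
    have e4 : Y t - U t - ((∫ s in (0 : ℝ)..t, divForm B s (v s))
        - ∫ s in (0 : ℝ)..t, divForm B s (u s)) = 0 := by
      rw [sub_sub_sub_comm, e1, e2, sub_self]
    exact (sub_eq_zero.1 e4).symm
  have hpos : 0 ≤ ∫ t in Set.Ioo (0 : ℝ) 1, rePairing d (G t) (w t) := by
    refine integral_pairing_nonneg (rePairing d)
      (S := fun p q => (inner ℂ (H1.toL2 d q) (H1.toL2 d p)).re)
      (N := fun p => ‖H1.toL2 d p‖ ^ 2) (C := ‖H1.toL2 d‖ ^ 2) (by fun_prop) (by simp)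
      (fun p => by positivity) (fun p => ?_) (fun p => by simp) (fun p q => ?_) hGm hwm ?_
    · rw [← mul_pow]
      gcongr
      exact (H1.toL2 d).le_opNorm p
    · set x := H1.toL2 d p
      set y := H1.toL2 d q
      have h1 : (inner ℂ x x).re = ‖x‖ ^ 2 := by
        have := inner_self_eq_norm_sq (𝕜 := ℂ) x
        exact this
      have h2 : (inner ℂ x y).re ≤ ‖x‖ * ‖y‖ := re_inner_le_norm (𝕜 := ℂ) x y
      change (‖x‖ ^ 2 - ‖y‖ ^ 2) / 2 ≤ (inner ℂ x x).re - (inner ℂ x y).re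
      nlinarith [sq_nonneg (‖x‖ - ‖y‖)]
    · filter_upwards [hprim] with t ht p
      rw [ht]; rfl
  have hgradm : AEStronglyMeasurable (fun t => H1.grad d (w t)) timeMeasure :=
    (H1.grad d).continuous.comp_aestronglyMeasurable hwm.1
  have hgrad2 : MemLp (fun t => H1.grad d (w t)) 2 timeMeasure :=
    hwm.of_le_mul (c := ‖H1.grad d‖) hgradm
      (Filter.Eventually.of_forall fun t => (H1.grad d).le_opNorm _)
  have hgi : Integrable (fun t => ‖H1.grad d (w t)‖ ^ 2) timeMeasure :=
    hgrad2.integrable_norm_pow (by norm_num)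
  have hle : ∀ᵐ t ∂timeMeasure, rePairing d (G t) (w t) ≤ -(lam * ‖H1.grad d (w t)‖ ^ 2) := by
    filter_upwards [hI] with t ht
    have h2 := (hbd t (Set.Ioo_subset_Icc_self ht) (H1.grad d (w t))).2
    rw [hGw t ht, rePairing_apply, divForm, HNeg1.div_apply, Complex.neg_re]
    exact neg_le_neg h2
  have hpi : Integrable (fun t => rePairing d (G t) (w t)) timeMeasure :=
    memLp_one_iff_integrable.1
      (MemLp.of_bilin (p := 2) (q := 2) (r := 1) (fun x v => rePairing d x v) 1 hGm hwm
        ((rePairing d).aestronglyMeasurable_comp₂ hGm.1 hwm.1)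
        (Filter.Eventually.of_forall fun t => by
          rw [one_mul, rePairing_apply]
          exact (Complex.abs_re_le_norm _).trans ((G t).le_opNorm (w t))))
  have hzero : ∫ t, ‖H1.grad d (w t)‖ ^ 2 ∂timeMeasure = 0 := by
    have h1 := integral_mono_ae hpi (hgi.const_mul lam).neg hle
    have h2 : ∫ t, -(lam * ‖H1.grad d (w t)‖ ^ 2) ∂timeMeasure
        = -(lam * ∫ t, ‖H1.grad d (w t)‖ ^ 2 ∂timeMeasure) := by
      rw [integral_neg, integral_const_mul]
    have h3 : 0 ≤ ∫ t, ‖H1.grad d (w t)‖ ^ 2 ∂timeMeasure :=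
      integral_nonneg fun t => by positivity
    have h4 : 0 ≤ -(lam * ∫ t, ‖H1.grad d (w t)‖ ^ 2 ∂timeMeasure) := by
      rw [← h2]; exact hpos.trans h1
    nlinarith
  have hgz : ∀ᵐ t ∂timeMeasure, H1.grad d (w t) = 0 := by
    have := (integral_eq_zero_iff_of_nonneg (fun t => by positivity) hgi).1 hzero
    filter_upwards [this] with t ht
    simpa using ht
  have hGz : ∀ᵐ t ∂timeMeasure, G t = 0 := by
    filter_upwards [hgz, hI] with t h1 ht
    have h3 := (hbd t (Set.Ioo_subset_Icc_self ht) (H1.grad d (w t))).1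
    rw [h1, norm_zero, mul_zero, norm_le_zero_iff] at h3
    rw [hGw t ht, divForm, h1, h3, ← HNeg1.divL_apply, map_zero]
  filter_upwards [hgz, hprim, hI] with t h1 h2 ht
  have h3 : ∫ s in (0 : ℝ)..t, G s = 0 := by
    rw [intervalIntegral.integral_of_le ht.1.le, integral_Ioc_eq_integral_Ioo]
    refine integral_eq_zero_of_ae ?_
    exact ae_restrict_of_ae_restrict_of_subset (Set.Ioo_subset_Ioo_right ht.2.le) hGz
  -- Injectivity of the embedding into `H⁻¹` is needed only at this element of `H¹`, which is tested
  -- against itself.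
  have h4 : H1.toL2 d (w t) = 0 := by
    have h5 : HNeg1.ofL2 (H1.toL2 d (w t)) (w t) = 0 := by rw [← h2, h3]; rfl
    rw [HNeg1.ofL2_apply] at h5
    exact inner_self_eq_zero.1 h5
  exact sub_eq_zero.1 (H1.ext_of_toL2_grad h4 h1)

/-! ### The localised self-similar solution as a function of `t` and `σ = |x|²` -/

/-- A smooth cutoff which is `1` for `σ ≤ 1` and `0` for `σ ≥ 2`. -/
noncomputable def cutoff (σ : ℝ) : ℝ := Real.smoothTransition (2 - σ)

lemma contDiff_cutoff : ContDiff ℝ ∞ cutoff :=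
  Real.smoothTransition.contDiff.comp (contDiff_const.sub contDiff_id)

lemma contDiff_deriv_cutoff : ContDiff ℝ ∞ (deriv cutoff) := contDiff_cutoff.deriv'

lemma cutoff_of_le {σ : ℝ} (h : σ ≤ 1) : cutoff σ = 1 :=
  Real.smoothTransition.one_of_one_le (by linarith)

lemma cutoff_eventuallyEq {σ : ℝ} (h : 2 < σ) : cutoff =ᶠ[nhds σ] fun _ => 0 := by
  filter_upwards [Ioi_mem_nhds h] with z hz
  exact Real.smoothTransition.zero_of_nonpos (by have : 2 < z := hz; linarith)

lemma cutoff_of_lt {σ : ℝ} (h : 2 < σ) : cutoff σ = 0 := (cutoff_eventuallyEq h).eq_of_nhds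

lemma deriv_cutoff_eventuallyEq {σ : ℝ} (h : 2 < σ) : deriv cutoff =ᶠ[nhds σ] fun _ => 0 := by
  filter_upwards [Ioi_mem_nhds h] with z hz
  rw [(cutoff_eventuallyEq hz).deriv_eq]; simp

lemma deriv_cutoff_of_lt {σ : ℝ} (h : 2 < σ) : deriv cutoff σ = 0 :=
  (deriv_cutoff_eventuallyEq h).eq_of_nhds

lemma deriv_deriv_cutoff_of_lt {σ : ℝ} (h : 2 < σ) : deriv (deriv cutoff) σ = 0 := by
  rw [(deriv_cutoff_eventuallyEq h).deriv_eq]; simp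

lemma exists_cutoff_bound : ∃ M : ℝ, 0 < M ∧ ∀ σ, 0 ≤ σ →
    |cutoff σ| ≤ M ∧ |deriv cutoff σ| ≤ M ∧ |deriv (deriv cutoff) σ| ≤ M := by
  have h : ∀ f : ℝ → ℝ, Continuous f → (∀ σ, 2 < σ → f σ = 0) → ∃ M : ℝ, ∀ σ, 0 ≤ σ → |f σ| ≤ M :=
    fun f hf h0 => exists_bound_of_continuous_of_eventually hf.abs.continuousOn (C := 0) (by
      filter_upwards [Filter.eventually_gt_atTop 2] with σ hσ
      rw [h0 σ hσ, abs_zero])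
  obtain ⟨M₀, h₀⟩ := h _ contDiff_cutoff.continuous fun _ => cutoff_of_lt
  obtain ⟨M₁, h₁⟩ := h _ contDiff_deriv_cutoff.continuous fun _ => deriv_cutoff_of_lt
  obtain ⟨M₂, h₂⟩ := h _ (contDiff_deriv_cutoff.continuous_deriv (by simp))
    fun _ => deriv_deriv_cutoff_of_lt
  exact ⟨max 1 (max M₀ (max M₁ M₂)), by positivity, fun σ hσ => ⟨(h₀ σ hσ).trans (by simp),
    (h₁ σ hσ).trans (by simp), (h₂ σ hσ).trans (by simp)⟩⟩

namespace SelfSimilarProfile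

variable {D γ : ℝ} (p : SelfSimilarProfile D γ)

/-- The solution. -/
noncomputable def value (t σ : ℝ) : ℂ :=
  ((t * (1 - t) ^ (-γ) : ℝ) : ℂ) * (cutoff σ * p.φ (σ / (1 - t)))

/-- The derivative of the solution in `σ`. -/
noncomputable def valueDeriv (t σ : ℝ) : ℂ :=
  ((t * (1 - t) ^ (-γ) : ℝ) : ℂ) * (deriv cutoff σ * p.φ (σ / (1 - t))
    + cutoff σ * (deriv p.φ (σ / (1 - t)) / ((1 - t : ℝ) : ℂ)))

/-- The flux, up to the factor `x`. -/
noncomputable def flux (t σ : ℝ) : ℂ := 2 * p.a (σ / (1 - t)) * p.valueDeriv t σ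

/-- The time derivative of the solution. -/
noncomputable def timeDeriv (t σ : ℝ) : ℂ :=
  (((1 - t) ^ (-γ) : ℝ) : ℂ) * (cutoff σ * p.φ (σ / (1 - t)) + t * cutoff σ / ((1 - t : ℝ) : ℂ) *
    (γ * p.φ (σ / (1 - t)) + (σ / (1 - t) : ℝ) * deriv p.φ (σ / (1 - t))))

/-- The forcing term. -/
noncomputable def force (t σ : ℝ) : ℂ :=
  (((1 - t) ^ (-γ) : ℝ) : ℂ) * (cutoff σ * p.φ (σ / (1 - t)) - t *
    ((2 * D * deriv cutoff σ + 4 * σ * deriv (deriv cutoff) σ)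
        * (p.a (σ / (1 - t)) * p.φ (σ / (1 - t)))
      + 4 * deriv cutoff σ * (σ / (1 - t) : ℝ) * deriv (fun s => p.a s * p.φ s) (σ / (1 - t))
      + 2 * deriv cutoff σ * (σ / (1 - t) : ℝ)
        * (2 * p.a (σ / (1 - t)) * deriv p.φ (σ / (1 - t)))))

lemma contDiff_deriv_φ : ContDiff ℝ ∞ (deriv p.φ) := p.contDiff_φ.deriv'

lemma contDiff_mul : ContDiff ℝ ∞ fun s => p.a s * p.φ s := p.contDiff_a.mul p.contDiff_φ

lemma hasDerivAt_rescale {f : ℝ → ℂ} (hf : ContDiff ℝ ∞ f) (t σ : ℝ) :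
    HasDerivAt (fun σ => f (σ / (1 - t))) (deriv f (σ / (1 - t)) / ((1 - t : ℝ) : ℂ)) σ := by
  have h1 : HasDerivAt f (deriv f (σ / (1 - t))) (σ / (1 - t)) :=
    (hf.differentiable (by simp) _).hasDerivAt
  refine (h1.scomp σ ((hasDerivAt_id σ).div_const (1 - t))).congr_deriv ?_
  rw [Complex.real_smul]
  push_cast
  ring

lemma hasDerivAt_cutoff (σ : ℝ) : HasDerivAt (fun σ => (cutoff σ : ℂ)) ((deriv cutoff σ : ℝ) : ℂ) σ :=
  (contDiff_cutoff.differentiable (by simp) σ).hasDerivAt.ofReal_comp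

lemma hasDerivAt_deriv_cutoff (σ : ℝ) :
    HasDerivAt (fun σ => ((deriv cutoff σ : ℝ) : ℂ)) ((deriv (deriv cutoff) σ : ℝ) : ℂ) σ :=
  (contDiff_deriv_cutoff.differentiable (by simp) σ).hasDerivAt.ofReal_comp

lemma hasDerivAt_value (t σ : ℝ) : HasDerivAt (p.value t) (p.valueDeriv t σ) σ :=
  ((hasDerivAt_cutoff σ).mul (hasDerivAt_rescale p.contDiff_φ t σ)).const_mul _

lemma hasDerivAt_value_time {t : ℝ} (ht : t < 1) (σ : ℝ) :
    HasDerivAt (fun t => p.value t σ) (p.timeDeriv t σ) t := by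
  have hτ : 0 < 1 - t := by linarith
  have h0 : HasDerivAt (fun t : ℝ => 1 - t) (-1) t := by
    simpa using (hasDerivAt_id t).const_sub 1
  have h1 : HasDerivAt (fun t : ℝ => (1 - t) ^ (-γ)) (γ * (1 - t) ^ (-γ) / (1 - t)) t := by
    refine (h0.rpow_const (p := -γ) (Or.inl hτ.ne')).congr_deriv ?_
    rw [Real.rpow_sub_one hτ.ne']
    ring
  have h2 : HasDerivAt (fun t : ℝ => σ / (1 - t)) (σ / (1 - t) / (1 - t)) t := by
    have := (h0.inv hτ.ne').const_mul σ
    exact this.congr_deriv (by field_simp)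
  have h3 : HasDerivAt p.φ (deriv p.φ (σ / (1 - t))) (σ / (1 - t)) :=
    (p.contDiff_φ.differentiable (by simp) _).hasDerivAt
  have h4 := (((hasDerivAt_id t).mul h1).ofReal_comp).mul
    ((h3.scomp t h2).const_mul (cutoff σ : ℂ))
  refine HasDerivAt.congr_deriv h4 ?_
  simp only [timeDeriv, id, Complex.real_smul, Function.comp_apply, Pi.mul_apply]
  push_cast
  ring

lemma flux_eq (t : ℝ) : p.flux t = fun σ => ((t * (1 - t) ^ (-γ) : ℝ) : ℂ) *
    (2 * deriv cutoff σ * (p.a (σ / (1 - t)) * p.φ (σ / (1 - t)))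
      + cutoff σ * (2 * p.a (σ / (1 - t)) * deriv p.φ (σ / (1 - t))) / ((1 - t : ℝ) : ℂ)) := by
  ext σ
  simp only [flux, valueDeriv]
  ring

/-- `D h + 2 σ h'` at `σ = |x|²` is the divergence of `h(|x|²) x`. The profile equation cancels
every term in which the cutoff is not differentiated; what remains is the commutator with the cutoff
and the term from differentiating the factor `t`. -/
lemma timeDeriv_eq {t : ℝ} (ht : t < 1) (σ : ℝ) :
    p.timeDeriv t σ = D * p.flux t σ + 2 * σ * deriv (p.flux t) σ + p.force t σ := by
  have hτ : ((1 - t : ℝ) : ℂ) ≠ 0 := by exact_mod_cast (by linarith : (1 - t) ≠ 0)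
  have hg : ContDiff ℝ ∞ fun s => 2 * p.a s * deriv p.φ s :=
    (contDiff_const.mul p.contDiff_a).mul p.contDiff_deriv_φ
  have h1 := ((((hasDerivAt_deriv_cutoff σ).const_mul 2).mul
    (hasDerivAt_rescale p.contDiff_mul t σ)).add
    (((hasDerivAt_cutoff σ).mul (hasDerivAt_rescale hg t σ)).div_const
      ((1 - t : ℝ) : ℂ))).const_mul ((t * (1 - t) ^ (-γ) : ℝ) : ℂ)
  have h2 := (h1.congr_of_eventuallyEq (f₁ := p.flux t)
    (Filter.Eventually.of_forall fun z => congrFun (p.flux_eq t) z)).deriv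
  rw [h2]
  simp only [flux_eq, timeDeriv, force, p.eqn]
  -- Writing `σ = S T`, with similarity variable `S` and `T = 1 - t`, turns the claim into a
  -- rational identity.
  have hs : (σ : ℂ) = ((σ / (1 - t) : ℝ) : ℂ) * ((1 - t : ℝ) : ℂ) := by
    rw [← Complex.ofReal_mul, div_mul_cancel₀]
    linarith
  generalize hS : ((σ / (1 - t) : ℝ) : ℂ) = S at *
  generalize hT : ((1 - t : ℝ) : ℂ) = T at *
  rw [hs]
  push_cast
  field_simp
  ring

lemma contDiff_value (t : ℝ) : ContDiff ℝ ∞ (p.value t) :=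
  contDiff_const.mul ((Complex.ofRealCLM.contDiff.comp contDiff_cutoff).mul
    (p.contDiff_φ.comp (contDiff_id.div_const _)))

lemma contDiff_flux (t : ℝ) : ContDiff ℝ ∞ (p.flux t) := by
  have h : deriv (p.value t) = p.valueDeriv t := funext fun σ => (p.hasDerivAt_value t σ).deriv
  refine (contDiff_const.mul (p.contDiff_a.comp (contDiff_id.div_const _))).mul ?_
  rw [← h]
  exact (p.contDiff_value t).deriv'

lemma value_of_lt (t : ℝ) {σ : ℝ} (h : 2 < σ) : p.value t σ = 0 := by
  simp [value, cutoff_of_lt h]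

lemma valueDeriv_of_lt (t : ℝ) {σ : ℝ} (h : 2 < σ) : p.valueDeriv t σ = 0 := by
  simp [valueDeriv, cutoff_of_lt h, deriv_cutoff_of_lt h]

lemma timeDeriv_of_lt (t : ℝ) {σ : ℝ} (h : 2 < σ) : p.timeDeriv t σ = 0 := by
  simp [timeDeriv, cutoff_of_lt h]

lemma force_of_lt (t : ℝ) {σ : ℝ} (h : 2 < σ) : p.force t σ = 0 := by
  simp [force, cutoff_of_lt h, deriv_cutoff_of_lt h, deriv_deriv_cutoff_of_lt h]

lemma continuousOn_sim : ContinuousOn (fun q : ℝ × ℝ => q.2 / (1 - q.1)) (Set.Iio 1 ×ˢ Set.univ) :=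
  continuousOn_snd.div (by fun_prop) fun q hq => (sub_pos.2 hq.1).ne'

lemma continuousOn_rpow_sim (γ : ℝ) :
    ContinuousOn (fun q : ℝ × ℝ => (((1 - q.1) ^ (-γ) : ℝ) : ℂ)) (Set.Iio 1 ×ˢ Set.univ) :=
  Complex.continuous_ofReal.comp_continuousOn
    (ContinuousOn.rpow_const (by fun_prop) fun q hq => Or.inl (sub_pos.2 hq.1).ne')

lemma continuousOn_inv_sim :
    ContinuousOn (fun q : ℝ × ℝ => (((1 - q.1 : ℝ) : ℂ))⁻¹) (Set.Iio 1 ×ˢ Set.univ) :=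
  ContinuousOn.inv₀ (by fun_prop) fun q hq => by exact_mod_cast (sub_pos.2 hq.1).ne'

lemma continuousOn_comp_sim {f : ℝ → ℂ} (hf : Continuous f) :
    ContinuousOn (fun q : ℝ × ℝ => f (q.2 / (1 - q.1))) (Set.Iio 1 ×ˢ Set.univ) :=
  hf.comp_continuousOn continuousOn_sim

lemma continuousOn_valueDeriv :
    ContinuousOn (Function.uncurry p.valueDeriv) (Set.Iio 1 ×ˢ Set.univ) := by
  have h1 := continuousOn_rpow_sim γ
  have h2 := continuousOn_comp_sim p.contDiff_φ.continuous
  have h3 := continuousOn_comp_sim p.contDiff_deriv_φ.continuous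
  have h4 := continuousOn_inv_sim
  have h5 := contDiff_cutoff.continuous
  have h6 := contDiff_deriv_cutoff.continuous
  simp only [Function.uncurry_def, valueDeriv, Complex.ofReal_mul, div_eq_mul_inv _ (Complex.ofReal _)]
  fun_prop

lemma continuousOn_flux :
    ContinuousOn (Function.uncurry p.flux) (Set.Iio 1 ×ˢ Set.univ) :=
  (continuousOn_const.mul (continuousOn_comp_sim p.contDiff_a.continuous)).mul
    p.continuousOn_valueDeriv

lemma continuousOn_value :
    ContinuousOn (Function.uncurry p.value) (Set.Iio 1 ×ˢ Set.univ) := by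
  have h1 := continuousOn_rpow_sim γ
  have h2 := continuousOn_comp_sim p.contDiff_φ.continuous
  have h5 := contDiff_cutoff.continuous
  simp only [Function.uncurry_def, value, Complex.ofReal_mul]
  fun_prop

lemma continuousOn_timeDeriv :
    ContinuousOn (Function.uncurry p.timeDeriv) (Set.Iio 1 ×ˢ Set.univ) := by
  have h1 := continuousOn_rpow_sim γ
  have h2 := continuousOn_comp_sim p.contDiff_φ.continuous
  have h3 := continuousOn_comp_sim p.contDiff_deriv_φ.continuous
  have h4 := continuousOn_inv_sim
  have h5 := contDiff_cutoff.continuous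
  have h7 := Complex.continuous_ofReal.comp_continuousOn continuousOn_sim
  simp only [Function.uncurry_def, timeDeriv, div_eq_mul_inv _ (Complex.ofReal _)]
  fun_prop

lemma continuousOn_force :
    ContinuousOn (Function.uncurry p.force) (Set.Iio 1 ×ˢ Set.univ) := by
  have h1 := continuousOn_rpow_sim γ
  have h2 := continuousOn_comp_sim p.contDiff_φ.continuous
  have h3 := continuousOn_comp_sim p.contDiff_deriv_φ.continuous
  have h4 := continuousOn_comp_sim p.contDiff_a.continuous
  have h8 := continuousOn_comp_sim (p.contDiff_mul.continuous_deriv (by simp))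
  have h5 := contDiff_cutoff.continuous
  have h6 := contDiff_deriv_cutoff.continuous
  have h9 := contDiff_deriv_cutoff.continuous_deriv (by simp)
  have h7 := Complex.continuous_ofReal.comp_continuousOn continuousOn_sim
  simp only [Function.uncurry_def, force]
  fun_prop

end SelfSimilarProfile

/-! ### Pointwise bounds for the solution, its gradient and the force -/

namespace SelfSimilarProfile

variable {D γ : ℝ} (p : SelfSimilarProfile D γ)

lemma rpow_neg_mul_rpow_neg_sim (γ : ℝ) {τ σ : ℝ} (hτ : 0 < τ) (hσ : 0 ≤ σ) :
    τ ^ (-γ) * (1 + σ / τ) ^ (-γ) = (τ + σ) ^ (-γ) := by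
  rw [← Real.mul_rpow hτ.le (by positivity)]
  congr 1
  field_simp

lemma norm_φ_le' {s : ℝ} (hs : 0 ≤ s) : ‖p.φ s‖ ≤ p.C * (1 + s) ^ (-γ) := by
  rw [Real.rpow_neg (by linarith), ← div_eq_mul_inv, le_div_iff₀ (by positivity)]
  exact p.norm_φ_le s hs

lemma norm_deriv_φ_le' {s : ℝ} (hs : 0 ≤ s) :
    ‖deriv p.φ s‖ * (1 + s) ≤ p.C * (1 + s) ^ (-γ) := by
  rw [Real.rpow_neg (by linarith), ← div_eq_mul_inv, le_div_iff₀ (by positivity), mul_assoc]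
  have h := p.norm_deriv_φ_le s hs
  rwa [Real.rpow_add (by linarith), Real.rpow_one, mul_comm ((1 + s) ^ γ)] at h

/-- The cutoff terms of the force contain `s (a φ)'`. The decay `(1 + s) |a'| ≤ C` makes this no
larger than `φ` itself, up to a constant. -/
lemma norm_deriv_mul_le {s : ℝ} (hs : 0 ≤ s) :
    ‖deriv (fun s => p.a s * p.φ s) s‖ * s ≤ 2 * p.C ^ 2 * (1 + s) ^ (-γ) := by
  have ha : HasDerivAt p.a (deriv p.a s) s :=
    (p.contDiff_a.differentiable (by simp) s).hasDerivAt
  have hφ : HasDerivAt p.φ (deriv p.φ s) s :=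
    (p.contDiff_φ.differentiable (by simp) s).hasDerivAt
  have hd : deriv (fun s => p.a s * p.φ s) s = deriv p.a s * p.φ s + p.a s * deriv p.φ s :=
    (ha.mul hφ).deriv
  have hY : 0 < (1 + s) ^ (-γ) := by positivity
  have h1 : ‖deriv p.a s‖ * s ≤ p.C :=
    le_trans (by gcongr; linarith) (p.norm_deriv_a_le s hs)
  have h2 : ‖deriv p.φ s‖ * s ≤ p.C * (1 + s) ^ (-γ) :=
    le_trans (by gcongr; linarith) (p.norm_deriv_φ_le' hs)
  have hC := p.C_pos
  calc ‖deriv (fun s => p.a s * p.φ s) s‖ * s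
      ≤ (‖deriv p.a s‖ * ‖p.φ s‖ + ‖p.a s‖ * ‖deriv p.φ s‖) * s := by
        rw [hd]; gcongr
        refine (norm_add_le _ _).trans ?_
        rw [norm_mul, norm_mul]
    _ = (‖deriv p.a s‖ * s) * ‖p.φ s‖ + ‖p.a s‖ * (‖deriv p.φ s‖ * s) := by ring
    _ ≤ p.C * (p.C * (1 + s) ^ (-γ)) + p.C * (p.C * (1 + s) ^ (-γ)) := by
        gcongr
        · exact p.norm_φ_le' hs
        · exact p.norm_a_le s hs
    _ = _ := by ring

lemma norm_value_le {M t σ : ℝ} (hM : |cutoff σ| ≤ M) (ht0 : 0 ≤ t) (ht1 : t < 1) (hσ : 0 ≤ σ) :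
    ‖p.value t σ‖ ≤ M * p.C * (1 - t + σ) ^ (-γ) := by
  have hτ : 0 < 1 - t := by linarith
  have hs : 0 ≤ σ / (1 - t) := by positivity
  have hM0 : 0 ≤ M := (abs_nonneg _).trans hM
  have hC := p.C_pos
  rw [value, norm_mul, norm_mul, Complex.norm_real, Complex.norm_real, norm_mul,
    Real.norm_of_nonneg ht0, Real.norm_of_nonneg (by positivity : 0 ≤ (1 - t) ^ (-γ)),
    Real.norm_eq_abs, ← rpow_neg_mul_rpow_neg_sim γ hτ hσ]
  calc t * (1 - t) ^ (-γ) * (|cutoff σ| * ‖p.φ (σ / (1 - t))‖)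
      ≤ 1 * (1 - t) ^ (-γ) * (M * (p.C * (1 + σ / (1 - t)) ^ (-γ))) := by
        gcongr
        exact p.norm_φ_le' hs
    _ = _ := by ring

/-- The gradient has length `2 |valueDeriv| √σ`. Differentiating in `σ` costs a factor `1 / (1 - t +
σ)`, and `√σ` returns half of that power; the cutoff term is absorbed using `1 - t + σ ≤ 3`. -/
lemma norm_valueDeriv_mul_sqrt_le {M t σ : ℝ} (hM : |cutoff σ| ≤ M) (hM' : |deriv cutoff σ| ≤ M)
    (ht0 : 0 ≤ t) (ht1 : t < 1) (hσ : 0 ≤ σ) (hσ2 : σ ≤ 2) :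
    ‖p.valueDeriv t σ‖ * √σ ≤ 4 * M * p.C * (1 - t + σ) ^ (-γ - 1 / 2) := by
  have hτ : 0 < 1 - t := by linarith
  have hτσ : 0 < 1 - t + σ := by linarith
  have hs : 0 ≤ σ / (1 - t) := by positivity
  have hM0 : 0 ≤ M := (abs_nonneg _).trans hM
  have hC := p.C_pos
  set Y := (1 + σ / (1 - t)) ^ (-γ) with hY
  have hYpos : 0 < Y := by positivity
  have hφ := p.norm_φ_le' hs
  have hφ' : ‖deriv p.φ (σ / (1 - t))‖ / (1 - t) ≤ p.C * Y / (1 - t + σ) := by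
    rw [le_div_iff₀ hτσ]
    refine le_trans (le_of_eq ?_) (p.norm_deriv_φ_le' hs)
    field_simp
  have h1 : ‖p.valueDeriv t σ‖ ≤ (1 - t) ^ (-γ) * (M * (p.C * Y) + M * (p.C * Y / (1 - t + σ))) := by
    rw [valueDeriv, norm_mul, Complex.norm_real, norm_mul, Real.norm_of_nonneg ht0,
      Real.norm_of_nonneg (by positivity : 0 ≤ (1 - t) ^ (-γ))]
    calc _ ≤ 1 * (1 - t) ^ (-γ) * (M * (p.C * Y) + M * (p.C * Y / (1 - t + σ))) := by
          gcongr
          refine (norm_add_le _ _).trans ?_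
          rw [norm_mul, norm_mul, norm_div, Complex.norm_real, Complex.norm_real, Complex.norm_real,
            Real.norm_of_nonneg hτ.le, Real.norm_eq_abs, Real.norm_eq_abs]
          gcongr
      _ = _ := by rw [one_mul]
  have h2 : (1 - t) ^ (-γ) * (M * (p.C * Y) + M * (p.C * Y / (1 - t + σ)))
      = M * p.C * (1 - t + σ) ^ (-γ) * (1 + 1 / (1 - t + σ)) := by
    rw [← rpow_neg_mul_rpow_neg_sim γ hτ hσ]; ring
  have h3 : 1 + 1 / (1 - t + σ) ≤ 4 / (1 - t + σ) := by
    rw [← sub_nonneg]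
    have : 4 / (1 - t + σ) - (1 + 1 / (1 - t + σ)) = (3 - (1 - t + σ)) / (1 - t + σ) := by
      field_simp; ring
    rw [this]
    exact div_nonneg (by linarith) hτσ.le
  have h4 : √σ ≤ (1 - t + σ) ^ (1 / 2 : ℝ) := by
    rw [← Real.sqrt_eq_rpow]; exact Real.sqrt_le_sqrt (by linarith)
  calc ‖p.valueDeriv t σ‖ * √σ
      ≤ (M * p.C * (1 - t + σ) ^ (-γ) * (4 / (1 - t + σ))) * (1 - t + σ) ^ (1 / 2 : ℝ) := by
        gcongr
        exact (h1.trans_eq h2).trans (by gcongr)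
    _ = 4 * M * p.C * ((1 - t + σ) ^ (-γ) * (1 - t + σ) ^ (1 / 2 : ℝ) / (1 - t + σ) ^ (1 : ℝ)) := by
        rw [Real.rpow_one]; ring
    _ = _ := by
        rw [← Real.rpow_add hτσ, ← Real.rpow_sub hτσ]; ring_nf

lemma norm_force_le {M t σ : ℝ} (hM : |cutoff σ| ≤ M) (hM' : |deriv cutoff σ| ≤ M)
    (hM'' : |deriv (deriv cutoff) σ| ≤ M) (ht0 : 0 ≤ t) (ht1 : t < 1) (hσ : 0 ≤ σ) (hσ2 : σ ≤ 2) :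
    ‖p.force t σ‖
      ≤ (M * p.C + ((2 * |D| + 8) * M * p.C ^ 2 + 8 * M * p.C ^ 2 + 4 * M * p.C ^ 2))
        * (1 - t + σ) ^ (-γ) := by
  have hτ : 0 < 1 - t := by linarith
  have hs : 0 ≤ σ / (1 - t) := by positivity
  have hM0 : 0 ≤ M := (abs_nonneg _).trans hM
  have hC := p.C_pos
  rw [force, norm_mul, Complex.norm_real, Real.norm_of_nonneg (by positivity : 0 ≤ (1 - t) ^ (-γ)),
    ← rpow_neg_mul_rpow_neg_sim γ hτ hσ]
  set s := σ / (1 - t) with hsdef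
  set Y := (1 + s) ^ (-γ) with hY
  have hYpos : 0 < Y := by positivity
  have hφ := p.norm_φ_le' hs
  have ha := p.norm_a_le s hs
  have b1 : ‖(cutoff σ : ℂ) * p.φ s‖ ≤ M * p.C * Y := by
    rw [norm_mul, Complex.norm_real, Real.norm_eq_abs, mul_assoc]
    gcongr
  have b2 : ‖(2 * D * deriv cutoff σ + 4 * σ * deriv (deriv cutoff) σ : ℂ) * (p.a s * p.φ s)‖
      ≤ (2 * |D| + 8) * M * p.C ^ 2 * Y := by
    have : (2 * D * deriv cutoff σ + 4 * σ * deriv (deriv cutoff) σ : ℂ)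
        = ((2 * D * deriv cutoff σ + 4 * σ * deriv (deriv cutoff) σ : ℝ) : ℂ) := by push_cast; ring
    rw [this, norm_mul, norm_mul, Complex.norm_real, Real.norm_eq_abs]
    have h1 : |2 * D * deriv cutoff σ + 4 * σ * deriv (deriv cutoff) σ| ≤ (2 * |D| + 8) * M := by
      refine (abs_add_le _ _).trans ?_
      rw [abs_mul, abs_mul, abs_mul, abs_mul, abs_of_nonneg hσ, abs_of_pos (by norm_num : (0 : ℝ) < 2),
        abs_of_pos (by norm_num : (0 : ℝ) < 4)]
      calc _ ≤ 2 * |D| * M + 4 * 2 * M := by gcongr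
        _ = _ := by ring
    calc _ ≤ (2 * |D| + 8) * M * (p.C * (p.C * Y)) := by gcongr
      _ = _ := by ring
  have b3 : ‖(4 * deriv cutoff σ * (s : ℝ) * deriv (fun s => p.a s * p.φ s) s : ℂ)‖
      ≤ 8 * M * p.C ^ 2 * Y := by
    rw [norm_mul, norm_mul, norm_mul, Complex.norm_real, Complex.norm_real, Real.norm_eq_abs,
      Real.norm_of_nonneg hs]
    calc _ = ‖(4 : ℂ)‖ * |deriv cutoff σ| * (‖deriv (fun s => p.a s * p.φ s) s‖ * s) := by ring
      _ ≤ ‖(4 : ℂ)‖ * M * (2 * p.C ^ 2 * Y) := by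
        exact mul_le_mul (by gcongr) (p.norm_deriv_mul_le hs) (by positivity) (by positivity)
      _ = _ := by norm_num; ring
  have b4 : ‖(2 * deriv cutoff σ * (s : ℝ) * (2 * p.a s * deriv p.φ s) : ℂ)‖
      ≤ 4 * M * p.C ^ 2 * Y := by
    have h2 : ‖deriv p.φ s‖ * s ≤ p.C * Y :=
      le_trans (by gcongr; linarith) (p.norm_deriv_φ_le' hs)
    rw [norm_mul, norm_mul, norm_mul, norm_mul, norm_mul, Complex.norm_real, Complex.norm_real,
      Real.norm_eq_abs, Real.norm_of_nonneg hs]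
    calc _ = ‖(2 : ℂ)‖ ^ 2 * |deriv cutoff σ| * (‖p.a s‖ * (‖deriv p.φ s‖ * s)) := by ring
      _ ≤ ‖(2 : ℂ)‖ ^ 2 * M * (p.C * (p.C * Y)) := by gcongr
      _ = _ := by norm_num; ring
  have b5 := (norm_add_le _ _).trans (add_le_add ((norm_add_le _ _).trans (add_le_add b2 b3)) b4)
  have b6 := norm_sub_le (cutoff σ * p.φ s) ((t : ℂ) *
    ((2 * D * deriv cutoff σ + 4 * σ * deriv (deriv cutoff) σ) * (p.a s * p.φ s)
      + 4 * deriv cutoff σ * (s : ℝ) * deriv (fun s => p.a s * p.φ s) s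
      + 2 * deriv cutoff σ * (s : ℝ) * (2 * p.a s * deriv p.φ s)))
  rw [norm_mul (t : ℂ), Complex.norm_real, Real.norm_of_nonneg ht0] at b6
  have b7 : ∀ z : ℝ, 0 ≤ z → t * z ≤ z := fun z hz => by nlinarith
  have b8 := b6.trans (add_le_add b1 ((b7 _ (norm_nonneg _)).trans b5))
  calc _ ≤ (1 - t) ^ (-γ) * (M * p.C * Y + ((2 * |D| + 8) * M * p.C ^ 2 * Y
        + 8 * M * p.C ^ 2 * Y + 4 * M * p.C ^ 2 * Y)) := by gcongr
    _ = _ := by ring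

/-- Time and space are separated here. A small `β` moves part of the singularity of `(1 - t + σ)^(-γ
- 1/2)` into space, leaving `(1 - t)^(β - 1/2)`, which is square integrable in time. -/
lemma exists_bounds (hγ : 0 < γ) {β : ℝ} (hβ : 0 < β) (hβ' : β < 1 / 2) :
    ∃ M : ℝ, 0 < M ∧ ∀ t σ, 0 ≤ t → t < 1 → 0 < σ → σ ≤ 2 →
      ‖p.value t σ‖ ≤ M * σ ^ (-(γ + β)) ∧ ‖p.force t σ‖ ≤ M * σ ^ (-(γ + β)) ∧
      ‖p.valueDeriv t σ‖ * √σ ≤ M * (1 - t) ^ (β - 1 / 2) * σ ^ (-(γ + β)) := by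
  obtain ⟨K, hK, hb⟩ := exists_cutoff_bound
  have hC := p.C_pos
  refine ⟨max (K * p.C * 2) (max ((K * p.C + ((2 * |D| + 8) * K * p.C ^ 2 + 8 * K * p.C ^ 2
    + 4 * K * p.C ^ 2)) * 2) (4 * K * p.C)), by positivity, fun t σ ht0 ht1 hσ hσ2 => ?_⟩
  have hτ : 0 < 1 - t := by linarith
  obtain ⟨h1, h2, h3⟩ := hb σ hσ.le
  have e1 : (1 - t + σ) ^ (-γ) ≤ 2 * σ ^ (-(γ + β)) := by
    calc (1 - t + σ) ^ (-γ) ≤ σ ^ (-γ) :=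
          Real.rpow_le_rpow_of_nonpos hσ (by linarith) (by linarith)
      _ = σ ^ β * σ ^ (-(γ + β)) := by rw [← Real.rpow_add hσ]; ring_nf
      _ ≤ 2 * σ ^ (-(γ + β)) := by
          gcongr
          calc σ ^ β ≤ 2 ^ β := Real.rpow_le_rpow hσ.le hσ2 hβ.le
            _ ≤ 2 ^ (1 : ℝ) := Real.rpow_le_rpow_of_exponent_le (by norm_num) (by linarith)
            _ = 2 := Real.rpow_one _
  have e2 : (1 - t + σ) ^ (-γ - 1 / 2) ≤ (1 - t) ^ (β - 1 / 2) * σ ^ (-(γ + β)) := by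
    have : (1 - t + σ) ^ (-γ - 1 / 2)
        = (1 - t + σ) ^ (β - 1 / 2) * (1 - t + σ) ^ (-(γ + β)) := by
      rw [← Real.rpow_add (by linarith)]; ring_nf
    rw [this]
    exact mul_le_mul (Real.rpow_le_rpow_of_nonpos hτ (by linarith) (by linarith))
      (Real.rpow_le_rpow_of_nonpos hσ (by linarith) (by linarith)) (by positivity) (by positivity)
  refine ⟨?_, ?_, ?_⟩
  · calc _ ≤ _ := p.norm_value_le h1 ht0 ht1 hσ.le
      _ ≤ K * p.C * (2 * σ ^ (-(γ + β))) := by gcongr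
      _ = (K * p.C * 2) * σ ^ (-(γ + β)) := by ring
      _ ≤ _ := by gcongr; exact le_max_left _ _
  · calc _ ≤ _ := p.norm_force_le h1 h2 h3 ht0 ht1 hσ.le hσ2
      _ ≤ _ * (2 * σ ^ (-(γ + β))) := mul_le_mul_of_nonneg_left e1 (by positivity)
      _ = (_ * 2) * σ ^ (-(γ + β)) := (mul_assoc _ _ _).symm
      _ ≤ _ := by
        gcongr
        exact (le_max_left _ _).trans (le_max_right _ _)
  · calc _ ≤ _ := p.norm_valueDeriv_mul_sqrt_le h1 h2 ht0 ht1 hσ.le hσ2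
      _ ≤ (4 * K * p.C) * ((1 - t) ^ (β - 1 / 2) * σ ^ (-(γ + β))) := by gcongr
      _ ≤ _ * ((1 - t) ^ (β - 1 / 2) * σ ^ (-(γ + β))) := by
        gcongr
        exact (le_max_right _ _).trans (le_max_right _ _)
      _ = _ := (mul_assoc _ _ _).symm

end SelfSimilarProfile

/-! ### Radial functions on `ℝ^d` -/

lemma hasFDerivAt_comp_norm_sq {E : Type*} [NormedAddCommGroup E] [InnerProductSpace ℝ E]
    {h : ℝ → ℂ} {h' : ℂ} {x : E} (hh : HasDerivAt h h' (‖x‖ ^ 2)) :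
    HasFDerivAt (fun x => h (‖x‖ ^ 2)) (((2 : ℝ) • innerSL ℝ x).smulRight h') x := by
  refine (hh.hasFDerivAt.comp x (hasStrictFDerivAt_norm_sq x).hasFDerivAt).congr_fderiv ?_
  ext y
  simp
  ring

lemma fderiv_comp_norm_sq_single {d : ℕ} {h : ℝ → ℂ} {h' : ℂ} {x : EuclideanSpace ℝ (Fin d)}
    (hh : HasDerivAt h h' (‖x‖ ^ 2)) (i : Fin d) :
    fderiv ℝ (fun x : EuclideanSpace ℝ (Fin d) => h (‖x‖ ^ 2)) x (EuclideanSpace.single i 1)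
      = 2 * h' * x i := by
  rw [(hasFDerivAt_comp_norm_sq hh).fderiv]
  simp [EuclideanSpace.inner_single_right]
  ring

lemma contDiff_comp_norm_sq {d : ℕ} {h : ℝ → ℂ} (hh : ContDiff ℝ ∞ h) :
    ContDiff ℝ ∞ fun x : EuclideanSpace ℝ (Fin d) => h (‖x‖ ^ 2) :=
  hh.comp (contDiff_norm_sq ℝ)

/-- The closed ball which supports the solution. -/
def suppBall (d : ℕ) : Set (EuclideanSpace ℝ (Fin d)) := Metric.closedBall 0 √2

lemma isCompact_suppBall (d : ℕ) : IsCompact (suppBall d) := isCompact_closedBall _ _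

lemma mem_suppBall {d : ℕ} {x : EuclideanSpace ℝ (Fin d)} : x ∈ suppBall d ↔ ‖x‖ ^ 2 ≤ 2 := by
  rw [suppBall, mem_closedBall_zero_iff]
  exact Real.le_sqrt (norm_nonneg x) (by norm_num)

lemma two_lt_of_notMem_suppBall {d : ℕ} {x : EuclideanSpace ℝ (Fin d)} (h : x ∉ suppBall d) :
    2 < ‖x‖ ^ 2 := not_le.1 fun h' => h (mem_suppBall.2 h')

/-- In polar coordinates the integrand becomes `y ^ (d - 1 - 2 q)` on `(0, √2]`. -/
lemma integrableOn_suppBall_rpow {d : ℕ} (hd : 0 < d) {q : ℝ} (hq : 2 * q < d) :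
    IntegrableOn (fun x : EuclideanSpace ℝ (Fin d) => (‖x‖ ^ 2) ^ (-q)) (suppBall d) := by
  have : Nonempty (Fin d) := ⟨⟨0, hd⟩⟩
  have hm : MeasurableSet (suppBall d) := (isCompact_suppBall d).measurableSet
  rw [← integrable_indicator_iff hm]
  have h1 : (suppBall d).indicator (fun x => (‖x‖ ^ 2) ^ (-q))
      = fun x => (Set.Iic √2).indicator (fun y : ℝ => (y ^ 2) ^ (-q)) ‖x‖ := by
    ext x
    by_cases hx : x ∈ suppBall d
    · rw [Set.indicator_of_mem hx, Set.indicator_of_mem]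
      exact mem_closedBall_zero_iff.1 hx
    · rw [Set.indicator_of_notMem hx, Set.indicator_of_notMem]
      exact fun h => hx (mem_closedBall_zero_iff.2 h)
  rw [h1, integrable_fun_norm_addHaar, finrank_euclideanSpace_fin]
  have h2 : IntegrableOn (fun y : ℝ => y ^ ((d : ℝ) - 1 - 2 * q)) (Set.Ioc 0 √2) := by
    have := intervalIntegral.intervalIntegrable_rpow' (a := 0) (b := √2)
      (show -1 < (d : ℝ) - 1 - 2 * q by linarith)
    exact (intervalIntegrable_iff_integrableOn_Ioc_of_le (Real.sqrt_nonneg _)).1 this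
  have h3 : IntegrableOn ((Set.Iic √2).indicator fun y : ℝ => y ^ ((d : ℝ) - 1 - 2 * q))
      (Set.Ioi 0) := by
    rw [IntegrableOn, integrable_indicator_iff measurableSet_Iic, IntegrableOn,
      Measure.restrict_restrict measurableSet_Iic, Set.inter_comm, Set.Ioi_inter_Iic]
    exact h2
  refine h3.congr_fun (fun y hy => ?_) measurableSet_Ioi
  have hy0 : 0 < y := hy
  by_cases hy2 : y ∈ Set.Iic √2
  · simp only [Set.indicator_of_mem hy2, smul_eq_mul]
    rw [← Real.rpow_natCast y 2, ← Real.rpow_mul hy0.le, ← Real.rpow_natCast y (d - 1),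
      ← Real.rpow_add hy0, Nat.cast_sub hd]
    congr 1
    push_cast
    ring
  · simp only [Set.indicator_of_notMem hy2, smul_zero]

/-- The `L²` norm over the supporting ball of `|x|^{-2 q}`. -/
noncomputable def ballConst (d : ℕ) (q : ℝ) : ℝ := √(∫ x in suppBall d, (‖x‖ ^ 2) ^ (-(2 * q)))

/-- A pointwise bound by `(|x|²)^(-q)` is squared before integration; hence the condition `4 q < d`,
which for `q = γ + β` is where `γ < d/4` enters the norm estimates. -/
lemma norm_toLp_le_ballConst {d : ℕ} (hd : 0 < d) {q : ℝ} (hq : 4 * q < d) {G : Type*}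
    [NormedAddCommGroup G] [InnerProductSpace ℂ G] {F : EuclideanSpace ℝ (Fin d) → G} {A : ℝ}
    (hA : 0 ≤ A) (hF : MemLp F 2 volume) (hF0 : ∀ x ∉ suppBall d, F x = 0)
    (hFA : ∀ x, 0 < ‖x‖ ^ 2 → ‖x‖ ^ 2 ≤ 2 → ‖F x‖ ≤ A * (‖x‖ ^ 2) ^ (-q)) :
    ‖hF.toLp F‖ ≤ A * ballConst d q := by
  have : Nonempty (Fin d) := ⟨⟨0, hd⟩⟩
  have hm : MeasurableSet (suppBall d) := (isCompact_suppBall d).measurableSet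
  have hint := integrableOn_suppBall_rpow (q := 2 * q) hd (by linarith)
  rw [ballConst, ← Real.sqrt_sq hA, ← Real.sqrt_mul (sq_nonneg A)]
  refine Real.le_sqrt_of_sq_le ?_
  rw [norm_toLp_sq, ← setIntegral_eq_integral_of_forall_compl_eq_zero (s := suppBall d)
    (fun x hx => by rw [hF0 x hx]; simp), ← integral_const_mul]
  refine setIntegral_mono_ae_restrict (hF.integrable_norm_pow (by norm_num)).integrableOn
    (hint.const_mul _) ?_
  have h0 : ∀ᵐ x : EuclideanSpace ℝ (Fin d), x ≠ 0 := by
    rw [ae_iff]; simp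
  filter_upwards [ae_restrict_of_ae h0, ae_restrict_mem hm] with x hx hxm
  have hx2 : 0 < ‖x‖ ^ 2 := by have := norm_pos_iff.2 hx; positivity
  calc ‖F x‖ ^ 2 ≤ (A * (‖x‖ ^ 2) ^ (-q)) ^ 2 := by
        gcongr; exact hFA x hx2 (mem_suppBall.1 hxm)
    _ = A ^ 2 * (‖x‖ ^ 2) ^ (-(2 * q)) := by
        rw [mul_pow, ← Real.rpow_natCast ((‖x‖ ^ 2) ^ (-q)) 2, ← Real.rpow_mul hx2.le]
        congr 2
        push_cast; ring

/-! ### The elliptic coefficients and radial vector fields -/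

namespace SelfSimilarProfile

variable {d : ℕ} {γ : ℝ} (p : SelfSimilarProfile d γ)

/-- The elliptic coefficients. -/
noncomputable def coeff : Coeff d := fun t x => p.a (‖x‖ ^ 2 / (1 - t)) • (1 : Matrix (Fin d) (Fin d) ℂ)

lemma toEuclideanLin_coeff (t : ℝ) (x : EuclideanSpace ℝ (Fin d)) (ξ : EuclideanSpace ℂ (Fin d)) :
    Matrix.toEuclideanLin (p.coeff t x) ξ = p.a (‖x‖ ^ 2 / (1 - t)) • ξ := by
  simp [coeff, Matrix.toEuclideanLin]

lemma isElliptic_coeff : IsElliptic p.coeff where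
  measurable i j := by
    have h : Measurable fun q : ℝ × EuclideanSpace ℝ (Fin d) => p.a (‖q.2‖ ^ 2 / (1 - q.1)) :=
      p.contDiff_a.continuous.measurable.comp (by fun_prop)
    simp only [coeff, Matrix.smul_apply, smul_eq_mul]
    exact h.mul_const _
  bounds := by
    refine ⟨p.C, p.lam, p.C_pos, p.lam_pos, fun t ht x ξ => ?_⟩
    -- At `t = 1` the quotient is `0` by convention, so the coefficient is `a 0` and the bounds
    -- persist on the closed interval.
    have hs : 0 ≤ ‖x‖ ^ 2 / (1 - t) := div_nonneg (by positivity) (by linarith [ht.2])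
    rw [toEuclideanLin_coeff, norm_smul, inner_smul_right, inner_self_eq_norm_sq_to_K]
    refine ⟨mul_le_mul_of_nonneg_right (p.norm_a_le _ hs) (norm_nonneg _), ?_⟩
    have : ((‖ξ‖ : ℝ) : ℂ) ^ 2 = ((‖ξ‖ ^ 2 : ℝ) : ℂ) := by push_cast; rfl
    change _ ≤ (p.a (‖x‖ ^ 2 / (1 - t)) * ((‖ξ‖ : ℝ) : ℂ) ^ 2).re
    rw [this, Complex.re_mul_ofReal]
    exact mul_le_mul_of_nonneg_right (p.le_re _ hs) (by positivity)

/-- The vector field `h(|x|²) x`. -/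
noncomputable def radialField (h : ℝ → ℂ) (x : EuclideanSpace ℝ (Fin d)) : EuclideanSpace ℂ (Fin d) :=
  h (‖x‖ ^ 2) • WithLp.toLp 2 fun i => ((x i : ℝ) : ℂ)

lemma continuous_complexify : Continuous fun x : EuclideanSpace ℝ (Fin d) =>
    (WithLp.toLp 2 fun i => ((x i : ℝ) : ℂ) : EuclideanSpace ℂ (Fin d)) :=
  (PiLp.continuous_toLp 2 _).comp (by fun_prop)

lemma norm_complexify (x : EuclideanSpace ℝ (Fin d)) :
    ‖(WithLp.toLp 2 fun i => ((x i : ℝ) : ℂ) : EuclideanSpace ℂ (Fin d))‖ = ‖x‖ := by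
  simp [EuclideanSpace.norm_eq]

lemma norm_radialField (h : ℝ → ℂ) (x : EuclideanSpace ℝ (Fin d)) :
    ‖radialField h x‖ = ‖h (‖x‖ ^ 2)‖ * ‖x‖ := by
  rw [radialField, norm_smul, norm_complexify]

lemma radialField_apply (h : ℝ → ℂ) (x : EuclideanSpace ℝ (Fin d)) (i : Fin d) :
    radialField h x i = h (‖x‖ ^ 2) * x i := rfl

lemma sum_fderiv_radialField {h : ℝ → ℂ} {h' : ℂ} {x : EuclideanSpace ℝ (Fin d)}
    (hh : HasDerivAt h h' (‖x‖ ^ 2)) :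
    ∑ i, fderiv ℝ (fun x : EuclideanSpace ℝ (Fin d) => radialField h x i) x
      (EuclideanSpace.single i 1) = d * h (‖x‖ ^ 2) + 2 * (‖x‖ ^ 2 : ℝ) * h' := by
  have h1 : ∀ i, fderiv ℝ (fun x : EuclideanSpace ℝ (Fin d) => radialField h x i) x
      (EuclideanSpace.single i 1) = h (‖x‖ ^ 2) + 2 * h' * ((x i) ^ 2 : ℝ) := fun i => by
    have e1 := hasFDerivAt_comp_norm_sq hh
    have e2 : HasFDerivAt (fun x : EuclideanSpace ℝ (Fin d) => ((x i : ℝ) : ℂ))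
        (Complex.ofRealCLM.comp (EuclideanSpace.proj i)) x :=
      (Complex.ofRealCLM.comp (EuclideanSpace.proj (𝕜 := ℝ) i)).hasFDerivAt
    have e3 := (e1.mul e2).fderiv
    simp only [radialField_apply]
    refine (congrArg (fun L : EuclideanSpace ℝ (Fin d) →L[ℝ] ℂ =>
      L (EuclideanSpace.single i 1)) e3).trans ?_
    simp [EuclideanSpace.inner_single_right]
    ring
  simp only [h1, Finset.sum_add_distrib, Finset.sum_const, Finset.card_univ, Fintype.card_fin,
    nsmul_eq_mul, ← Finset.mul_sum]
  rw [EuclideanSpace.norm_sq_eq]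
  push_cast
  simp only [Real.norm_eq_abs, ← Complex.ofReal_pow, sq_abs]
  ring

lemma hasCompactSupport_of_suppBall {G : Type*} [Zero G] {F : EuclideanSpace ℝ (Fin d) → G}
    (h : ∀ x ∉ suppBall d, F x = 0) : HasCompactSupport F :=
  HasCompactSupport.intro (isCompact_suppBall d) fun x hx => h x hx

lemma contDiff_radialField {h : ℝ → ℂ} (hh : ContDiff ℝ ∞ h) (i : Fin d) :
    ContDiff ℝ ∞ fun x : EuclideanSpace ℝ (Fin d) => radialField h x i :=
  (contDiff_comp_norm_sq hh).mul
    (Complex.ofRealCLM.comp (EuclideanSpace.proj (𝕜 := ℝ) i)).contDiff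

lemma continuous_radialField {h : ℝ → ℂ} (hh : Continuous h) :
    Continuous fun x : EuclideanSpace ℝ (Fin d) => radialField h x :=
  (hh.comp (by fun_prop)).smul continuous_complexify

lemma memLp_radial {h : ℝ → ℂ} (hh : Continuous h) (h0 : ∀ σ, 2 < σ → h σ = 0) :
    MemLp (fun x : EuclideanSpace ℝ (Fin d) => h (‖x‖ ^ 2)) 2 volume :=
  (hh.comp (by fun_prop)).memLp_of_hasCompactSupport
    (hasCompactSupport_of_suppBall fun _ hx => h0 _ (two_lt_of_notMem_suppBall hx))

lemma radialField_of_notMem {h : ℝ → ℂ} (h0 : ∀ σ, 2 < σ → h σ = 0)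
    {x : EuclideanSpace ℝ (Fin d)} (hx : x ∉ suppBall d) : radialField h x = 0 := by
  rw [radialField, h0 _ (two_lt_of_notMem_suppBall hx), zero_smul]

lemma memLp_radialField {h : ℝ → ℂ} (hh : Continuous h) (h0 : ∀ σ, 2 < σ → h σ = 0) :
    MemLp (fun x : EuclideanSpace ℝ (Fin d) => radialField h x) 2 volume :=
  (continuous_radialField hh).memLp_of_hasCompactSupport
    (hasCompactSupport_of_suppBall fun _ hx => radialField_of_notMem h0 hx)

lemma continuousOn_radial {h : ℝ → ℝ → ℂ}
    (hh : ContinuousOn (Function.uncurry h) (Set.Iio 1 ×ˢ Set.univ)) :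
    ContinuousOn (Function.uncurry fun (t : ℝ) (x : EuclideanSpace ℝ (Fin d)) => h t (‖x‖ ^ 2))
      (Set.Iio 1 ×ˢ Set.univ) :=
  hh.comp (f := fun q : ℝ × EuclideanSpace ℝ (Fin d) => (q.1, ‖q.2‖ ^ 2)) (by fun_prop)
    fun _ hq => ⟨hq.1, trivial⟩

lemma continuousOn_radialField {h : ℝ → ℝ → ℂ}
    (hh : ContinuousOn (Function.uncurry h) (Set.Iio 1 ×ˢ Set.univ)) :
    ContinuousOn (Function.uncurry fun (t : ℝ) (x : EuclideanSpace ℝ (Fin d)) =>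
      radialField (h t) x) (Set.Iio 1 ×ˢ Set.univ) :=
  (continuousOn_radial hh).smul (continuous_complexify.comp continuous_snd).continuousOn

end SelfSimilarProfile

/-! ### Square integrability in time up to the blow-up -/

lemma memLp_two_rpow_one_sub {β : ℝ} (hβ : 0 < β) :
    MemLp (fun t : ℝ => (1 - t) ^ (β - 1 / 2)) 2 timeMeasure := by
  have hm : AEStronglyMeasurable (fun t : ℝ => (1 - t) ^ (β - 1 / 2)) timeMeasure :=
    (by fun_prop : Measurable fun t : ℝ => (1 - t) ^ (β - 1 / 2)).aestronglyMeasurable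
  rw [memLp_two_iff_integrable_sq hm]
  have h1 : IntervalIntegrable (fun t : ℝ => t ^ (2 * β - 1)) volume 0 1 :=
    intervalIntegral.intervalIntegrable_rpow' (by linarith)
  have h2 := (h1.comp_sub_left 1).symm
  rw [sub_zero, sub_self, intervalIntegrable_iff_integrableOn_Ioo_of_le zero_le_one] at h2
  refine h2.congr_fun (fun t ht => ?_) measurableSet_Ioo
  have hτ : 0 < 1 - t := by linarith [ht.2]
  change (1 - t) ^ (2 * β - 1) = ((1 - t) ^ (β - 1 / 2)) ^ 2
  rw [← Real.rpow_natCast ((1 - t) ^ (β - 1 / 2)) 2, ← Real.rpow_mul hτ.le]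
  congr 1
  push_cast; ring

lemma aestronglyMeasurable_of_continuousOn_Iio {X : Type*} [NormedAddCommGroup X] {g : ℝ → X}
    (hc : ContinuousOn g (Set.Iio 1)) : AEStronglyMeasurable g timeMeasure :=
  (hc.mono fun _ ht => ht.2).aestronglyMeasurable measurableSet_Ioo

lemma memLp_two_of_norm_le {X : Type*} [NormedAddCommGroup X] {g : ℝ → X}
    (hc : ContinuousOn g (Set.Iio 1)) {A β : ℝ} (hβ : 0 < β)
    (hb : ∀ t ∈ Set.Ioo (0 : ℝ) 1, ‖g t‖ ≤ A * (1 - t) ^ (β - 1 / 2)) :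
    MemLp g 2 timeMeasure := by
  refine (memLp_two_rpow_one_sub hβ).of_le_mul (c := A)
    (aestronglyMeasurable_of_continuousOn_Iio hc) ?_
  filter_upwards [ae_restrict_mem measurableSet_Ioo] with t ht
  have hτ : 0 < 1 - t := by linarith [ht.2]
  rw [Real.norm_of_nonneg (by positivity)]
  exact hb t ht

lemma memLp_two_of_continuousOn_Icc {X : Type*} [NormedAddCommGroup X] {g : ℝ → X}
    (hc : ContinuousOn g (Set.Icc 0 1)) : MemLp g 2 timeMeasure := by
  obtain ⟨K, hK⟩ := isCompact_Icc.exists_bound_of_continuousOn hc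
  refine MemLp.of_bound ((hc.mono Set.Ioo_subset_Icc_self).aestronglyMeasurable
    measurableSet_Ioo) K ?_
  filter_upwards [ae_restrict_mem measurableSet_Ioo] with t ht
    using hK t (Set.Ioo_subset_Icc_self ht)

lemma one_le_rpow_one_sub {β t : ℝ} (hβ : β < 1 / 2) (ht : t ∈ Set.Ioo (0 : ℝ) 1) :
    1 ≤ (1 - t) ^ (β - 1 / 2) :=
  Real.one_le_rpow_of_pos_of_le_one_of_nonpos (by linarith [ht.2]) (by linarith [ht.1])
    (by linarith)

lemma intervalIntegrable_of_memLp_timeMeasure {X : Type*} [NormedAddCommGroup X] {g : ℝ → X}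
    (hg : MemLp g 2 timeMeasure) : IntervalIntegrable g volume 0 1 := by
  rw [intervalIntegrable_iff_integrableOn_Ioo_of_le zero_le_one]
  exact hg.integrable (by norm_num)

/-! ### The localised profile as a Lions solution -/

namespace SelfSimilarProfile

variable {d : ℕ} {γ : ℝ} (p : SelfSimilarProfile d γ)

lemma contDiff_valueDeriv (t : ℝ) : ContDiff ℝ ∞ (p.valueDeriv t) := by
  have h : deriv (p.value t) = p.valueDeriv t := funext fun σ => (p.hasDerivAt_value t σ).deriv
  rw [← h]
  exact (p.contDiff_value t).deriv'

lemma continuous_timeDeriv (t : ℝ) : Continuous (p.timeDeriv t) := by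
  have h2 := p.contDiff_φ.continuous
  have h3 := p.contDiff_deriv_φ.continuous
  have h5 := contDiff_cutoff.continuous
  unfold timeDeriv
  fun_prop

lemma continuous_force (t : ℝ) : Continuous (p.force t) := by
  have h2 := p.contDiff_φ.continuous
  have h3 := p.contDiff_deriv_φ.continuous
  have h4 := p.contDiff_a.continuous
  have h8 := p.contDiff_mul.continuous_deriv (by simp)
  have h5 := contDiff_cutoff.continuous
  have h6 := contDiff_deriv_cutoff.continuous
  have h9 := contDiff_deriv_cutoff.continuous_deriv (by simp)
  unfold force
  fun_prop

/-- For each fixed `t`, even `t ≥ 1` where powers and quotients take conventional values, the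
function is continuous in `x` with compact support. The curve in `L²` is therefore defined for all
real times. -/
lemma memLp_value (t : ℝ) :
    MemLp (fun x : EuclideanSpace ℝ (Fin d) => p.value t (‖x‖ ^ 2)) 2 volume :=
  memLp_radial (p.contDiff_value t).continuous fun _ => p.value_of_lt t

lemma memLp_timeDeriv (t : ℝ) :
    MemLp (fun x : EuclideanSpace ℝ (Fin d) => p.timeDeriv t (‖x‖ ^ 2)) 2 volume :=
  memLp_radial (p.continuous_timeDeriv t) fun _ => p.timeDeriv_of_lt t

lemma memLp_force (t : ℝ) :
    MemLp (fun x : EuclideanSpace ℝ (Fin d) => p.force t (‖x‖ ^ 2)) 2 volume :=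
  memLp_radial (p.continuous_force t) fun _ => p.force_of_lt t

lemma memLp_grad (t : ℝ) : MemLp (fun x : EuclideanSpace ℝ (Fin d) =>
    radialField (fun σ => 2 * p.valueDeriv t σ) x) 2 volume :=
  memLp_radialField (continuous_const.mul (p.contDiff_valueDeriv t).continuous)
    fun σ hσ => by rw [p.valueDeriv_of_lt t hσ, mul_zero]

lemma flux_of_lt (t : ℝ) {σ : ℝ} (h : 2 < σ) : p.flux t σ = 0 := by
  rw [flux, p.valueDeriv_of_lt t h, mul_zero]

lemma memLp_flux (t : ℝ) : MemLp (fun x : EuclideanSpace ℝ (Fin d) =>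
    radialField (p.flux t) x) 2 volume :=
  memLp_radialField (p.contDiff_flux t).continuous fun _ => p.flux_of_lt t

/-- The solution as a curve in `H¹`. -/
noncomputable def sol (t : ℝ) : H1 d :=
  ⟨WithLp.toLp 2 ((p.memLp_value t).toLp _, (p.memLp_grad t).toLp _),
    isWeakGradient_toLp ((contDiff_comp_norm_sq (p.contDiff_value t)).of_le (by simp))
      (p.memLp_value t) (p.memLp_grad t)
      fun x i => by
        rw [fderiv_comp_norm_sq_single (p.hasDerivAt_value t _) i, radialField_apply]⟩

lemma toL2_sol (t : ℝ) : H1.toL2 d (p.sol t) = (p.memLp_value t).toLp _ := rfl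

lemma grad_sol (t : ℝ) : H1.grad d (p.sol t) = (p.memLp_grad t).toLp _ := rfl

/-- The forcing term as a curve in `L²`. -/
noncomputable def forceL2 (t : ℝ) : L2 d := (p.memLp_force t).toLp _

lemma divForm_sol (t : ℝ) :
    divForm p.coeff t (p.sol t) = HNeg1.div ((p.memLp_flux t).toLp _) := by
  have h : (fun x => Matrix.toEuclideanLin (p.coeff t x) (H1.grad d (p.sol t) x))
      =ᵐ[volume] fun x => radialField (p.flux t) x := by
    rw [grad_sol]
    filter_upwards [(p.memLp_grad t).coeFn_toLp] with x hx
    rw [hx, toEuclideanLin_coeff, radialField, radialField, smul_smul, flux]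
    congr 1
    ring
  have hm := (memLp_congr_ae h).2 (p.memLp_flux t)
  rw [divForm, coeffMul_eq_toLp hm]
  congr 1
  exact MemLp.toLp_congr _ _ h

/-- The equation at a fixed time: `timeDeriv_eq` identifies `timeDeriv - force` with the classical
divergence of the flux, and `ofL2_div_eq` carries this to `H⁻¹`. -/
lemma ofL2_timeDeriv {t : ℝ} (ht : t < 1) : HNeg1.ofL2 ((p.memLp_timeDeriv t).toLp _)
    = divForm p.coeff t (p.sol t) + HNeg1.ofL2 (p.forceL2 t) := by
  have hm : MemLp (fun x : EuclideanSpace ℝ (Fin d) =>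
      p.timeDeriv t (‖x‖ ^ 2) - p.force t (‖x‖ ^ 2)) 2 volume :=
    (p.memLp_timeDeriv t).sub (p.memLp_force t)
  have h1 : HNeg1.ofL2 (hm.toLp _) = HNeg1.div ((p.memLp_flux t).toLp _) := by
    refine ofL2_div_eq (fun i => contDiff_radialField (p.contDiff_flux t) i)
      (hasCompactSupport_of_suppBall fun _ hx => radialField_of_notMem (fun _ => p.flux_of_lt t) hx)
      _ _ fun x => ?_
    rw [sum_fderiv_radialField
      ((p.contDiff_flux t).differentiable (by simp) (‖x‖ ^ 2)).hasDerivAt, p.timeDeriv_eq ht]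
    push_cast
    ring
  rw [divForm_sol, ← h1, forceL2]
  simp only [← HNeg1.ofL2L_apply]
  rw [← map_add, ← MemLp.toLp_add]
  congr 1
  refine MemLp.toLp_congr _ _ (Filter.Eventually.of_forall fun x => ?_)
  simp

lemma continuousOn_value_toLp :
    ContinuousOn (fun t => (p.memLp_value t).toLp (fun x => p.value t (‖x‖ ^ 2))) (Set.Iio 1) :=
  continuousOn_toLp (isCompact_suppBall d) (continuousOn_radial p.continuousOn_value)
    (fun t _ hx => p.value_of_lt t (two_lt_of_notMem_suppBall hx)) p.memLp_value

lemma continuousOn_forceL2 : ContinuousOn p.forceL2 (Set.Iio 1) :=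
  continuousOn_toLp (isCompact_suppBall d) (continuousOn_radial p.continuousOn_force)
    (fun t _ hx => p.force_of_lt t (two_lt_of_notMem_suppBall hx)) p.memLp_force

lemma continuousOn_grad_toLp :
    ContinuousOn (fun t => (p.memLp_grad t).toLp (radialField fun σ => 2 * p.valueDeriv t σ))
      (Set.Iio 1) :=
  continuousOn_toLp (isCompact_suppBall d)
    (continuousOn_radialField (h := fun t σ => 2 * p.valueDeriv t σ)
      (show ContinuousOn (fun q : ℝ × ℝ => (2 : ℂ) * Function.uncurry p.valueDeriv q) _ from
        continuousOn_const.mul p.continuousOn_valueDeriv))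
    (fun t _ hx => radialField_of_notMem
      (fun σ hσ => by rw [p.valueDeriv_of_lt t hσ, mul_zero]) hx) p.memLp_grad

lemma continuousOn_flux_toLp :
    ContinuousOn (fun t => (p.memLp_flux t).toLp (radialField (p.flux t))) (Set.Iio 1) :=
  continuousOn_toLp (isCompact_suppBall d) (continuousOn_radialField p.continuousOn_flux)
    (fun t _ hx => radialField_of_notMem (fun _ => p.flux_of_lt t) hx) p.memLp_flux

lemma continuousOn_sol : ContinuousOn p.sol (Set.Iio 1) := by
  rw [Topology.IsInducing.subtypeVal.continuousOn_iff]
  have h := (WithLp.prod_continuous_toLp 2 (L2 d) (L2Vec d)).comp_continuousOn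
    (p.continuousOn_value_toLp.prodMk p.continuousOn_grad_toLp)
  exact h

lemma continuousOn_divForm_sol :
    ContinuousOn (fun t => divForm p.coeff t (p.sol t)) (Set.Iio 1) := by
  simp only [divForm_sol, ← HNeg1.divL_apply]
  exact (HNeg1.divL d).continuous.comp_continuousOn p.continuousOn_flux_toLp

lemma continuousOn_ofL2_forceL2 :
    ContinuousOn (fun t => HNeg1.ofL2 (p.forceL2 t)) (Set.Iio 1) :=
  (HNeg1.ofL2L d).continuous.comp_continuousOn p.continuousOn_forceL2

/-- Since `4γ < d`, there is a `β > 0` with `4(γ + β) < d`; then `|x|^(-2(γ + β))` is square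
integrable on the supporting ball and the separated bounds of `exists_bounds` integrate in `x`. -/
lemma exists_norm_bounds (hd : 0 < d) (hγ : 0 < γ) (hγ' : 4 * γ < d) :
    ∃ A β : ℝ, 0 < A ∧ 0 < β ∧ β < 1 / 2 ∧ ∀ t ∈ Set.Ioo (0 : ℝ) 1,
      ‖p.sol t‖ ≤ A * (1 - t) ^ (β - 1 / 2) ∧
      ‖divForm p.coeff t (p.sol t)‖ ≤ A * (1 - t) ^ (β - 1 / 2) ∧ ‖p.forceL2 t‖ ≤ A := by
  obtain ⟨β, hβ0, hβ1⟩ : ∃ β : ℝ, 0 < β ∧ β < min (1 / 2) ((d - 4 * γ) / 4) :=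
    exists_between (lt_min (by norm_num) (by linarith))
  have hβ2 := hβ1.trans_le (min_le_left _ _)
  have hβ3 := hβ1.trans_le (min_le_right _ _)
  have hq : 4 * (γ + β) < d := by linarith
  obtain ⟨M, hM, hb⟩ := p.exists_bounds hγ hβ0 hβ2
  set J := ballConst d (γ + β) with hJ
  have hJ0 : 0 ≤ J := Real.sqrt_nonneg _
  have hC := p.C_pos
  obtain ⟨c, hc0, hc⟩ : ∃ c : ℝ, 0 ≤ c ∧ ‖H1.grad d‖ = c := ⟨_, ContinuousLinearMap.opNorm_nonneg _, rfl⟩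
  refine ⟨max 1 (3 * M * J + c * (2 * p.C * M * J)), β, by positivity, hβ0, hβ2, fun t ht => ?_⟩
  have hτ : 0 < 1 - t := by linarith [ht.2]
  have hk := one_le_rpow_one_sub hβ2 ht
  set k := (1 - t) ^ (β - 1 / 2) with hkdef
  have e1 : ‖(p.memLp_value t).toLp _‖ ≤ M * J :=
    norm_toLp_le_ballConst hd hq hM.le (p.memLp_value t)
      (fun x hx => p.value_of_lt t (two_lt_of_notMem_suppBall hx))
      fun x h1 h2 => (hb t _ ht.1.le ht.2 h1 h2).1
  have e2 : ‖p.forceL2 t‖ ≤ M * J :=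
    norm_toLp_le_ballConst hd hq hM.le (p.memLp_force t)
      (fun x hx => p.force_of_lt t (two_lt_of_notMem_suppBall hx))
      fun x h1 h2 => (hb t _ ht.1.le ht.2 h1 h2).2.1
  have e3 : ∀ x : EuclideanSpace ℝ (Fin d), 0 < ‖x‖ ^ 2 → ‖x‖ ^ 2 ≤ 2 →
      ‖p.valueDeriv t (‖x‖ ^ 2)‖ * ‖x‖ ≤ M * k * (‖x‖ ^ 2) ^ (-(γ + β)) := fun x h1 h2 => by
    have := (hb t _ ht.1.le ht.2 h1 h2).2.2
    rwa [Real.sqrt_sq (norm_nonneg x)] at this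
  have e4 : ‖(p.memLp_grad t).toLp _‖ ≤ (2 * (M * k)) * J := by
    refine norm_toLp_le_ballConst hd hq (by positivity) (p.memLp_grad t)
      (fun x hx => radialField_of_notMem
        (fun σ hσ => by rw [p.valueDeriv_of_lt t hσ, mul_zero]) hx) fun x h1 h2 => ?_
    have h3 : ‖(2 : ℂ)‖ = 2 := by norm_num
    rw [norm_radialField, norm_mul, h3]
    linarith [e3 x h1 h2]
  have e5 : ‖(p.memLp_flux t).toLp _‖ ≤ (2 * p.C * (M * k)) * J := by
    refine norm_toLp_le_ballConst hd hq (by positivity) (p.memLp_flux t)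
      (fun x hx => radialField_of_notMem (fun _ => p.flux_of_lt t) hx) fun x h1 h2 => ?_
    have h3 : ‖(2 : ℂ)‖ = 2 := by norm_num
    rw [norm_radialField, flux, norm_mul, norm_mul, h3]
    calc 2 * ‖p.a (‖x‖ ^ 2 / (1 - t))‖ * ‖p.valueDeriv t (‖x‖ ^ 2)‖ * ‖x‖
        = 2 * ‖p.a (‖x‖ ^ 2 / (1 - t))‖ * (‖p.valueDeriv t (‖x‖ ^ 2)‖ * ‖x‖) := by ring
      _ ≤ 2 * p.C * (M * k * (‖x‖ ^ 2) ^ (-(γ + β))) := by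
          exact mul_le_mul (mul_le_mul_of_nonneg_left (p.norm_a_le _ (by positivity)) (by norm_num))
            (e3 x h1 h2) (by positivity) (by positivity)
      _ = _ := by ring
  have hMJ : 0 ≤ M * J := by positivity
  refine ⟨?_, ?_, ?_⟩
  · have h1 : ‖p.sol t‖ ≤ ‖(p.memLp_value t).toLp _‖ + ‖(p.memLp_grad t).toLp _‖ := by
      have h2 : ‖p.sol t‖ ^ 2 = ‖(p.memLp_value t).toLp _‖ ^ 2 + ‖(p.memLp_grad t).toLp _‖ ^ 2 :=
        WithLp.prod_norm_sq_eq_of_L2 _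
      refine le_of_sq_le_sq (h2.trans_le ?_) (by positivity)
      nlinarith [norm_nonneg ((p.memLp_value t).toLp _), norm_nonneg ((p.memLp_grad t).toLp _)]
    calc ‖p.sol t‖ ≤ M * J * 1 + 2 * (M * k) * J := by linarith
      _ ≤ M * J * k + 2 * (M * k) * J := by gcongr
      _ = (3 * M * J + 0) * k := by ring
      _ ≤ (3 * M * J + c * (2 * p.C * M * J)) * k := by gcongr; positivity
      _ ≤ _ := by gcongr; exact le_max_right _ _
  · rw [divForm_sol]
    calc ‖HNeg1.div ((p.memLp_flux t).toLp _)‖ ≤ c * ‖(p.memLp_flux t).toLp _‖ :=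
          hc ▸ (norm_neg _).trans_le (norm_innerSLFlip_comp_le _ _)
      _ ≤ c * ((2 * p.C * (M * k)) * J) := by gcongr
      _ = (0 + c * (2 * p.C * M * J)) * k := by ring
      _ ≤ (3 * M * J + c * (2 * p.C * M * J)) * k := by gcongr; positivity
      _ ≤ _ := by gcongr; exact le_max_right _ _
  · refine e2.trans (le_trans ?_ (le_max_right _ _))
    have : 0 ≤ c * (2 * p.C * M * J) := by positivity
    linarith

lemma memLp_sol (hd : 0 < d) (hγ : 0 < γ) (hγ' : 4 * γ < d) : MemLp p.sol 2 timeMeasure := by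
  obtain ⟨A, β, hA, hβ, hβ', hb⟩ := p.exists_norm_bounds hd hγ hγ'
  exact memLp_two_of_norm_le p.continuousOn_sol hβ fun t ht => (hb t ht).1

lemma memLp_forceL2 (hd : 0 < d) (hγ : 0 < γ) (hγ' : 4 * γ < d) : MemLp p.forceL2 ∞ timeMeasure := by
  obtain ⟨A, β, hA, hβ, hβ', hb⟩ := p.exists_norm_bounds hd hγ hγ'
  refine memLp_top_of_bound (aestronglyMeasurable_of_continuousOn_Iio p.continuousOn_forceL2) A ?_
  filter_upwards [ae_restrict_mem measurableSet_Ioo] with t ht using (hb t ht).2.2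

lemma isLionsSolution_sol (hd : 0 < d) (hγ : 0 < γ) (hγ' : 4 * γ < d) :
    IsLionsSolution p.coeff p.forceL2 p.sol := by
  obtain ⟨A, β, hA, hβ, hβ', hb⟩ := p.exists_norm_bounds hd hγ hγ'
  have hdiv : MemLp (fun t => divForm p.coeff t (p.sol t)) 2 timeMeasure :=
    memLp_two_of_norm_le p.continuousOn_divForm_sol hβ fun t ht => (hb t ht).2.1
  have hforce : MemLp (fun t => HNeg1.ofL2 (p.forceL2 t)) 2 timeMeasure := by
    refine memLp_two_of_norm_le (A := ‖H1.toL2 d‖ * A) p.continuousOn_ofL2_forceL2 hβ fun t ht => ?_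
    have h1 : ‖HNeg1.ofL2 (p.forceL2 t)‖ ≤ ‖H1.toL2 d‖ * ‖p.forceL2 t‖ :=
      norm_innerSLFlip_comp_le _ _
    calc _ ≤ ‖H1.toL2 d‖ * A := h1.trans (by gcongr; exact (hb t ht).2.2)
      _ = ‖H1.toL2 d‖ * A * 1 := (mul_one _).symm
      _ ≤ _ := by gcongr; exact one_le_rpow_one_sub hβ' ht
  have idiv := intervalIntegrable_of_memLp_timeMeasure hdiv
  have iforce := intervalIntegrable_of_memLp_timeMeasure hforce
  have isum := idiv.add iforce
  set g : ℝ → HNeg1 d := fun t => divForm p.coeff t (p.sol t) + HNeg1.ofL2 (p.forceL2 t) with hg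
  have hsub : ∀ {t : ℝ}, t ∈ Set.Icc (0 : ℝ) 1 → Set.uIcc 0 t ⊆ Set.uIcc (0 : ℝ) 1 := fun ht => by
    rw [Set.uIcc_of_le ht.1, Set.uIcc_of_le zero_le_one]
    exact Set.Icc_subset_Icc_right ht.2
  -- The representative is defined as the primitive of `div (B ∇u) + f`. It is continuous up to `t =
  -- 1`, where `u` itself blows up, and makes the integrated equation immediate; agreement with `u`
  -- is needed only for `t < 1`.
  refine ⟨p.memLp_sol hd hγ hγ', idiv, iforce, fun t => ∫ s in (0 : ℝ)..t, g s,
    ⟨?_, g, hdiv.add hforce, fun t _ => by simp⟩, ?_, fun t ht => ?_⟩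
  · have hc : ContinuousOn (fun t => ∫ s in (0 : ℝ)..t, g s) (Set.Icc 0 1) := by
      have := intervalIntegral.continuousOn_primitive_interval
        ((intervalIntegrable_iff_integrableOn_Icc_of_le zero_le_one).1 isum |>.mono_set
          (Set.uIcc_of_le zero_le_one).le)
      rwa [Set.uIcc_of_le zero_le_one] at this
    exact memLp_two_of_continuousOn_Icc hc
  · filter_upwards [ae_restrict_mem measurableSet_Ioo] with t ht
    have hsub1 : Set.uIcc 0 t ⊆ Set.Iio (1 : ℝ) := by
      rw [Set.uIcc_of_le ht.1.le]
      exact fun s hs => hs.2.trans_lt ht.2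
    have h1 := toLp_sub_eq_integral isOpen_Iio (isCompact_suppBall d)
      (continuousOn_radial p.continuousOn_timeDeriv)
      (fun t _ hx => p.timeDeriv_of_lt t (two_lt_of_notMem_suppBall hx))
      p.memLp_value p.memLp_timeDeriv
      (fun t ht x => p.hasDerivAt_value_time ht (‖x‖ ^ 2)) hsub1
    -- The factor `t` in the solution gives the initial condition.
    have h0 : (p.memLp_value 0).toLp _ = (0 : L2 d) := by
      refine (Lp.eq_zero_iff_ae_eq_zero).2 ((p.memLp_value 0).coeFn_toLp.trans ?_)
      exact Filter.Eventually.of_forall fun x => by simp [value]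
    rw [h0, sub_zero] at h1
    have hcont : ContinuousOn (fun t => (p.memLp_timeDeriv t).toLp
        (fun x => p.timeDeriv t (‖x‖ ^ 2))) (Set.uIcc 0 t) :=
      (continuousOn_toLp (isCompact_suppBall d) (continuousOn_radial p.continuousOn_timeDeriv)
        (fun t _ hx => p.timeDeriv_of_lt t (two_lt_of_notMem_suppBall hx))
        p.memLp_timeDeriv).mono hsub1
    rw [toL2_sol, h1, ← HNeg1.ofL2L_apply,
      ← (HNeg1.ofL2L d).intervalIntegral_comp_comm hcont.intervalIntegrable]
    exact intervalIntegral.integral_congr fun s hs => (p.ofL2_timeDeriv (hsub1 hs)).symm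
  · change (∫ s in (0 : ℝ)..t, (divForm p.coeff s (p.sol s) + HNeg1.ofL2 (p.forceL2 s)))
      - _ = _
    rw [intervalIntegral.integral_add (idiv.mono_set (hsub ht)) (iforce.mono_set (hsub ht)),
      add_sub_cancel_left]

end SelfSimilarProfile

/-- The theorem speaks of classes in `Lp`, whose chosen representatives agree with the explicit
curves only almost everywhere. -/
lemma IsLionsSolution.congr {d : ℕ} {B : Coeff d} {f f' : ℝ → L2 d} {u u' : ℝ → H1 d}
    (h : IsLionsSolution B f u) (hf : f =ᵐ[timeMeasure] f') (hu : u =ᵐ[timeMeasure] u') :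
    IsLionsSolution B f' u' := by
  have hIoc : timeMeasure = volume.restrict (Set.Ioc (0 : ℝ) 1) :=
    Measure.restrict_congr_set Ioo_ae_eq_Ioc
  have key : ∀ {X : Type} [NormedAddCommGroup X] [NormedSpace ℝ X] {a b : ℝ → X},
      (a =ᵐ[timeMeasure] b) → (IntervalIntegrable a volume 0 1 → IntervalIntegrable b volume 0 1) ∧
      ∀ t ∈ Set.Icc (0 : ℝ) 1, ∫ s in (0 : ℝ)..t, a s = ∫ s in (0 : ℝ)..t, b s := by
    intro X _ _ a b hab
    rw [hIoc] at hab
    refine ⟨fun ha => ha.congr_ae (by rwa [Set.uIoc_of_le zero_le_one]), fun t ht => ?_⟩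
    rw [intervalIntegral.integral_of_le ht.1, intervalIntegral.integral_of_le ht.1]
    exact integral_congr_ae
      (ae_restrict_of_ae_restrict_of_subset (Set.Ioc_subset_Ioc_right ht.2) hab)
  have hdiv : (fun s => divForm B s (u s)) =ᵐ[timeMeasure] fun s => divForm B s (u' s) := by
    filter_upwards [hu] with t ht
    rw [ht]
  have hforce : (fun s => HNeg1.ofL2 (f s)) =ᵐ[timeMeasure] fun s => HNeg1.ofL2 (f' s) := by
    filter_upwards [hf] with t ht
    rw [ht]
  obtain ⟨U, hU, hUu, hUeq⟩ := h.exists_representative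
  refine ⟨(memLp_congr_ae hu).1 h.memLp, (key hdiv).1 h.integrable_divForm,
    (key hforce).1 h.integrable_force, U, hU, ?_, fun t ht => ?_⟩
  · filter_upwards [hUu, hu] with t h1 h2
    rw [h1, h2]
  · rw [← (key hdiv).2 t ht, ← (key hforce).2 t ht]
    exact hUeq t ht

/-! ### The solution leaves `L^r(L^s)` -/

/-- If this were finite, `(t - 1)⁻¹` would be interval integrable up to its pole. -/
lemma lintegral_inv_one_sub_eq_top {κ : ℝ} (hκ : 0 < κ) :
    ∫⁻ t in Set.Ioo (1 / 2 : ℝ) 1, ENNReal.ofReal (κ * (1 - t)⁻¹) = ⊤ := by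
  by_contra h
  have hm : AEStronglyMeasurable (fun t : ℝ => κ * (1 - t)⁻¹)
      (volume.restrict (Set.Ioo (1 / 2 : ℝ) 1)) :=
    (by fun_prop : Measurable fun t : ℝ => κ * (1 - t)⁻¹).aestronglyMeasurable
  have h1 : IntegrableOn (fun t : ℝ => κ * (1 - t)⁻¹) (Set.Ioo (1 / 2 : ℝ) 1) := by
    refine (lintegral_ofReal_ne_top_iff_integrable hm ?_).1 h
    filter_upwards [ae_restrict_mem measurableSet_Ioo] with t ht
    have : 0 < 1 - t := by linarith [ht.2]
    simp only [Pi.zero_apply]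
    positivity
  have h2 : IntegrableOn (fun t : ℝ => (t - 1)⁻¹) (Set.Ioo (1 / 2 : ℝ) 1) := by
    refine (h1.const_mul (-κ⁻¹)).congr (Filter.Eventually.of_forall fun t => ?_)
    have : (t - 1)⁻¹ = -(1 - t)⁻¹ := by rw [← inv_neg, neg_sub]
    simp only [this]
    field_simp
  have h3 : IntervalIntegrable (fun t : ℝ => (t - 1)⁻¹) volume (1 / 2) 1 :=
    (intervalIntegrable_iff_integrableOn_Ioo_of_le (by norm_num)).2 h2
  rw [intervalIntegrable_sub_inv_iff] at h3
  rcases h3 with h3 | h3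
  · norm_num at h3
  · exact h3 Set.right_mem_uIcc

lemma ofReal_mul_volume_ball_rpow_le_eLpNorm {d : ℕ} {s c ρ : ℝ} (hs : 0 < s) (hρ : 0 < ρ)
    (hc : 0 ≤ c) {F : EuclideanSpace ℝ (Fin d) → ℂ} (hF : ∀ x ∈ Metric.ball 0 ρ, c ≤ ‖F x‖) :
    ENNReal.ofReal (c * (ρ ^ d * (volume (Metric.ball (0 : EuclideanSpace ℝ (Fin d)) 1)).toReal)
      ^ (1 / s)) ≤ eLpNorm F (ENNReal.ofReal s) volume := by
  have hp0 : ENNReal.ofReal s ≠ 0 := by simpa using hs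
  have h1 : eLpNorm ((Metric.ball (0 : EuclideanSpace ℝ (Fin d)) ρ).indicator fun _ => c)
      (ENNReal.ofReal s) volume ≤ eLpNorm F (ENNReal.ofReal s) volume := by
    refine eLpNorm_mono fun x => ?_
    by_cases hx : x ∈ Metric.ball (0 : EuclideanSpace ℝ (Fin d)) ρ
    · rw [Set.indicator_of_mem hx, Real.norm_of_nonneg hc]; exact hF x hx
    · rw [Set.indicator_of_notMem hx, norm_zero]; exact norm_nonneg _
  refine le_trans (le_of_eq ?_) h1
  have hv : volume (Metric.ball (0 : EuclideanSpace ℝ (Fin d)) 1) ≠ ⊤ := measure_ball_lt_top.ne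
  rw [eLpNorm_indicator_const measurableSet_ball hp0 ENNReal.ofReal_ne_top,
    ENNReal.toReal_ofReal hs.le, Measure.addHaar_ball_of_pos _ _ hρ, finrank_euclideanSpace_fin,
    Real.enorm_eq_ofReal hc, ENNReal.ofReal_mul hc, ← ENNReal.ofReal_rpow_of_nonneg (by positivity)
      (by positivity), ENNReal.ofReal_mul (by positivity), ENNReal.ofReal_toReal hv]

namespace SelfSimilarProfile

variable {d : ℕ} {γ : ℝ} (p : SelfSimilarProfile d γ)

lemma exists_norm_φ_ge : ∃ s₀ : ℝ, 0 < s₀ ∧ s₀ ≤ 1 ∧ ∀ s, 0 ≤ s → s ≤ s₀ →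
    ‖p.φ 0‖ / 2 ≤ ‖p.φ s‖ := by
  have h0 : 0 < ‖p.φ 0‖ := norm_pos_iff.2 p.φ_zero
  have h1 : ∀ᶠ s in nhds (0 : ℝ), ‖p.φ 0‖ / 2 < ‖p.φ s‖ :=
    p.contDiff_φ.continuous.norm.continuousAt.eventually (lt_mem_nhds (by linarith))
  obtain ⟨ε, hε, h2⟩ := Metric.eventually_nhds_iff.1 h1
  refine ⟨min 1 (ε / 2), by positivity, min_le_left _ _, fun s hs hs' => (h2 ?_).le⟩
  rw [Real.dist_eq, sub_zero, abs_of_nonneg hs]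
  have := hs'.trans (min_le_right _ _)
  linarith

/-- On the ball of radius `√(s₀ (1 - t))` the similarity variable stays below `s₀`, where `|φ| ≥ |φ
0| / 2`, and the cutoff equals `1`. The volume contributes `(1 - t)^(d/(2s))` and the amplitude `(1
- t)^(-γ)`. Times above `1/2` keep the factor `t` away from zero. -/
lemma exists_eLpNorm_ge {r s : ℝ} (hs : 0 < s) (hγ : γ = 1 / r + d / (2 * s)) :
    ∃ κ : ℝ, 0 < κ ∧ ∀ t ∈ Set.Ioo (1 / 2 : ℝ) 1,
      ENNReal.ofReal (κ * (1 - t) ^ (-(1 / r)))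
        ≤ eLpNorm (H1.toL2 d (p.sol t)) (ENNReal.ofReal s) volume := by
  obtain ⟨s₀, hs₀, hs₀1, hφ⟩ := p.exists_norm_φ_ge
  have h0 : 0 < ‖p.φ 0‖ := norm_pos_iff.2 p.φ_zero
  set v := (volume (Metric.ball (0 : EuclideanSpace ℝ (Fin d)) 1)).toReal with hv
  have hvpos : 0 < v := ENNReal.toReal_pos (Metric.measure_ball_pos _ _ one_pos).ne'
    measure_ball_lt_top.ne
  refine ⟨1 / 2 * (‖p.φ 0‖ / 2) * (s₀ ^ ((d : ℝ) / 2) * v) ^ (1 / s), by positivity,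
    fun t ht => ?_⟩
  have hτ : 0 < 1 - t := by linarith [ht.2]
  have ht0 : 0 ≤ t := by linarith [ht.1]
  rw [toL2_sol, eLpNorm_congr_ae (p.memLp_value t).coeFn_toLp]
  set ρ := √(s₀ * (1 - t)) with hρ
  refine le_trans (le_of_eq ?_) (ofReal_mul_volume_ball_rpow_le_eLpNorm (ρ := ρ)
    (c := 1 / 2 * (1 - t) ^ (-γ) * (‖p.φ 0‖ / 2)) hs (Real.sqrt_pos.2 (by positivity)) (by positivity) ?_)
  · congr 1
    have e1 : ρ ^ d = s₀ ^ ((d : ℝ) / 2) * (1 - t) ^ ((d : ℝ) / 2) := by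
      rw [hρ, Real.sqrt_eq_rpow, ← Real.rpow_natCast, ← Real.rpow_mul (by positivity),
        Real.mul_rpow hs₀.le hτ.le]
      congr 2 <;> ring
    have e2 : (ρ ^ d * v) ^ (1 / s)
        = (s₀ ^ ((d : ℝ) / 2) * v) ^ (1 / s) * (1 - t) ^ ((d : ℝ) / (2 * s)) := by
      rw [e1, mul_right_comm, Real.mul_rpow (by positivity) (by positivity),
        ← Real.rpow_mul hτ.le]
      congr 2
      field_simp
    have e3 : (1 - t) ^ (-(1 / r)) = (1 - t) ^ (-γ) * (1 - t) ^ ((d : ℝ) / (2 * s)) := by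
      rw [← Real.rpow_add hτ]
      congr 1
      rw [hγ]; ring
    rw [e2, e3]
    ring
  · intro x hx
    have hx1 : ‖x‖ < ρ := mem_ball_zero_iff.1 hx
    have hx2 : ‖x‖ ^ 2 ≤ s₀ * (1 - t) := by
      rw [← Real.sq_sqrt (by positivity : 0 ≤ s₀ * (1 - t))]
      gcongr
    have hx3 : ‖x‖ ^ 2 / (1 - t) ≤ s₀ := (div_le_iff₀ hτ).2 hx2
    have hx4 : ‖x‖ ^ 2 ≤ 1 := by nlinarith
    rw [value, cutoff_of_le hx4, Complex.ofReal_one, one_mul, norm_mul, Complex.norm_real,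
      Real.norm_of_nonneg (by positivity)]
    gcongr
    · exact ht.1.le
    · exact hφ _ (by positivity) hx3

lemma not_memLrLs_sol {r s : ℝ} (hr : 0 < r) (hs : 0 < s) (hγ : γ = 1 / r + d / (2 * s)) :
    ¬ MemLrLs r s (fun t => H1.toL2 d (p.sol t)) := by
  obtain ⟨κ, hκ, h⟩ := p.exists_eLpNorm_ge hs hγ
  intro hmem
  refine absurd hmem (not_lt.2 ?_)
  -- The `r`-th power of the lower bound is `κ ^ r (1 - t)⁻¹`.
  rw [← lintegral_inv_one_sub_eq_top (κ := κ ^ r) (by positivity)]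
  refine le_trans (setLIntegral_mono_ae' measurableSet_Ioo (Filter.Eventually.of_forall
    fun t ht => ?_)) (lintegral_mono_set (Set.Ioo_subset_Ioo_left (by norm_num)))
  have hτ : 0 < 1 - t := by linarith [ht.2]
  refine le_trans (le_of_eq ?_) (ENNReal.rpow_le_rpow (h t ht) hr.le)
  rw [ENNReal.ofReal_rpow_of_nonneg (by positivity) hr.le, Real.mul_rpow hκ.le (by positivity),
    ← Real.rpow_mul hτ.le]
  congr 2
  rw [show -(1 / r) * r = -1 by field_simp, Real.rpow_neg_one]

end SelfSimilarProfile

lemma MemLrLs.congr {d : ℕ} {r s : ℝ} {w w' : ℝ → L2 d} (h : MemLrLs r s w)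
    (hw : w =ᵐ[timeMeasure] w') : MemLrLs r s w' := by
  refine (lintegral_congr_ae ?_).symm.trans_lt h
  filter_upwards [hw] with t ht
  rw [ht]

end Parabolic

theorem mainTheorem1 (d : ℕ) (hd : 2 ≤ d) (r s : ℝ) (hr : 1 < r) (hs : 1 < s)
    (hrs : 2 / r + (d : ℝ) / s < (d : ℝ) / 2) :
    ∃ (B : Parabolic.Coeff d) (f : Lp (Parabolic.L2 d) ∞ Parabolic.timeMeasure),
      Parabolic.IsElliptic B ∧
      ∃ u : Lp (Parabolic.H1 d) 2 Parabolic.timeMeasure,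
        Parabolic.IsLionsSolution B f u ∧
        (∀ v : Lp (Parabolic.H1 d) 2 Parabolic.timeMeasure,
          Parabolic.IsLionsSolution B f v → v = u) ∧
        ¬ Parabolic.MemLrLs r s (fun t => Parabolic.H1.toL2 d (u t)) := by
  have hd' : (2 : ℝ) ≤ d := by exact_mod_cast hd
  have hd0 : 0 < d := by omega
  have hr0 : 0 < r := by linarith
  have hs0 : 0 < s := by linarith
  -- This is the critical exponent, for which `‖u(t)‖` in `L^s` is at least `κ (1 - t)^(-1/r)`; the
  -- assumption on `r` and `s` becomes `4γ < d`.
  obtain ⟨γ, hγ⟩ : ∃ γ : ℝ, γ = 1 / r + d / (2 * s) := ⟨_, rfl⟩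
  have hγ0 : 0 < γ := by rw [hγ]; positivity
  have hγd : 4 * γ < d := by
    have : 4 * γ = 2 * (2 / r + d / s) := by rw [hγ]; field_simp; ring
    linarith
  obtain ⟨p⟩ := Parabolic.exists_selfSimilarProfile d γ hd' hγ0 (by linarith)
  have hu := p.memLp_sol hd0 hγ0 hγd
  have hf := p.memLp_forceL2 hd0 hγ0 hγd
  have hsol : Parabolic.IsLionsSolution p.coeff (hf.toLp _) (hu.toLp _) :=
    (p.isLionsSolution_sol hd0 hγ0 hγd).congr hf.coeFn_toLp.symm hu.coeFn_toLp.symm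
  refine ⟨p.coeff, hf.toLp _, p.isElliptic_coeff, hu.toLp _, hsol,
    fun v hv => Lp.ext (hsol.ae_eq p.isElliptic_coeff hv), fun hmem => ?_⟩
  refine p.not_memLrLs_sol hr0 hs0 hγ (hmem.congr ?_)
  filter_upwards [hu.coeFn_toLp] with t ht
  rw [ht]
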